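/- Let $u:[0,\infty)\to\mathbb R$ be continuous with $\int_0^\infty(1+x^2)|u(x)|\,dx<\infty$. For $k\in\mathbb C$ let $\phi(x,k)$, and for $\operatorname{Im}k\ge 0$ let $\psi(x,k)$, $x\ge 0$, be the solutions of $$\phi(x,k)=e^{-ikx}-\frac1k\int_0^x\sin k(x-\xi)\,u(\xi)\phi(\xi,k)\,d\xi,\qquad \psi(x,k)=e^{ikx}+\frac1k\int_x^\infty\sin k(x-\xi)\,u(\xi)\psi(\xi,k)\,d\xi,$$ continuous in $x\ge0$, with $\psi(x,k)e^{-ikx}$ bounded in $x$, where $\frac1k\sin k(x-\xi)$ is read as $x-\xi$ for $k=0$. For $k\neq0$, $\operatorname{Im}k\ge0$, put $$a(k)=\frac{1}{2ik}\,(\phi\psi_x-\psi\phi_x),$$ which is independent of $x$. Assume that $a(k)\ne0$ for all $k\neq0$ with $\operatorname{Im}k\ge0$. Let $q(x,y)$ be a real-valued function that is $C^2$ on $[0,\infty)^2$ up to the boundary, satisfies $$q_{xx}+q_{yy}+u(x)q=0,\qquad x>0,\ y>0,$$ and is such that $|q|+|q_x|+|q_y|\le C(1+x+y)^{-p}$ on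 $[0,\infty)^2$ for some constants $C$ and $p>2$. Define $$g_0(k)=\int_0^\infty e^{ky}q(0,y)\,dy\quad(\operatorname{Re}k\le0),\qquad f_0(k)=\int_0^\infty q(x,0)\phi(x,k)\,dx-\frac{\phi(0,k)}{\psi(0,k)}\int_0^\infty q(x,0)\psi(x,k)\,dx,$$ $$\rho(k)=\frac{f_0(k)}{ia(k)}+\frac{g_0(-k)}{\psi(0,k)}\qquad(k>0).$$ Then $\psi(0,k)\neq0$ for all $\operatorname{Im}k\ge0$, and the following hold. 1. For all $x>0$, $y>0$, $$q(x,y)=-\frac1{2i\pi}\int_0^\infty e^{-ky}\bigl(\rho(k)\psi(x,k)-\overline{\rho(k)}\,\overline{\psi(x,k)}\bigr)\,dk+\frac1{2i\pi}\int_0^{i\infty}\frac{\psi(x,k)}{\psi(0,k)}\bigl(e^{-ky}g_0(k)+e^{ky}g_0(-k)\bigr)\,dk,$$ both integrals being absolutely convergent. 2. For every $k$ with $\operatorname{Re}k\le0$ for which $e^{|\operatorname{Im}k|x}q(x,0)$ and $e^{|\operatorname{Im}k|x}q_y(x,0)$ are integrable over $x\in(0,\infty)$ (in particular for every real $k\le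 0$), $$\int_0^\infty[kq(x,0)-q_y(x,0)]\,\phi(x,k)\,dx+\int_0^\infty e^{ky}[q(0,y)\phi_x(0,k)-q_x(0,y)\phi(0,k)]\,dy=0.$$ 3. For every $k$ with $\operatorname{Im}k\ge0$ for which $e^{\max(\operatorname{Re}k,0)y}q(0,y)$ and $e^{\max(\operatorname{Re}k,0)y}q_x(0,y)$ are integrable over $y\in(0,\infty)$ (in particular whenever $\operatorname{Re}k\le0$), $$\int_0^\infty[kq(x,0)-q_y(x,0)]\,\psi(x,k)\,dx+\int_0^\infty e^{ky}[q(0,y)\psi_x(0,k)-q_x(0,y)\psi(0,k)]\,dy=0.$$ All integrals in 2 and 3 converge absolutely. -/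

import Mathlib

open Set MeasureTheory

namespace QuarterPlane

noncomputable section

/-- The kernel `sin (k t) / k`, extended to `k = 0` by its limit `t`. -/
def sinKernel (k : ℂ) (t : ℝ) : ℂ :=
  if k = 0 then (t : ℂ) else Complex.sin (k * t) / k

/-- `f` is, on `[0, ∞)`, the solution normalised at `x = 0` of `f'' + (u + k²) f = 0`:
`f x = e^{-ikx} - (1/k) ∫₀ˣ sin (k (x - ξ)) u(ξ) f(ξ) dξ`. -/
def IsPhi (u : ℝ → ℝ) (k : ℂ) (f : ℝ → ℂ) : Prop :=
  ContinuousOn f (Ici 0) ∧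
  ∀ x : ℝ, 0 ≤ x →
    f x = Complex.exp (-(Complex.I * k * x))
      - ∫ ξ in (0 : ℝ)..x, sinKernel k (x - ξ) * (u ξ : ℂ) * f ξ

/-- `f` is, on `[0, ∞)`, the Jost solution (normalised at `x = ∞`, for `Im k ≥ 0`) of
`f'' + (u + k²) f = 0`, i.e. `f x e^{-ikx}` is bounded and
`f x = e^{ikx} + (1/k) ∫ₓ^∞ sin (k (x - ξ)) u(ξ) f(ξ) dξ`. -/
def IsPsi (u : ℝ → ℝ) (k : ℂ) (f : ℝ → ℂ) : Prop :=
  ContinuousOn f (Ici 0) ∧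
  (∃ C : ℝ, ∀ x : ℝ, 0 ≤ x → ‖f x‖ ≤ C * Real.exp (-(k.im * x))) ∧
  ∀ x : ℝ, 0 ≤ x →
    f x = Complex.exp (Complex.I * k * x)
      + ∫ ξ in Ioi x, sinKernel k (x - ξ) * (u ξ : ℂ) * f ξ

/-- The solution `φ(·, k)` of the Volterra equation `IsPhi` (unique on `[0, ∞)`; its values at
negative arguments are irrelevant). -/
def phi (u : ℝ → ℝ) (k : ℂ) : ℝ → ℂ := Classical.epsilon (IsPhi u k)

/-- The solution `ψ(·, k)`, `Im k ≥ 0`, of the Volterra equation `IsPsi` (unique on `[0, ∞)`;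
its values at negative arguments are irrelevant). -/
def psi (u : ℝ → ℝ) (k : ℂ) : ℝ → ℂ := Classical.epsilon (IsPsi u k)

/-- `φ_x(0, k)`. -/
def phiX0 (u : ℝ → ℝ) (k : ℂ) : ℂ := derivWithin (phi u k) (Ici 0) 0

/-- `ψ_x(0, k)`. -/
def psiX0 (u : ℝ → ℝ) (k : ℂ) : ℂ := derivWithin (psi u k) (Ici 0) 0

/-- `a(k) = (φ ψ_x - ψ φ_x) / (2ik)`, `k ≠ 0`; the Wronskian does not depend on `x` and is
evaluated at `x = 0`. -/
def jostA (u : ℝ → ℝ) (k : ℂ) : ℂ :=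
  (phi u k 0 * psiX0 u k - psi u k 0 * phiX0 u k) / (2 * Complex.I * k)

/-- `q_x(x, y)` for `x, y ≥ 0` (one-sided at `x = 0`). -/
def partialX (q : ℝ → ℝ → ℝ) (x y : ℝ) : ℝ := derivWithin (fun s => q s y) (Ici 0) x

/-- `q_y(x, y)` for `x, y ≥ 0` (one-sided at `y = 0`). -/
def partialY (q : ℝ → ℝ → ℝ) (x y : ℝ) : ℝ := derivWithin (fun t => q x t) (Ici 0) y

/-- `q` solves `q_xx + q_yy + u(x) q = 0` classically in the open quarter plane. -/
def SolvesPDE (u : ℝ → ℝ) (q : ℝ → ℝ → ℝ) : Prop :=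
  ∀ x y : ℝ, 0 < x → 0 < y →
    iteratedDeriv 2 (fun s => q s y) x + iteratedDeriv 2 (fun t => q x t) y + u x * q x y = 0

/-- `q`, `q_x`, `q_y` are `O((1 + x + y)^{-p})` on the closed quarter plane for some `p > 2`. -/
def HasDecay (q : ℝ → ℝ → ℝ) : Prop :=
  ∃ C p : ℝ, 2 < p ∧ ∀ x y : ℝ, 0 ≤ x → 0 ≤ y →
    |q x y| + |partialX q x y| + |partialY q x y| ≤ C * (1 + x + y) ^ (-p)

/-- `g₀(k) = ∫₀^∞ e^{ky} q(0, y) dy`. -/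
def g0 (q : ℝ → ℝ → ℝ) (k : ℂ) : ℂ :=
  ∫ y in Ioi (0 : ℝ), Complex.exp (k * y) * (q 0 y : ℂ)

/-- `f₀(k) = ∫₀^∞ q(x, 0) φ(x, k) dx - (φ(0, k) / ψ(0, k)) ∫₀^∞ q(x, 0) ψ(x, k) dx`. -/
def f0 (u : ℝ → ℝ) (q : ℝ → ℝ → ℝ) (k : ℂ) : ℂ :=
  (∫ x in Ioi (0 : ℝ), (q x 0 : ℂ) * phi u k x)
    - phi u k 0 / psi u k 0 * ∫ x in Ioi (0 : ℝ), (q x 0 : ℂ) * psi u k x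

/-- `ρ(k) = f₀(k) / (i a(k)) + g₀(-k) / ψ(0, k)`. -/
def rho (u : ℝ → ℝ) (q : ℝ → ℝ → ℝ) (k : ℂ) : ℂ :=
  f0 u q k / (Complex.I * jostA u k) + g0 q (-k) / psi u k 0

/-- The integrand on the positive real axis:
`e^{-ky} (ρ(k) ψ(x, k) - conj ρ(k) conj ψ(x, k))`. -/
def realAxisIntegrand (u : ℝ → ℝ) (q : ℝ → ℝ → ℝ) (x y : ℝ) (k : ℂ) : ℂ :=
  Complex.exp (-(k * y)) *
    (rho u q k * psi u k x - (starRingEnd ℂ) (rho u q k) * (starRingEnd ℂ) (psi u k x))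

/-- The integrand on the positive imaginary axis:
`(ψ(x, k) / ψ(0, k)) (e^{-ky} g₀(k) + e^{ky} g₀(-k))`. -/
def imagAxisIntegrand (u : ℝ → ℝ) (q : ℝ → ℝ → ℝ) (x y : ℝ) (k : ℂ) : ℂ :=
  psi u k x / psi u k 0 *
    (Complex.exp (-(k * y)) * g0 q k + Complex.exp (k * y) * g0 q (-k))

end

end QuarterPlane

open QuarterPlane

/-! The engine is Green's identity for `q` and a separated function w(x)v(y) with w'' + (u + k²)w =
0 and v'' = k²v. The field (v(q_x w - q w'), w(q_y v - q v')) is divergence free, and the decay of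
`q` removes the edges of the quarter plane at infinity. The choice v = e^{ky} gives the global
relations directly where everything converges: for w = φ with k ≤ 0 real, for w = ψ with Re k ≤ 0.
The remaining k follow by analytic continuation, and boundary points by continuity
(`HolCont.eq_zero_of_frequently`).

The representation comes from v = sin(ly), k = il. Since v(0) = 0, the unknown q_y(x,0) drops out.
Green's identity with ψ on [x, ∞) and with the regular solution s (s(0) = 0, s'(0) = 1) on [0, x]
gives `sineTransform_eq`: the sine transform Q(x,l) of q(x,·) equals (ψ(x,il)/ψ(0,il)) Q(0,l) + l
H(il), where H is the Dirichlet resolvent of the half line applied to q(·,0). The sine transform is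
inverted by Abel summation with the factor e^{-εl}; by Fubini this is convolution with Poisson
kernels. The integral of e^{-εl} sin(ly) l H(il) is the imaginary part of an integral of e^{(iε-y)k}
k H(k), which rotates from the imaginary to the real axis. There e^{-yk} gives convergence uniformly
in ε, so ε can go to 0 (`sine_representation`).

It remains to recognise ρ. On the real axis H - conj H is a multiple of s(x) ∫ q(ξ,0) s(ξ) dξ, and
the combination of φ and ψ in f₀/a reduces to the same integral (`forcedPart_sub_conj`, `rho_eq`).
The contributions of g₀(-k)ψ(x,k)/ψ(0,k) along the two axes cancel by a second rotation.

All this needs ψ(0,k) ≠ 0. For real k ≠ 0 it follows from the Wronskian of ψ(·,k) and ψ(·,-k); off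
both axes from self-adjointness, as k² is not real. On the imaginary axis, k = 0 included, it uses a
≠ 0: the sign of a(iκ) for large κ persists, so ψ_x(0,iκ₀) ≤ 0 at the largest zero κ₀ of ψ(0,iκ).
Lagrange's identity between κ > κ₀ and κ₀ then bounds an integral of positive type by a nonpositive
number, which fails as κ → κ₀.

The functions φ, s and ψ, with their holomorphy and bounds, come from Neumann series in weighted
norms in which the Volterra operators contract by 1/2 (`VolterraKernel`). -/

namespace QuarterPlane

open Filter Topology

/-! ### Holomorphy of integrals depending on a parameter. -/

/-- `f` is continuous on `Ω` and holomorphic on `U`. -/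
structure HolCont (U Ω : Set ℂ) (f : ℂ → ℂ) : Prop where
  cont : ContinuousOn f Ω
  diff : DifferentiableOn ℂ f U

namespace HolCont

variable {U Ω : Set ℂ} {f g : ℂ → ℂ}

theorem of_differentiable (hf : Differentiable ℂ f) : HolCont U Ω f :=
  ⟨hf.continuous.continuousOn, hf.differentiableOn⟩

theorem add (hf : HolCont U Ω f) (hg : HolCont U Ω g) : HolCont U Ω (fun k => f k + g k) :=
  ⟨hf.cont.add hg.cont, hf.diff.add hg.diff⟩

theorem sub (hf : HolCont U Ω f) (hg : HolCont U Ω g) : HolCont U Ω (fun k => f k - g k) :=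
  ⟨hf.cont.sub hg.cont, hf.diff.sub hg.diff⟩

theorem mul (hf : HolCont U Ω f) (hg : HolCont U Ω g) : HolCont U Ω (fun k => f k * g k) :=
  ⟨hf.cont.mul hg.cont, hf.diff.mul hg.diff⟩

theorem div (hf : HolCont U Ω f) (hg : HolCont U Ω g) (hUΩ : U ⊆ Ω) (h0 : ∀ k ∈ Ω, g k ≠ 0) :
    HolCont U Ω (fun k => f k / g k) :=
  ⟨hf.cont.div hg.cont h0, hf.diff.div hg.diff fun k hk => h0 k (hUΩ hk)⟩

theorem mono (hf : HolCont U Ω f) {U' Ω' : Set ℂ} (hU : U' ⊆ U) (hΩ : Ω' ⊆ Ω) :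
    HolCont U' Ω' f :=
  ⟨hf.cont.mono hΩ, hf.diff.mono hU⟩

theorem congr (hf : HolCont U Ω f) (hUΩ : U ⊆ Ω) (h : ∀ k ∈ Ω, g k = f k) : HolCont U Ω g :=
  ⟨hf.cont.congr h, hf.diff.congr fun k hk => h k (hUΩ hk)⟩

end HolCont

section ParametricIntegrals

variable {α : Type*} [MeasurableSpace α] {μ : Measure α}

theorem continuousOn_integral_of_locally_dominated {X : Type*} [TopologicalSpace X]
    [FirstCountableTopology X] {F : X → α → ℂ} {S : Set X}
    (hmeas : ∀ p ∈ S, AEStronglyMeasurable (F p) μ)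
    (hcont : ∀ᵐ a ∂μ, ContinuousOn (fun p => F p a) S)
    (hdom : ∀ p₀ ∈ S, ∃ B : α → ℝ, Integrable B μ ∧ ∃ V ∈ 𝓝[S] p₀,
      ∀ᵐ a ∂μ, ∀ p ∈ V, ‖F p a‖ ≤ B a) :
    ContinuousOn (fun p => ∫ a, F p a ∂μ) S := by
  intro p₀ hp₀
  obtain ⟨B, hB, V, hV, hle⟩ := hdom p₀ hp₀
  refine continuousWithinAt_of_dominated (bound := B) ?_ ?_ hB ?_
  · filter_upwards [self_mem_nhdsWithin] with p hp using hmeas p hp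
  · filter_upwards [hV] with p hp
    filter_upwards [hle] with a ha using ha p hp
  · filter_upwards [hcont] with a ha using ha p₀ hp₀

/-- Cauchy's estimate on discs of radius r/4 turns the bound B on the integrand into the bound
B/(r/4) on its k-derivative, so no hypothesis on the derivative is required. -/
theorem differentiableOn_integral_of_locally_dominated {F : ℂ → α → ℂ} {U : Set ℂ}
    (hU : IsOpen U) (hmeas : ∀ k ∈ U, AEStronglyMeasurable (F k) μ)
    (hdiff : ∀ᵐ a ∂μ, DifferentiableOn ℂ (fun k => F k a) U)
    (hdom : ∀ k₀ ∈ U, ∃ B : α → ℝ, Integrable B μ ∧ ∃ V ∈ 𝓝[U] k₀,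
      ∀ᵐ a ∂μ, ∀ k ∈ V, ‖F k a‖ ≤ B a) :
    DifferentiableOn ℂ (fun k => ∫ a, F k a ∂μ) U := by
  intro k₀ hk₀
  obtain ⟨B, hB, V, hV, hle⟩ := hdom k₀ hk₀
  rw [hU.nhdsWithin_eq hk₀] at hV
  obtain ⟨r, hr, hball⟩ := Metric.mem_nhds_iff.1 (inter_mem hV (hU.mem_nhds hk₀))
  have hball' : ∀ k ∈ Metric.ball k₀ (r / 2), ∀ z ∈ Metric.closedBall k (r / 4),
      z ∈ V ∧ z ∈ U := by
    intro k hk z hz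
    refine hball ?_
    rw [Metric.mem_ball] at hk ⊢
    rw [Metric.mem_closedBall] at hz
    linarith [dist_triangle z k k₀]
  have hself : ∀ k : ℂ, k ∈ Metric.closedBall k (r / 4) :=
    fun k => Metric.mem_closedBall_self (by positivity)
  have hk₀' : k₀ ∈ Metric.ball k₀ (r / 2) := Metric.mem_ball_self (by positivity)
  -- The derivative is measurable in a as a pointwise limit of difference quotients along k₀ +
  -- (r/4)/(n+1), a sequence that stays in the disc where F is controlled.
  have hderiv_meas : AEStronglyMeasurable (fun a => deriv (fun k => F k a) k₀) μ := by
    have hlim : Tendsto (fun n : ℕ => k₀ + (((r / 4) / ((n : ℝ) + 1) : ℝ) : ℂ)) atTop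
        (𝓝[≠] k₀) := by
      rw [tendsto_nhdsWithin_iff]
      constructor
      · have h1 : Tendsto (fun n : ℕ => (r / 4) / ((n : ℝ) + 1)) atTop (𝓝 0) :=
          tendsto_const_nhds.div_atTop
            (tendsto_atTop_add_const_right _ _ tendsto_natCast_atTop_atTop)
        have h2 := (Complex.continuous_ofReal.tendsto 0).comp h1
        simpa using h2.const_add k₀
      · refine Eventually.of_forall fun n => ?_
        have : ((r / 4) / ((n : ℝ) + 1) : ℝ) ≠ 0 := by positivity
        simp only [mem_compl_iff, mem_singleton_iff, add_eq_left]
        exact_mod_cast this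
    refine aestronglyMeasurable_of_tendsto_ae atTop
      (f := fun (n : ℕ) a => slope (fun k => F k a) k₀
        (k₀ + (((r / 4) / ((n : ℝ) + 1) : ℝ) : ℂ))) (fun n => ?_) ?_
    · simp only [slope_def_field]
      refine AEStronglyMeasurable.mul (AEStronglyMeasurable.sub (hmeas _ ?_) (hmeas _ hk₀))
        aestronglyMeasurable_const
      refine (hball' k₀ hk₀' _ ?_).2
      rw [Metric.mem_closedBall, dist_eq_norm, add_sub_cancel_left, Complex.norm_real,
        Real.norm_of_nonneg (by positivity)]
      exact div_le_self (by positivity) (by linarith [(Nat.cast_nonneg n : (0 : ℝ) ≤ n)])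
    · filter_upwards [hdiff] with a ha
      exact ((hasDerivAt_iff_tendsto_slope.1
        (ha.differentiableAt (hU.mem_nhds hk₀)).hasDerivAt)).comp hlim
  refine DifferentiableAt.differentiableWithinAt ?_
  refine (hasDerivAt_integral_of_dominated_loc_of_deriv_le (bound := fun a => B a / (r / 4))
    (F' := fun k a => deriv (fun k => F k a) k)
    (Metric.ball_mem_nhds k₀ (half_pos hr)) ?_ ?_ hderiv_meas ?_ (hB.div_const _)
    ?_).2.differentiableAt
  · filter_upwards [hU.mem_nhds hk₀] with k hk using hmeas k hk
  · refine hB.mono' (hmeas k₀ hk₀) ?_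
    filter_upwards [hle] with a ha using ha k₀ (hball' k₀ hk₀' _ (hself k₀)).1
  · filter_upwards [hle, hdiff] with a ha hda k hk
    refine Complex.norm_deriv_le_of_forall_mem_sphere_norm_le (by positivity)
      (DifferentiableOn.diffContOnCl ?_) ?_
    · refine hda.mono fun z hz => (hball' k hk z ?_).2
      exact Metric.closure_ball_subset_closedBall hz
    · exact fun z hz => ha z (hball' k hk z (Metric.sphere_subset_closedBall hz)).1
  · filter_upwards [hdiff] with a ha k hk
    exact (ha.differentiableAt (hU.mem_nhds (hball' k hk k (hself k)).2)).hasDerivAt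

theorem HolCont.integral {F : ℂ → α → ℂ} {U Ω : Set ℂ} (hU : IsOpen U) (hUΩ : U ⊆ Ω)
    (hmeas : ∀ k ∈ Ω, AEStronglyMeasurable (F k) μ)
    (hF : ∀ᵐ a ∂μ, HolCont U Ω (fun k => F k a))
    (hdom : ∀ k₀ ∈ Ω, ∃ B : α → ℝ, Integrable B μ ∧ ∃ V ∈ 𝓝[Ω] k₀,
      ∀ᵐ a ∂μ, ∀ k ∈ V, ‖F k a‖ ≤ B a) :
    HolCont U Ω (fun k => ∫ a, F k a ∂μ) := by
  refine ⟨continuousOn_integral_of_locally_dominated hmeas (hF.mono fun a h => h.cont) hdom,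
    differentiableOn_integral_of_locally_dominated hU (fun k hk => hmeas k (hUΩ hk))
      (hF.mono fun a h => h.diff) fun k₀ hk₀ => ?_⟩
  obtain ⟨B, hB, V, hV, hle⟩ := hdom k₀ (hUΩ hk₀)
  exact ⟨B, hB, V, nhdsWithin_mono _ hUΩ hV, hle⟩

end ParametricIntegrals

/-! ### Rotation of contours and the Poisson kernel. -/

theorem integrableOn_exp_neg_mul {a : ℝ} (ha : 0 < a) :
    IntegrableOn (fun t : ℝ => Real.exp (-(a * t))) (Ioi 0) := by
  simpa only [neg_mul] using exp_neg_integrableOn_Ioi 0 ha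

/-- A holomorphic function which decays exponentially in the first quadrant has the same integral
along both boundary rays. -/
theorem integral_quadrant_rotate {F : ℂ → ℂ} {C a b : ℝ} (ha : 0 < a) (hb : 0 < b)
    (hF : HolCont {k | 0 < k.re ∧ 0 < k.im} {k | 0 ≤ k.re ∧ 0 ≤ k.im} F)
    (hbd : ∀ k : ℂ, 0 ≤ k.re → 0 ≤ k.im → ‖F k‖ ≤ C * Real.exp (-(a * k.re) - b * k.im)) :
    IntegrableOn (fun t : ℝ => F t) (Ioi 0) ∧
    IntegrableOn (fun t : ℝ => F (Complex.I * t)) (Ioi 0) ∧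
    ∫ t in Ioi (0 : ℝ), F t = Complex.I * ∫ t in Ioi (0 : ℝ), F (Complex.I * t) := by
  have hC : 0 ≤ C := by
    have := hbd 0 (by simp) (by simp)
    simp only [Complex.zero_re, Complex.zero_im, mul_zero, neg_zero, sub_zero, Real.exp_zero,
      mul_one] at this
    exact (norm_nonneg _).trans this
  have c1 : ContinuousOn (fun t : ℝ => F t) (Ioi 0) :=
    hF.cont.comp Complex.continuous_ofReal.continuousOn fun t (ht : 0 < t) => by simp [ht.le]
  have c2 : ContinuousOn (fun t : ℝ => F (Complex.I * t)) (Ioi 0) :=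
    hF.cont.comp (by fun_prop) fun t (ht : 0 < t) => by simp [ht.le]
  have i1 : IntegrableOn (fun t : ℝ => F t) (Ioi 0) := by
    refine ((integrableOn_exp_neg_mul ha).const_mul C).mono'
      (c1.aestronglyMeasurable measurableSet_Ioi) ?_
    refine (ae_restrict_iff' measurableSet_Ioi).2 (Eventually.of_forall fun t (ht : 0 < t) => ?_)
    simpa using hbd t (by simpa using ht.le) (by simp)
  have i2 : IntegrableOn (fun t : ℝ => F (Complex.I * t)) (Ioi 0) := by
    refine ((integrableOn_exp_neg_mul hb).const_mul C).mono'
      (c2.aestronglyMeasurable measurableSet_Ioi) ?_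
    refine (ae_restrict_iff' measurableSet_Ioi).2 (Eventually.of_forall fun t (ht : 0 < t) => ?_)
    simpa using hbd (Complex.I * t) (by simp) (by simpa using ht.le)
  refine ⟨i1, i2, ?_⟩
  -- Cauchy's theorem on the square [0,R]²: the two sides through the origin are on the left, the
  -- two far sides on the right.
  have hrect : ∀ R : ℝ, 0 < R →
      (∫ t in (0 : ℝ)..R, F t) - Complex.I * (∫ t in (0 : ℝ)..R, F (Complex.I * t))
        = (∫ t in (0 : ℝ)..R, F (t + R * Complex.I))
          - Complex.I * ∫ t in (0 : ℝ)..R, F (R + t * Complex.I) := by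
    intro R hR
    have h := Complex.integral_boundary_rect_eq_zero_of_continuousOn_of_differentiableOn F 0
      (R + R * Complex.I)
      (hF.cont.mono fun z hz => by
        simp [Complex.mem_reProdIm, uIcc_of_le hR.le] at hz
        exact ⟨hz.1.1, hz.2.1⟩)
      (hF.diff.mono fun z hz => by
        simp [Complex.mem_reProdIm, hR.le] at hz
        exact ⟨hz.1.1, hz.2.1⟩)
    simp only [Complex.zero_re, Complex.zero_im, Complex.add_re, Complex.add_im, Complex.ofReal_re,
      Complex.ofReal_im, Complex.mul_re, Complex.mul_im, Complex.I_re, Complex.I_im, mul_zero,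
      mul_one, sub_zero, add_zero, zero_add, Complex.ofReal_zero, zero_mul, smul_eq_mul] at h
    simp only [mul_comm Complex.I (Complex.ofReal _)]
    linear_combination h
  -- A far side has length R and carries a factor e^{-bR} or e^{-aR}.
  have hsmall : Tendsto (fun R : ℝ => (∫ t in (0 : ℝ)..R, F (t + R * Complex.I))
      - Complex.I * ∫ t in (0 : ℝ)..R, F (R + t * Complex.I)) atTop (𝓝 0) := by
    have e1 : ∀ c : ℝ, 0 < c → Tendsto (fun R : ℝ => C * Real.exp (-(c * R)) * R) atTop (𝓝 0) := by
      intro c hc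
      have h1 := (Real.tendsto_pow_mul_exp_neg_atTop_nhds_zero 1).comp
        (tendsto_id.const_mul_atTop hc)
      have h2 := h1.const_mul (C / c)
      rw [mul_zero] at h2
      refine h2.congr fun R => ?_
      simp only [Function.comp, id, pow_one]
      field_simp
    have b1 : Tendsto (fun R : ℝ => ∫ t in (0 : ℝ)..R, F (t + R * Complex.I)) atTop (𝓝 0) := by
      refine squeeze_zero_norm' ?_ (e1 b hb)
      filter_upwards [eventually_gt_atTop 0] with R hR
      refine (intervalIntegral.norm_integral_le_of_norm_le_const fun t ht => ?_).trans_eq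
        (by rw [sub_zero, abs_of_pos hR])
      rw [uIoc_of_le hR.le] at ht
      refine (hbd _ (by simpa using ht.1.le) (by simpa using hR.le)).trans ?_
      refine mul_le_mul_of_nonneg_left (Real.exp_le_exp.2 ?_) hC
      have := mul_nonneg ha.le ht.1.le
      simpa using this
    have b2 : Tendsto (fun R : ℝ => ∫ t in (0 : ℝ)..R, F (R + t * Complex.I)) atTop (𝓝 0) := by
      refine squeeze_zero_norm' ?_ (e1 a ha)
      filter_upwards [eventually_gt_atTop 0] with R hR
      refine (intervalIntegral.norm_integral_le_of_norm_le_const fun t ht => ?_).trans_eq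
        (by rw [sub_zero, abs_of_pos hR])
      rw [uIoc_of_le hR.le] at ht
      refine (hbd _ (by simpa using hR.le) (by simpa using ht.1.le)).trans ?_
      refine mul_le_mul_of_nonneg_left (Real.exp_le_exp.2 ?_) hC
      have := mul_nonneg hb.le ht.1.le
      simpa using this
    simpa using b1.sub (b2.const_mul Complex.I)
  have hlim := ((intervalIntegral_tendsto_integral_Ioi 0 i1 tendsto_id).sub
    ((intervalIntegral_tendsto_integral_Ioi 0 i2 tendsto_id).const_mul Complex.I))
  have := tendsto_nhds_unique (hlim.congr' (by
    filter_upwards [eventually_gt_atTop 0] with R hR using hrect R hR)) hsmall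
  exact sub_eq_zero.1 this

theorem integral_exp_neg_mul_cos {ε : ℝ} (hε : 0 < ε) (a : ℝ) :
    IntegrableOn (fun l : ℝ => Real.exp (-(ε * l)) * Real.cos (l * a)) (Ioi 0) ∧
    ∫ l in Ioi (0 : ℝ), Real.exp (-(ε * l)) * Real.cos (l * a) = ε / (ε ^ 2 + a ^ 2) := by
  have hre : (-(ε : ℂ) + a * Complex.I).re < 0 := by simpa using hε
  have hi := integrableOn_exp_mul_complex_Ioi hre 0
  have hv := integral_exp_mul_complex_Ioi hre 0
  have hfun : ∀ l : ℝ, Real.exp (-(ε * l)) * Real.cos (l * a)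
      = (Complex.exp ((-(ε : ℂ) + a * Complex.I) * l)).re := by
    intro l
    rw [Complex.exp_re]
    simp [mul_comm]
  simp only [hfun]
  refine ⟨hi.re, ?_⟩
  rw [← RCLike.re_eq_complex_re, integral_re hi, hv]
  have hne : (ε ^ 2 + a ^ 2 : ℝ) ≠ 0 := by positivity
  simp only [Complex.ofReal_zero, mul_zero, Complex.exp_zero, RCLike.re_eq_complex_re]
  simp [Complex.div_re, Complex.normSq_apply]
  field_simp

/-- A product of sines is half a difference of cosines, so the Abel-damped sine kernel is a
difference of Poisson kernels centred at y and at -y. -/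
theorem integral_exp_neg_mul_sin_mul_sin {ε : ℝ} (hε : 0 < ε) (y η : ℝ) :
    ∫ l in Ioi (0 : ℝ), Real.exp (-(ε * l)) * (Real.sin (l * y) * Real.sin (l * η))
      = (ε / (ε ^ 2 + (y - η) ^ 2) - ε / (ε ^ 2 + (-y - η) ^ 2)) / 2 := by
  have h1 := integral_exp_neg_mul_cos hε (y - η)
  have h2 := integral_exp_neg_mul_cos hε (-y - η)
  rw [← h1.2, ← h2.2, ← integral_sub h1.1 h2.1, ← integral_div]
  congr 1 with l
  have e1 : l * (-y - η) = -(l * y + l * η) := by ring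
  rw [mul_sub, e1, Real.cos_neg, Real.cos_sub, Real.cos_add]
  ring

/-- The Poisson kernel of the half plane is an approximate identity. -/
theorem tendsto_poisson {g : ℝ → ℝ} {M y : ℝ} (hm : Measurable g) (hb : ∀ η, |g η| ≤ M)
    (hc : ContinuousAt g y) :
    Tendsto (fun ε : ℝ => ∫ η, ε / (ε ^ 2 + (y - η) ^ 2) * g η) (𝓝[>] 0) (𝓝 (Real.pi * g y)) := by
  -- The substitution η = y + εt moves ε from the kernel into the argument of g.
  have hsub : ∀ ε : ℝ, 0 < ε → ∫ η, ε / (ε ^ 2 + (y - η) ^ 2) * g η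
      = ∫ t : ℝ, (1 + t ^ 2)⁻¹ * g (y + ε * t) := by
    intro ε hε
    rw [← integral_add_left_eq_self _ y]
    have := Measure.integral_comp_mul_left
      (fun η => ε / (ε ^ 2 + (y - (y + η)) ^ 2) * g (y + η)) ε
    rw [abs_of_pos (inv_pos.2 hε), smul_eq_mul] at this
    rw [← mul_right_inj' (inv_ne_zero hε.ne'), ← this, ← integral_const_mul]
    congr 1 with t
    have h1 : (ε ^ 2 + (y - (y + ε * t)) ^ 2) = ε ^ 2 * (1 + t ^ 2) := by ring
    rw [h1]
    have : (1 + t ^ 2 : ℝ) ≠ 0 := by positivity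
    field_simp
  have hlim : Tendsto (fun ε : ℝ => ∫ t : ℝ, (1 + t ^ 2)⁻¹ * g (y + ε * t)) (𝓝[>] 0)
      (𝓝 (∫ t : ℝ, (1 + t ^ 2)⁻¹ * g y)) := by
    refine tendsto_integral_filter_of_dominated_convergence (fun t => (1 + t ^ 2)⁻¹ * M)
      (Eventually.of_forall fun ε => ?_) (Eventually.of_forall fun ε =>
        Eventually.of_forall fun t => ?_) (integrable_inv_one_add_sq.mul_const M)
      (Eventually.of_forall fun t => ?_)
    · have : Measurable fun t : ℝ => (1 + t ^ 2)⁻¹ * g (y + ε * t) := by fun_prop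
      exact this.aestronglyMeasurable
    · rw [norm_mul, Real.norm_of_nonneg (by positivity)]
      exact mul_le_mul_of_nonneg_left (hb _) (by positivity)
    · refine Tendsto.const_mul _ (hc.tendsto.comp ?_)
      have : Continuous fun ε : ℝ => y + ε * t := by fun_prop
      have h := this.tendsto 0
      simp only [zero_mul, add_zero] at h
      exact h.mono_left nhdsWithin_le_nhds
  rw [integral_mul_const, integral_univ_inv_one_add_sq] at hlim
  refine hlim.congr' ?_
  filter_upwards [self_mem_nhdsWithin] with ε hε using (hsub ε hε).symm

end QuarterPlane

/-! ### Abstract Volterra equations with a parameter. -/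

namespace QuarterPlane

open Filter Topology

/-- `f x k` is jointly continuous on `[0, ∞) × Ω` and holomorphic in `k ∈ U`. -/
structure JointHol (U Ω : Set ℂ) (f : ℝ → ℂ → ℂ) : Prop where
  cont : ContinuousOn (fun p : ℝ × ℂ => f p.1 p.2) (Ici 0 ×ˢ Ω)
  diff : ∀ x, 0 ≤ x → DifferentiableOn ℂ (f x) U

namespace JointHol

variable {U Ω : Set ℂ} {f g : ℝ → ℂ → ℂ}

theorem holCont (hf : JointHol U Ω f) {x : ℝ} (hx : 0 ≤ x) : HolCont U Ω (f x) :=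
  ⟨hf.cont.comp (f := fun k : ℂ => (x, k)) (by fun_prop) fun _ hk => ⟨hx, hk⟩, hf.diff x hx⟩

theorem continuousOn_left (hf : JointHol U Ω f) {k : ℂ} (hk : k ∈ Ω) :
    ContinuousOn (fun x => f x k) (Ici 0) :=
  hf.cont.comp (f := fun x : ℝ => (x, k)) (by fun_prop) fun _ hx => ⟨hx, hk⟩

theorem congr (hf : JointHol U Ω f) (hUΩ : U ⊆ Ω)
    (h : ∀ x, 0 ≤ x → ∀ k ∈ Ω, g x k = f x k) : JointHol U Ω g :=
  ⟨hf.cont.congr fun p hp => h p.1 hp.1 p.2 hp.2,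
    fun x hx => (hf.diff x hx).congr fun k hk => h x hx k (hUΩ hk)⟩

end JointHol

/-- A kernel `N x ξ k` on the half line, depending on the parameter `k`, which is a contraction by
the factor `1/2` with respect to the weight `e`. -/
structure VolterraKernel (U Ω : Set ℂ) (N : ℝ → ℝ → ℂ → ℂ) (e : ℝ → ℂ → ℝ) : Prop where
  isOpen : IsOpen U
  sub : U ⊆ Ω
  weight_cont : ContinuousOn (fun p : ℝ × ℂ => e p.1 p.2) (Ici 0 ×ˢ Ω)
  weight_nonneg : ∀ x k, 0 ≤ x → 0 ≤ e x k
  cont_snd : ∀ x, 0 ≤ x → ∀ k ∈ Ω, ContinuousOn (fun ξ => N x ξ k) (Ioi 0)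
  cont : ∀ ξ, 0 < ξ → ContinuousOn (fun p : ℝ × ℂ => N p.1 ξ p.2) (Ici 0 ×ˢ Ω)
  diff : ∀ x ξ, 0 ≤ x → 0 < ξ → DifferentiableOn ℂ (N x ξ) U
  contr : ∀ x, 0 ≤ x → ∀ k ∈ Ω, ∫ ξ in Ioi (0 : ℝ), ‖N x ξ k‖ * e ξ k ≤ e x k / 2
  dom : ∀ p₀ ∈ Ici (0 : ℝ) ×ˢ Ω, ∃ B : ℝ → ℝ, IntegrableOn B (Ioi 0) ∧
    ∃ V ∈ 𝓝[Ici (0 : ℝ) ×ˢ Ω] p₀, ∀ p ∈ V, ∀ ξ, 0 < ξ → ‖N p.1 ξ p.2‖ * e ξ p.2 ≤ B ξ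

namespace VolterraKernel

variable {U Ω : Set ℂ} {N : ℝ → ℝ → ℂ → ℂ} {e : ℝ → ℂ → ℝ}

theorem weight_cont_left (hN : VolterraKernel U Ω N e) {k : ℂ} (hk : k ∈ Ω) :
    ContinuousOn (fun x => e x k) (Ici 0) :=
  hN.weight_cont.comp (f := fun x : ℝ => (x, k)) (by fun_prop) fun _ hx => ⟨hx, hk⟩

theorem integrable (hN : VolterraKernel U Ω N e) {x : ℝ} (hx : 0 ≤ x) {k : ℂ} (hk : k ∈ Ω) :
    IntegrableOn (fun ξ => ‖N x ξ k‖ * e ξ k) (Ioi 0) := by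
  obtain ⟨B, hB, V, hV, hle⟩ := hN.dom (x, k) ⟨hx, hk⟩
  have hmem : (x, k) ∈ V := mem_of_mem_nhdsWithin (Set.mk_mem_prod hx hk) hV
  refine hB.mono' (((hN.cont_snd x hx k hk).norm.mul
    ((hN.weight_cont_left hk).mono Ioi_subset_Ici_self)).aestronglyMeasurable
      measurableSet_Ioi) ?_
  refine (ae_restrict_iff' measurableSet_Ioi).2 (Eventually.of_forall fun ξ (hξ : 0 < ξ) => ?_)
  rw [Real.norm_of_nonneg (mul_nonneg (norm_nonneg _) (hN.weight_nonneg _ _ hξ.le))]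
  exact hle _ hmem ξ hξ

theorem norm_mul_le {f : ℝ → ℂ} {M c : ℝ} {x ξ : ℝ} {k : ℂ}
    (hf : ‖f ξ‖ ≤ M * c) : ‖N x ξ k * f ξ‖ ≤ M * (‖N x ξ k‖ * c) := by
  rw [norm_mul]
  calc _ ≤ ‖N x ξ k‖ * (M * c) := mul_le_mul_of_nonneg_left hf (norm_nonneg _)
    _ = _ := by ring

theorem integrable_mul (hN : VolterraKernel U Ω N e) {f : ℝ → ℂ} {M : ℝ} {x : ℝ} (hx : 0 ≤ x)
    {k : ℂ} (hk : k ∈ Ω) (hf : ContinuousOn f (Ioi 0)) (hM : ∀ ξ, 0 < ξ → ‖f ξ‖ ≤ M * e ξ k) :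
    IntegrableOn (fun ξ => N x ξ k * f ξ) (Ioi 0) := by
  refine ((hN.integrable hx hk).const_mul M).mono'
    (((hN.cont_snd x hx k hk).mul hf).aestronglyMeasurable measurableSet_Ioi) ?_
  exact (ae_restrict_iff' measurableSet_Ioi).2 (Eventually.of_forall fun ξ hξ =>
    norm_mul_le (hM ξ hξ))

/-- The alternative N = 0 allows f to be controlled only on the support of the kernel; uniqueness on
a bounded interval needs this form. -/
theorem norm_integral_le (hN : VolterraKernel U Ω N e) {f : ℝ → ℂ} {M : ℝ} (hM0 : 0 ≤ M)
    {x : ℝ} (hx : 0 ≤ x) {k : ℂ} (hk : k ∈ Ω) (hM : ∀ ξ, 0 < ξ → N x ξ k = 0 ∨ ‖f ξ‖ ≤ M * e ξ k) :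
    ‖∫ ξ in Ioi (0 : ℝ), N x ξ k * f ξ‖ ≤ M / 2 * e x k := by
  have h := norm_integral_le_of_norm_le ((hN.integrable hx hk).const_mul M)
    (f := fun ξ => N x ξ k * f ξ)
    ((ae_restrict_iff' measurableSet_Ioi).2 (Eventually.of_forall fun ξ hξ =>
      (hM ξ hξ).elim (fun h => by simp [h]) fun h => norm_mul_le h))
  rw [integral_const_mul] at h
  refine h.trans ?_
  have := mul_le_mul_of_nonneg_left (hN.contr x hx k hk) hM0
  linarith

theorem jointHol_integral (hN : VolterraKernel U Ω N e) {f : ℝ → ℂ → ℂ} {M : ℝ}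
    (hM0 : 0 ≤ M) (hf : JointHol U Ω f) (hM : ∀ x, 0 ≤ x → ∀ k ∈ Ω, ‖f x k‖ ≤ M * e x k) :
    JointHol U Ω (fun x k => ∫ ξ in Ioi (0 : ℝ), N x ξ k * f ξ k) := by
  have hmeas : ∀ x, 0 ≤ x → ∀ k ∈ Ω,
      AEStronglyMeasurable (fun ξ => N x ξ k * f ξ k) (volume.restrict (Ioi 0)) := fun x hx k hk =>
    ((hN.cont_snd x hx k hk).mul ((hf.continuousOn_left hk).mono
      Ioi_subset_Ici_self)).aestronglyMeasurable measurableSet_Ioi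
  constructor
  · refine continuousOn_integral_of_locally_dominated (F := fun (p : ℝ × ℂ) ξ =>
      N p.1 ξ p.2 * f ξ p.2) (fun p hp => hmeas p.1 hp.1 p.2 hp.2) ?_ fun p₀ hp₀ => ?_
    · refine (ae_restrict_iff' measurableSet_Ioi).2
        (Eventually.of_forall fun ξ (hξ : 0 < ξ) => (hN.cont ξ hξ).mul ?_)
      exact (hf.holCont hξ.le).cont.comp continuousOn_snd fun p hp => hp.2
    · obtain ⟨B, hB, V, hV, hle⟩ := hN.dom p₀ hp₀
      refine ⟨fun ξ => M * B ξ, hB.const_mul M, V ∩ (Ici 0 ×ˢ Ω),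
        inter_mem hV self_mem_nhdsWithin, ?_⟩
      refine (ae_restrict_iff' measurableSet_Ioi).2
        (Eventually.of_forall fun ξ (hξ : 0 < ξ) p hp => ?_)
      exact (norm_mul_le (f := fun ξ => f ξ p.2) (hM ξ hξ.le _ hp.2.2)).trans
        (mul_le_mul_of_nonneg_left (hle p hp.1 ξ hξ) hM0)
  · intro x hx
    refine differentiableOn_integral_of_locally_dominated (F := fun k ξ =>
      N x ξ k * f ξ k) hN.isOpen (fun k hk => hmeas x hx k (hN.sub hk)) ?_ fun k₀ hk₀ => ?_
    · exact (ae_restrict_iff' measurableSet_Ioi).2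
        (Eventually.of_forall fun ξ (hξ : 0 < ξ) => (hN.diff x ξ hx hξ).mul (hf.diff ξ hξ.le))
    · obtain ⟨B, hB, V, hV, hle⟩ := hN.dom (x, k₀) ⟨hx, hN.sub hk₀⟩
      have hc : ContinuousWithinAt (fun k : ℂ => (x, k)) U k₀ := by fun_prop
      have ht : Tendsto (fun k : ℂ => (x, k)) (𝓝[U] k₀) (𝓝[Ici (0 : ℝ) ×ˢ Ω] (x, k₀)) :=
        hc.tendsto_nhdsWithin fun k hk => ⟨hx, hN.sub hk⟩
      refine ⟨fun ξ => M * B ξ, hB.const_mul M, _, inter_mem (ht hV) self_mem_nhdsWithin, ?_⟩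
      refine (ae_restrict_iff' measurableSet_Ioi).2
        (Eventually.of_forall fun ξ (hξ : 0 < ξ) k hk => ?_)
      exact (norm_mul_le (f := fun ξ => f ξ k) (hM ξ hξ.le _ (hN.sub hk.2))).trans
        (mul_le_mul_of_nonneg_left (hle _ hk.1 ξ hξ) hM0)

/-- Neumann series: each application of the kernel halves the weighted norm, so the series is
dominated by M 2⁻ⁿ e and its sum by 2Me. -/
theorem exists_solution (hN : VolterraKernel U Ω N e) {m₀ : ℝ → ℂ → ℂ} {M : ℝ}
    (hM0 : 0 ≤ M) (hm₀ : JointHol U Ω m₀) (hM : ∀ x, 0 ≤ x → ∀ k ∈ Ω, ‖m₀ x k‖ ≤ M * e x k) :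
    ∃ m : ℝ → ℂ → ℂ, JointHol U Ω m ∧ (∀ x, 0 ≤ x → ∀ k ∈ Ω, ‖m x k‖ ≤ 2 * M * e x k) ∧
      ∀ x, 0 ≤ x → ∀ k ∈ Ω, m x k = m₀ x k + ∫ ξ in Ioi (0 : ℝ), N x ξ k * m ξ k := by
  let it : ℕ → ℝ → ℂ → ℂ := fun n =>
    Nat.rec m₀ (fun _ f x k => ∫ ξ in Ioi (0 : ℝ), N x ξ k * f ξ k) n
  have hsucc : ∀ n x k, it (n + 1) x k = ∫ ξ in Ioi (0 : ℝ), N x ξ k * it n ξ k :=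
    fun n x k => rfl
  have hit : ∀ n, JointHol U Ω (it n) ∧
      ∀ x, 0 ≤ x → ∀ k ∈ Ω, ‖it n x k‖ ≤ M * (1 / 2) ^ n * e x k := by
    intro n
    induction n with
    | zero => exact ⟨hm₀, fun x hx k hk => by simpa using! hM x hx k hk⟩
    | succ n ih =>
      refine ⟨hN.jointHol_integral (by positivity) ih.1 ih.2, fun x hx k hk => ?_⟩
      refine (hN.norm_integral_le (f := fun ξ => it n ξ k) (by positivity) hx hk
        fun ξ hξ => Or.inr (ih.2 ξ hξ.le k hk)).trans_eq ?_
      ring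
  have hgeom : Summable fun n : ℕ => M * (1 / 2 : ℝ) ^ n :=
    (summable_geometric_two).mul_left M
  have hgsum : ∑' n : ℕ, M * (1 / 2 : ℝ) ^ n = 2 * M := by
    rw [tsum_mul_left, tsum_geometric_two, mul_comm]
  have hsum : ∀ x, 0 ≤ x → ∀ k ∈ Ω, Summable fun n => it n x k := fun x hx k hk =>
    Summable.of_norm_bounded (hgeom.mul_right (e x k)) fun n => (hit n).2 x hx k hk
  refine ⟨fun x k => ∑' n, it n x k, ⟨?_, ?_⟩, ?_, ?_⟩
  · intro p₀ hp₀
    -- Near the given point the weight stays below its value there plus one, which makes the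
    -- geometric majorant uniform.
    have hnear : ∀ᶠ p in 𝓝[Ici 0 ×ˢ Ω] p₀, e p.1 p.2 < e p₀.1 p₀.2 + 1 :=
      (hN.weight_cont p₀ hp₀).eventually_lt_const (lt_add_one _)
    have hV := inter_mem hnear self_mem_nhdsWithin
    refine ContinuousWithinAt.mono_of_mem_nhdsWithin ?_ hV
    refine (continuousOn_tsum (f := fun n (p : ℝ × ℂ) => it n p.1 p.2)
      (u := fun n => M * (1 / 2) ^ n * (e p₀.1 p₀.2 + 1)) (fun n => (hit n).1.cont.mono
        inter_subset_right) (hgeom.mul_right _) fun n p hp => ?_) p₀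
      (mem_of_mem_nhdsWithin hp₀ hV)
    exact ((hit n).2 p.1 hp.2.1 p.2 hp.2.2).trans
      (mul_le_mul_of_nonneg_left (le_of_lt hp.1) (by positivity))
  · intro x hx k₀ hk₀
    have hc : ContinuousWithinAt (fun k : ℂ => e x k) U k₀ :=
      (hN.weight_cont.comp (f := fun k : ℂ => (x, k)) (s := U) (by fun_prop)
        fun k hk => ⟨hx, hN.sub hk⟩) k₀ hk₀
    have hnear : ∀ᶠ k in 𝓝[U] k₀, e x k < e x k₀ + 1 :=
      hc.eventually_lt_const (lt_add_one _)
    rw [hN.isOpen.nhdsWithin_eq hk₀] at hnear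
    obtain ⟨W, hWsub, hWo, hkW⟩ := mem_nhds_iff.1 (inter_mem hnear (hN.isOpen.mem_nhds hk₀))
    refine ((Complex.differentiableOn_tsum_of_summable_norm (F := fun n k => it n x k)
      (u := fun n => M * (1 / 2) ^ n * (e x k₀ + 1)) (hgeom.mul_right _)
      (fun n => ((hit n).1.diff x hx).mono fun k hk => (hWsub hk).2) hWo fun n k hk => ?_
      ).differentiableAt (hWo.mem_nhds hkW)).differentiableWithinAt
    exact ((hit n).2 x hx k (hN.sub (hWsub hk).2)).trans
      (mul_le_mul_of_nonneg_left (le_of_lt (hWsub hk).1) (by positivity))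
  · intro x hx k hk
    refine (tsum_of_norm_bounded (hgeom.hasSum.mul_right (e x k))
      fun n => (hit n).2 x hx k hk).trans_eq ?_
    rw [hgsum]
  · intro x hx k hk
    refine (hsum x hx k hk).tsum_eq_zero_add.trans ?_
    congr 1
    have hint : ∀ n, IntegrableOn (fun ξ => N x ξ k * it n ξ k) (Ioi 0) := fun n =>
      hN.integrable_mul hx hk (((hit n).1.continuousOn_left hk).mono Ioi_subset_Ici_self)
        fun ξ hξ => (hit n).2 ξ hξ.le k hk
    have hS : Summable fun n => ∫ ξ in Ioi (0 : ℝ), ‖N x ξ k * it n ξ k‖ := by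
      refine Summable.of_nonneg_of_le (fun n => integral_nonneg fun ξ => norm_nonneg _)
        (fun n => ?_) (hgeom.mul_right (∫ ξ in Ioi (0 : ℝ), ‖N x ξ k‖ * e ξ k))
      rw [← integral_const_mul]
      refine setIntegral_mono_on (hint n).norm ((hN.integrable hx hk).const_mul _)
        measurableSet_Ioi fun ξ (hξ : 0 < ξ) => ?_
      exact norm_mul_le (f := fun ξ => it n ξ k) ((hit n).2 ξ hξ.le k hk)
    have := (hasSum_integral_of_summable_integral_norm hint hS).tsum_eq
    simp only [hsucc]
    rw [this]
    refine setIntegral_congr_fun measurableSet_Ioi fun ξ (hξ : 0 < ξ) => ?_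
    exact tsum_mul_left

/-- Iterating the homogeneous equation gives ‖d‖ ≤ M 2⁻ⁿ e for every n. By `hsupp` the equation
closes on S, so for the kernel on [0, x] a bound on a compact interval is enough and no growth
condition at infinity is imposed. -/
theorem eq_zero_of_fixed (hN : VolterraKernel U Ω N e) {S : Set ℝ} (hS : S ⊆ Ici 0) {k : ℂ}
    (hk : k ∈ Ω) {d : ℝ → ℂ} {M : ℝ} (hM0 : 0 ≤ M) (hM : ∀ x ∈ S, ‖d x‖ ≤ M * e x k)
    (hsupp : ∀ x ∈ S, ∀ ξ, 0 < ξ → ξ ∉ S → N x ξ k = 0)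
    (hd : ∀ x ∈ S, d x = ∫ ξ in Ioi (0 : ℝ), N x ξ k * d ξ) : ∀ x ∈ S, d x = 0 := by
  have key : ∀ n : ℕ, ∀ x ∈ S, ‖d x‖ ≤ M * (1 / 2) ^ n * e x k := by
    intro n
    induction n with
    | zero => simpa using hM
    | succ n ih =>
      intro x hx
      rw [hd x hx]
      refine (hN.norm_integral_le (M := M * (1 / 2) ^ n) (by positivity) (hS hx) hk
        fun ξ hξ => ?_).trans_eq ?_
      · by_cases h : ξ ∈ S
        · exact Or.inr (ih ξ h)
        · exact Or.inl (hsupp x hx ξ hξ h)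
      · ring
  intro x hx
  have hlim : Tendsto (fun n : ℕ => M * (1 / 2 : ℝ) ^ n * e x k) atTop (𝓝 (M * 0 * e x k)) :=
    ((tendsto_pow_atTop_nhds_zero_of_lt_one (by norm_num) (by norm_num)).const_mul M).mul_const _
  rw [mul_zero, zero_mul] at hlim
  exact norm_le_zero_iff.1 (ge_of_tendsto' hlim fun n => key n x hx)

end VolterraKernel

end QuarterPlane

/-! ### The kernel sin(kt)/k: regularity, addition formula, bounds. -/

namespace QuarterPlane

open Filter Topology

section SinKernel

theorem norm_cos_le (z : ℂ) : ‖Complex.cos z‖ ≤ Real.exp |z.im| := by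
  rw [Complex.cos, norm_div, div_le_iff₀ (by simp)]
  refine (norm_add_le _ _).trans ?_
  rw [Complex.norm_exp, Complex.norm_exp]
  have h1 : Real.exp (z * Complex.I).re ≤ Real.exp |z.im| :=
    Real.exp_le_exp.2 (by simpa using neg_le_abs z.im)
  have h2 : Real.exp (-z * Complex.I).re ≤ Real.exp |z.im| :=
    Real.exp_le_exp.2 (by simpa using le_abs_self z.im)
  simp only [Complex.norm_ofNat]
  linarith

theorem norm_sin_le (z : ℂ) : ‖Complex.sin z‖ ≤ Real.exp |z.im| := by
  have := norm_cos_le (z - Real.pi / 2)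
  rw [Complex.cos_sub_pi_div_two] at this
  refine this.trans_eq ?_
  congr 2
  rw [← Complex.ofReal_ofNat, ← Complex.ofReal_div, Complex.sub_im, Complex.ofReal_im, sub_zero]

/-- Mean value inequality on the convex strip |Im w| ≤ |Im z|, where the derivative cos is at most
e^{|Im z|}. -/
theorem norm_sin_le_norm_mul (z : ℂ) : ‖Complex.sin z‖ ≤ Real.exp |z.im| * ‖z‖ := by
  have hconv : Convex ℝ {w : ℂ | |w.im| ≤ |z.im|} := by
    have : {w : ℂ | |w.im| ≤ |z.im|} = Complex.imLm ⁻¹' Icc (-|z.im|) |z.im| := by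
      ext w; simp [abs_le]
    rw [this]
    exact (convex_Icc _ _).linear_preimage Complex.imLm
  have := hconv.norm_image_sub_le_of_norm_hasDerivWithin_le (f := Complex.sin) (f' := Complex.cos)
    (x := 0) (y := z) (C := Real.exp |z.im|)
    (fun w _ => (Complex.hasDerivAt_sin w).hasDerivWithinAt)
    (fun w hw => (norm_cos_le w).trans (Real.exp_le_exp.2 hw)) (show |(0 : ℂ).im| ≤ |z.im| by simp)
    (show |z.im| ≤ |z.im| from le_rfl)
  simpa using this

/-- The singularity at k = 0 is removable; written through the entire function `dslope Complex.sin
0`, the kernel is visibly jointly continuous and entire in k. -/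
theorem sinKernel_eq_dslope (k : ℂ) (t : ℝ) :
    sinKernel k t = t * dslope Complex.sin 0 (k * t) := by
  unfold sinKernel
  by_cases hk : k = 0
  · simp [hk, dslope_same]
  · rcases eq_or_ne t 0 with rfl | ht
    · simp
    · have ht' : (t : ℂ) ≠ 0 := by exact_mod_cast ht
      rw [dslope_of_ne _ (mul_ne_zero hk ht'), slope_def_field]
      simp only [hk, if_false, Complex.sin_zero, sub_zero]
      field_simp

theorem differentiable_dslope_sin : Differentiable ℂ (dslope Complex.sin 0) := by
  rw [← differentiableOn_univ, Complex.differentiableOn_dslope univ_mem]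
  exact Complex.differentiable_sin.differentiableOn

theorem continuous_sinKernel : Continuous fun p : ℂ × ℝ => sinKernel p.1 p.2 := by
  simp only [sinKernel_eq_dslope]
  have := differentiable_dslope_sin.continuous
  fun_prop

theorem differentiable_sinKernel (t : ℝ) : Differentiable ℂ fun k => sinKernel k t := by
  simp only [sinKernel_eq_dslope]
  have := differentiable_dslope_sin
  fun_prop

theorem sinKernel_zero_right (k : ℂ) : sinKernel k 0 = 0 := by
  simp [sinKernel_eq_dslope]

theorem mul_sinKernel (k : ℂ) (t : ℝ) : k * sinKernel k t = Complex.sin (k * t) := by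
  unfold sinKernel
  by_cases hk : k = 0
  · simp [hk]
  · simp only [hk, if_false]; field_simp

theorem sinKernel_neg_right (k : ℂ) (t : ℝ) : sinKernel k (-t) = -sinKernel k t := by
  unfold sinKernel
  by_cases hk : k = 0
  · simp [hk]
  · simp [hk, neg_div]

theorem sinKernel_neg_left (k : ℂ) (t : ℝ) : sinKernel (-k) t = sinKernel k t := by
  unfold sinKernel
  by_cases hk : k = 0
  · simp [hk]
  · simp [hk]

theorem conj_sinKernel (k : ℂ) (t : ℝ) :
    (starRingEnd ℂ) (sinKernel k t) = sinKernel ((starRingEnd ℂ) k) t := by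
  unfold sinKernel
  by_cases hk : k = 0
  · simp [hk]
  · simp [hk, ← Complex.sin_conj]

theorem sinKernel_sub (k : ℂ) (x ξ : ℝ) : sinKernel k (x - ξ)
    = sinKernel k x * Complex.cos (k * ξ) - Complex.cos (k * x) * sinKernel k ξ := by
  unfold sinKernel
  by_cases hk : k = 0
  · simp [hk]
  · simp only [hk, if_false]
    rw [Complex.ofReal_sub, mul_sub, Complex.sin_sub]
    ring

theorem norm_sinKernel_le (k : ℂ) (t : ℝ) : ‖sinKernel k t‖ ≤ |t| * Real.exp (|k.im| * |t|) := by
  unfold sinKernel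
  by_cases hk : k = 0
  · simp [hk]
  · simp only [hk, if_false, norm_div]
    rw [div_le_iff₀ (norm_pos_iff.2 hk)]
    refine (norm_sin_le_norm_mul _).trans_eq ?_
    simp only [Complex.mul_im, Complex.ofReal_re, Complex.ofReal_im, mul_zero, zero_add, abs_mul,
      norm_mul, Complex.norm_real, Real.norm_eq_abs]
    ring

/-- Unlike `norm_sinKernel_le`, this bound has no linear factor in t and decays in k, at the price
of excluding k = 0. -/
theorem norm_sinKernel_le_div {k : ℂ} (hk : k ≠ 0) (t : ℝ) :
    ‖sinKernel k t‖ ≤ Real.exp (|k.im| * |t|) / ‖k‖ := by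
  unfold sinKernel
  simp only [hk, if_false, norm_div]
  refine div_le_div_of_nonneg_right ((norm_sin_le _).trans_eq ?_) (norm_nonneg _)
  simp [abs_mul]

theorem hasDerivAt_sinKernel (k : ℂ) (t : ℝ) :
    HasDerivAt (sinKernel k) (Complex.cos (k * t)) t := by
  have h0 : HasDerivAt (fun t : ℝ => (t : ℂ)) 1 t := Complex.ofRealCLM.hasDerivAt
  by_cases hk : k = 0
  · have : sinKernel k = fun t : ℝ => (t : ℂ) := by ext t; simp [sinKernel, hk]
    rw [this, hk]
    simpa using h0
  · have : sinKernel k = fun t : ℝ => Complex.sin (k * t) / k := by ext t; simp [sinKernel, hk]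
    rw [this]
    have h := ((Complex.hasDerivAt_sin (k * t)).comp t (h0.const_mul k)).div_const k
    refine h.congr_deriv ?_
    field_simp

theorem hasDerivAt_cos_mul (k : ℂ) (t : ℝ) :
    HasDerivAt (fun t : ℝ => Complex.cos (k * t)) (-(k ^ 2 * sinKernel k t)) t := by
  have h0 : HasDerivAt (fun t : ℝ => (t : ℂ)) 1 t := Complex.ofRealCLM.hasDerivAt
  have h := (Complex.hasDerivAt_cos (k * t)).comp t (h0.const_mul k)
  refine h.congr_deriv ?_
  rw [pow_two, mul_assoc, mul_sinKernel]
  ring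

end SinKernel

/-! ### Integrable potentials and the weights that make the Volterra operators contract. -/

/-- Continuity of `u` together with `∫₀^∞ (1 + x) |u(x)| dx < ∞`. -/
structure Admissible (u : ℝ → ℝ) : Prop where
  cont : Continuous u
  int : IntegrableOn (fun x => (1 + x) * |u x|) (Ioi 0)

/-- `(1 + |x|) |u(x)|`. -/
noncomputable def potWeight (u : ℝ → ℝ) (x : ℝ) : ℝ := (1 + |x|) * |u x|

/-- `∫₀ˣ (1 + |ξ|) |u(ξ)| dξ`. -/
noncomputable def cumWeight (u : ℝ → ℝ) (x : ℝ) : ℝ := ∫ ξ in (0 : ℝ)..x, potWeight u ξ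

/-- `∫₀^∞ (1 + ξ) |u(ξ)| dξ`. -/
noncomputable def totWeight (u : ℝ → ℝ) : ℝ := ∫ ξ in Ioi (0 : ℝ), potWeight u ξ

theorem potWeight_nonneg (u : ℝ → ℝ) (x : ℝ) : 0 ≤ potWeight u x := by
  unfold potWeight; positivity

theorem totWeight_nonneg (u : ℝ → ℝ) : 0 ≤ totWeight u :=
  integral_nonneg fun _ => potWeight_nonneg u _

namespace Admissible

variable {u : ℝ → ℝ}

theorem continuous_potWeight (hu : Admissible u) : Continuous (potWeight u) := by
  have := hu.cont
  unfold potWeight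
  fun_prop

theorem integrableOn_potWeight (hu : Admissible u) : IntegrableOn (potWeight u) (Ioi 0) :=
  hu.int.congr_fun (fun x (hx : 0 < x) => by simp [potWeight, abs_of_pos hx]) measurableSet_Ioi

theorem hasDerivAt_cumWeight (hu : Admissible u) (x : ℝ) :
    HasDerivAt (cumWeight u) (potWeight u x) x :=
  (hu.continuous_potWeight.integral_hasStrictDerivAt 0 x).hasDerivAt

theorem continuous_cumWeight (hu : Admissible u) : Continuous (cumWeight u) :=
  continuous_iff_continuousAt.2 fun x => (hu.hasDerivAt_cumWeight x).continuousAt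

theorem tendsto_cumWeight (hu : Admissible u) :
    Tendsto (cumWeight u) atTop (𝓝 (totWeight u)) :=
  intervalIntegral_tendsto_integral_Ioi 0 hu.integrableOn_potWeight tendsto_id

theorem cumWeight_nonneg {x : ℝ} (hx : 0 ≤ x) : 0 ≤ cumWeight u x :=
  intervalIntegral.integral_nonneg hx fun _ _ => potWeight_nonneg u _

theorem cumWeight_le (hu : Admissible u) {x : ℝ} (hx : 0 ≤ x) :
    cumWeight u x ≤ totWeight u := by
  unfold cumWeight totWeight
  rw [intervalIntegral.integral_of_le hx]
  exact setIntegral_mono_set hu.integrableOn_potWeight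
    (Eventually.of_forall fun _ => potWeight_nonneg u _) Ioc_subset_Ioi_self.eventuallyLE

theorem abs_le_potWeight (u : ℝ → ℝ) (x : ℝ) : |u x| ≤ potWeight u x :=
  le_mul_of_one_le_left (abs_nonneg _) (by linarith [abs_nonneg x])

/-- The integrand is the exact derivative of e^{2W}/2, with W = `cumWeight u`; the exponent 2 is
what produces the contraction factor 1/2. -/
theorem integral_weight_fwd (hu : Admissible u) (x : ℝ) :
    ∫ ξ in (0 : ℝ)..x, potWeight u ξ * Real.exp (2 * cumWeight u ξ)
      = (Real.exp (2 * cumWeight u x) - 1) / 2 := by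
  have hd : ∀ ξ, HasDerivAt (fun ξ => Real.exp (2 * cumWeight u ξ) / 2)
      (potWeight u ξ * Real.exp (2 * cumWeight u ξ)) ξ := fun ξ => by
    have := (((hu.hasDerivAt_cumWeight ξ).const_mul 2).exp).div_const 2
    exact this.congr_deriv (by ring)
  rw [intervalIntegral.integral_eq_sub_of_hasDerivAt (fun ξ _ => hd ξ)]
  · simp [cumWeight]; ring
  · refine Continuous.intervalIntegrable ?_ _ _
    have := hu.continuous_potWeight
    have := hu.continuous_cumWeight
    fun_prop

/-- The integrand is the derivative of -e^{-2W}/2 with W = `cumWeight u`; the contribution at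
infinity is dropped because of its sign. -/
theorem integral_weight_bwd (hu : Admissible u) (x : ℝ) :
    IntegrableOn (fun ξ => potWeight u ξ * Real.exp (-(2 * cumWeight u ξ))) (Ioi x) ∧
    ∫ ξ in Ioi x, potWeight u ξ * Real.exp (-(2 * cumWeight u ξ))
      ≤ Real.exp (-(2 * cumWeight u x)) / 2 := by
  have hd : ∀ ξ, HasDerivAt (fun ξ => -(Real.exp (-(2 * cumWeight u ξ)) / 2))
      (potWeight u ξ * Real.exp (-(2 * cumWeight u ξ))) ξ := fun ξ => by
    have := ((((hu.hasDerivAt_cumWeight ξ).const_mul 2).fun_neg.exp).div_const 2).fun_neg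
    exact this.congr_deriv (by ring)
  have hlim : Tendsto (fun ξ => -(Real.exp (-(2 * cumWeight u ξ)) / 2)) atTop
      (𝓝 (-(Real.exp (-(2 * totWeight u)) / 2))) :=
    ((Real.continuous_exp.tendsto _).comp
      (hu.tendsto_cumWeight.const_mul 2).neg).div_const 2 |>.neg
  refine ⟨integrableOn_Ioi_deriv_of_nonneg' (fun ξ _ => hd ξ)
    (fun ξ _ => mul_nonneg (potWeight_nonneg _ _) (Real.exp_pos _).le) hlim, ?_⟩
  rw [integral_Ioi_of_hasDerivAt_of_nonneg' (fun ξ _ => hd ξ)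
    (fun ξ _ => mul_nonneg (potWeight_nonneg _ _) (Real.exp_pos _).le) hlim]
  linarith [Real.exp_pos (-(2 * totWeight u))]

end Admissible

/-- Kernel of the Volterra equation on `[0, x]`. -/
noncomputable def fwdKernel (u : ℝ → ℝ) (x ξ : ℝ) (k : ℂ) : ℂ :=
  -(sinKernel k (max (x - ξ) 0) * u ξ)

/-- Growth weight for solutions of the Volterra equation on `[0, x]`. -/
noncomputable def fwdWeight (u : ℝ → ℝ) (x : ℝ) (k : ℂ) : ℝ :=
  (1 + x) * Real.exp (|k.im| * x) * Real.exp (2 * cumWeight u x)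

/-- Kernel of the Volterra equation on `[x, ∞)`. -/
noncomputable def bwdKernel (u : ℝ → ℝ) (x ξ : ℝ) (k : ℂ) : ℂ :=
  sinKernel k (min (x - ξ) 0) * u ξ

/-- Decay weight for solutions of the Volterra equation on `[x, ∞)`. -/
noncomputable def bwdWeight (u : ℝ → ℝ) (x : ℝ) (k : ℂ) : ℝ :=
  Real.exp (-(k.im * x)) * Real.exp (-(2 * cumWeight u x))

theorem one_le_fwdWeight {u : ℝ → ℝ} {x : ℝ} (hx : 0 ≤ x) (k : ℂ) : 1 ≤ fwdWeight u x k := by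
  have h1 : 1 ≤ Real.exp (|k.im| * x) := Real.one_le_exp (by positivity)
  have h2 : 1 ≤ Real.exp (2 * cumWeight u x) :=
    Real.one_le_exp (mul_nonneg zero_le_two (Admissible.cumWeight_nonneg hx))
  unfold fwdWeight
  have h3 : 1 ≤ (1 + x) * Real.exp (|k.im| * x) := one_le_mul_of_one_le_of_one_le (by linarith) h1
  exact one_le_mul_of_one_le_of_one_le h3 h2

theorem le_fwdWeight {u : ℝ → ℝ} {x : ℝ} (hx : 0 ≤ x) (k : ℂ) :
    (1 + x) * Real.exp (|k.im| * x) ≤ fwdWeight u x k :=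
  le_mul_of_one_le_right (by positivity)
    (Real.one_le_exp (mul_nonneg zero_le_two (Admissible.cumWeight_nonneg hx)))

theorem Admissible.fwdWeight_le {u : ℝ → ℝ} (hu : Admissible u) {x : ℝ} (hx : 0 ≤ x) (k : ℂ) :
    fwdWeight u x k ≤ Real.exp (2 * totWeight u) * ((1 + x) * Real.exp (|k.im| * x)) := by
  unfold fwdWeight
  rw [mul_comm]
  refine mul_le_mul_of_nonneg_right (Real.exp_le_exp.2 ?_) (by positivity)
  linarith [hu.cumWeight_le hx]

theorem bwdWeight_le {u : ℝ → ℝ} {x : ℝ} (hx : 0 ≤ x) (k : ℂ) :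
    bwdWeight u x k ≤ Real.exp (-(k.im * x)) :=
  mul_le_of_le_one_right (Real.exp_pos _).le (Real.exp_le_one_iff.2 (by
    linarith [Admissible.cumWeight_nonneg (u := u) hx]))

theorem Admissible.le_bwdWeight {u : ℝ → ℝ} (hu : Admissible u) {x : ℝ} (hx : 0 ≤ x) (k : ℂ) :
    Real.exp (-(k.im * x)) ≤ Real.exp (2 * totWeight u) * bwdWeight u x k := by
  unfold bwdWeight
  rw [mul_left_comm]
  refine le_mul_of_one_le_right (Real.exp_pos _).le ?_
  rw [← Real.exp_add]
  exact Real.one_le_exp (by linarith [hu.cumWeight_le hx])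

/-- Truncating the argument of `sinKernel`, which vanishes at 0, cuts the kernel off continuously.
Volterra integrals thus become integrals over the fixed half line. -/
theorem fwdKernel_eq_zero (u : ℝ → ℝ) {x ξ : ℝ} (h : x ≤ ξ) (k : ℂ) : fwdKernel u x ξ k = 0 := by
  simp [fwdKernel, max_eq_right (sub_nonpos.2 h), sinKernel_zero_right]

theorem bwdKernel_eq_zero (u : ℝ → ℝ) {x ξ : ℝ} (h : ξ ≤ x) (k : ℂ) : bwdKernel u x ξ k = 0 := by
  simp [bwdKernel, min_eq_right (sub_nonneg.2 h), sinKernel_zero_right]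

/-- The exponentials over [ξ, x] and [0, ξ] multiply to that over [0, x], the length x - ξ is at
most 1 + x, and the factor 1 + ξ of the weight is absorbed in `potWeight`. -/
theorem norm_fwdKernel_mul_le (u : ℝ → ℝ) {x ξ : ℝ} (hξ : 0 < ξ) (k : ℂ) :
    ‖fwdKernel u x ξ k‖ * fwdWeight u ξ k ≤ (1 + x) * Real.exp (|k.im| * x) *
      (Ioc 0 x).indicator (fun ξ => potWeight u ξ * Real.exp (2 * cumWeight u ξ)) ξ := by
  by_cases h : x < ξ
  · rw [fwdKernel_eq_zero u h.le, indicator_of_notMem (fun hm => (not_le.2 h) hm.2)]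
    simp
  · rw [not_lt] at h
    rw [indicator_of_mem (show ξ ∈ Ioc 0 x from ⟨hξ, h⟩)]
    unfold fwdKernel fwdWeight potWeight
    rw [norm_neg, norm_mul, max_eq_left (sub_nonneg.2 h), Complex.norm_real, Real.norm_eq_abs,
      abs_of_pos hξ]
    have h1 := norm_sinKernel_le k (x - ξ)
    rw [abs_of_nonneg (sub_nonneg.2 h)] at h1
    have h2 : ‖sinKernel k (x - ξ)‖ * Real.exp (|k.im| * ξ)
        ≤ (1 + x) * Real.exp (|k.im| * x) := by
      calc _ ≤ (x - ξ) * Real.exp (|k.im| * (x - ξ)) * Real.exp (|k.im| * ξ) :=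
            mul_le_mul_of_nonneg_right h1 (Real.exp_pos _).le
        _ = (x - ξ) * Real.exp (|k.im| * x) := by
            rw [mul_assoc, ← Real.exp_add]; congr 2; ring
        _ ≤ _ := mul_le_mul_of_nonneg_right (by linarith) (Real.exp_pos _).le
    calc _ = (‖sinKernel k (x - ξ)‖ * Real.exp (|k.im| * ξ)) *
          ((1 + ξ) * |u ξ| * Real.exp (2 * cumWeight u ξ)) := by ring
      _ ≤ _ := mul_le_mul_of_nonneg_right h2 (by positivity)

/-- The growth e^{Im k (ξ-x)} of the kernel meets the decay e^{-Im k ξ} of the weight and leaves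
e^{-Im k x}. The length ξ - x is absorbed in `potWeight`, so this weight carries no polynomial
factor. -/
theorem norm_bwdKernel_mul_le (u : ℝ → ℝ) {x ξ : ℝ} (hx : 0 ≤ x) (hξ : 0 < ξ) {k : ℂ}
    (hk : 0 ≤ k.im) :
    ‖bwdKernel u x ξ k‖ * bwdWeight u ξ k ≤ Real.exp (-(k.im * x)) *
      (Ioi x).indicator (fun ξ => potWeight u ξ * Real.exp (-(2 * cumWeight u ξ))) ξ := by
  by_cases h : ξ ≤ x
  · rw [bwdKernel_eq_zero u h, indicator_of_notMem (fun hm => (not_le.2 (mem_Ioi.1 hm)) h)]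
    simp
  · rw [not_le] at h
    rw [indicator_of_mem (show ξ ∈ Ioi x from h)]
    unfold bwdKernel bwdWeight potWeight
    rw [norm_mul, min_eq_left (sub_nonpos.2 h.le), Complex.norm_real, Real.norm_eq_abs,
      abs_of_pos hξ]
    have h1 := norm_sinKernel_le k (x - ξ)
    rw [abs_of_nonpos (sub_nonpos.2 h.le), abs_of_nonneg hk] at h1
    have h2 : ‖sinKernel k (x - ξ)‖ * Real.exp (-(k.im * ξ))
        ≤ (1 + ξ) * Real.exp (-(k.im * x)) := by
      calc _ ≤ -(x - ξ) * Real.exp (k.im * -(x - ξ)) * Real.exp (-(k.im * ξ)) :=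
            mul_le_mul_of_nonneg_right h1 (Real.exp_pos _).le
        _ = -(x - ξ) * Real.exp (-(k.im * x)) := by
            rw [mul_assoc, ← Real.exp_add]; congr 2; ring
        _ ≤ _ := mul_le_mul_of_nonneg_right (by linarith) (Real.exp_pos _).le
    calc _ = (‖sinKernel k (x - ξ)‖ * Real.exp (-(k.im * ξ))) *
          (|u ξ| * Real.exp (-(2 * cumWeight u ξ))) := by ring
      _ ≤ _ := mul_le_mul_of_nonneg_right h2 (by positivity)
      _ = _ := by ring

/-- The closed upper half plane. -/
abbrev upperClosed : Set ℂ := {k | 0 ≤ k.im}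

/-- The open upper half plane. -/
abbrev upperOpen : Set ℂ := {k | 0 < k.im}

theorem isOpen_upperOpen : IsOpen upperOpen := isOpen_lt continuous_const Complex.continuous_im

theorem upperOpen_subset : upperOpen ⊆ upperClosed := fun k (h : 0 < k.im) =>
  show 0 ≤ k.im from h.le

theorem Admissible.volterraKernel_fwd {u : ℝ → ℝ} (hu : Admissible u) :
    VolterraKernel univ univ (fwdKernel u) (fwdWeight u) where
  isOpen := isOpen_univ
  sub := subset_univ _
  weight_cont := by
    have := hu.continuous_cumWeight
    have : Continuous fun p : ℝ × ℂ => fwdWeight u p.1 p.2 := by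
      unfold fwdWeight
      fun_prop
    exact this.continuousOn
  weight_nonneg x k hx := zero_le_one.trans (one_le_fwdWeight hx k)
  cont_snd x hx k hk := by
    have h1 := continuous_sinKernel
    have h2 := hu.cont
    have : Continuous fun ξ => fwdKernel u x ξ k := by
      unfold fwdKernel
      exact ((h1.comp (f := fun ξ : ℝ => (k, max (x - ξ) 0)) (by fun_prop)).mul
        (by fun_prop)).neg
    exact this.continuousOn
  cont ξ hξ := by
    have h1 := continuous_sinKernel
    have : Continuous fun p : ℝ × ℂ => fwdKernel u p.1 ξ p.2 := by
      unfold fwdKernel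
      exact ((h1.comp (f := fun p : ℝ × ℂ => (p.2, max (p.1 - ξ) 0)) (by fun_prop)).mul
        continuous_const).neg
    exact this.continuousOn
  diff x ξ hx hξ := by
    have : Differentiable ℂ (fwdKernel u x ξ) :=
      ((differentiable_sinKernel (max (x - ξ) 0)).mul_const _).neg
    exact this.differentiableOn
  contr x hx k hk := by
    have hint : IntegrableOn (fun ξ => potWeight u ξ * Real.exp (2 * cumWeight u ξ))
        (Ioc 0 x) := by
      have h1 := hu.continuous_cumWeight
      have h2 := hu.continuous_potWeight
      have : Continuous fun ξ => potWeight u ξ * Real.exp (2 * cumWeight u ξ) := by fun_prop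
      exact (this.integrableOn_Icc).mono_set Ioc_subset_Icc_self
    have hle := integral_mono_of_nonneg (μ := volume.restrict (Ioi (0 : ℝ)))
      (f := fun ξ => ‖fwdKernel u x ξ k‖ * fwdWeight u ξ k)
      ((ae_restrict_iff' measurableSet_Ioi).2 (Eventually.of_forall fun ξ (hξ : 0 < ξ) =>
        mul_nonneg (norm_nonneg _) (zero_le_one.trans (one_le_fwdWeight hξ.le k))))
      (((integrable_indicator_iff measurableSet_Ioc).2 hint).restrict.const_mul
        ((1 + x) * Real.exp (|k.im| * x)))
      ((ae_restrict_iff' measurableSet_Ioi).2 (Eventually.of_forall fun ξ (hξ : 0 < ξ) =>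
        norm_fwdKernel_mul_le u hξ k))
    refine hle.trans ?_
    rw [integral_const_mul, setIntegral_indicator measurableSet_Ioc,
      inter_eq_right.2 Ioc_subset_Ioi_self, ← intervalIntegral.integral_of_le hx,
      hu.integral_weight_fwd]
    unfold fwdWeight
    have : 0 ≤ (1 + x) * Real.exp (|k.im| * x) := by positivity
    nlinarith
  dom p₀ hp₀ := by
    refine ⟨fun ξ => ((1 + p₀.1) * Real.exp (|p₀.2.im| * p₀.1) + 1) *
      (potWeight u ξ * Real.exp (2 * totWeight u)),
      (hu.integrableOn_potWeight.mul_const _).const_mul _,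
      {p | p ∈ Ici (0 : ℝ) ×ˢ univ ∧
        (1 + p.1) * Real.exp (|p.2.im| * p.1) < (1 + p₀.1) * Real.exp (|p₀.2.im| * p₀.1) + 1},
      ?_, ?_⟩
    · refine inter_mem self_mem_nhdsWithin ?_
      have : Continuous fun p : ℝ × ℂ => (1 + p.1) * Real.exp (|p.2.im| * p.1) := by fun_prop
      exact this.continuousWithinAt.eventually_lt_const (lt_add_one _)
    · rintro p ⟨hp, hlt⟩ ξ hξ
      have hp0 : 0 ≤ p.1 := hp.1
      refine (norm_fwdKernel_mul_le u hξ p.2).trans ?_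
      refine mul_le_mul hlt.le ?_ (indicator_nonneg (fun _ _ => mul_nonneg (potWeight_nonneg _ _)
        (Real.exp_pos _).le) _) (by have : 0 ≤ p₀.1 := hp₀.1; positivity)
      refine (indicator_le_self' (fun _ _ => mul_nonneg (potWeight_nonneg _ _)
        (Real.exp_pos _).le) _).trans ?_
      refine mul_le_mul_of_nonneg_left (Real.exp_le_exp.2 ?_) (potWeight_nonneg _ _)
      linarith [hu.cumWeight_le hξ.le]

theorem Admissible.volterraKernel_bwd {u : ℝ → ℝ} (hu : Admissible u) :
    VolterraKernel upperOpen upperClosed (bwdKernel u) (bwdWeight u) where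
  isOpen := isOpen_upperOpen
  sub := upperOpen_subset
  weight_cont := by
    have := hu.continuous_cumWeight
    have : Continuous fun p : ℝ × ℂ => bwdWeight u p.1 p.2 := by
      unfold bwdWeight
      fun_prop
    exact this.continuousOn
  weight_nonneg x k hx := by unfold bwdWeight; positivity
  cont_snd x hx k hk := by
    have h1 := continuous_sinKernel
    have h2 := hu.cont
    have : Continuous fun ξ => bwdKernel u x ξ k := by
      unfold bwdKernel
      exact (h1.comp (f := fun ξ : ℝ => (k, min (x - ξ) 0)) (by fun_prop)).mul (by fun_prop)
    exact this.continuousOn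
  cont ξ hξ := by
    have h1 := continuous_sinKernel
    have : Continuous fun p : ℝ × ℂ => bwdKernel u p.1 ξ p.2 := by
      unfold bwdKernel
      exact (h1.comp (f := fun p : ℝ × ℂ => (p.2, min (p.1 - ξ) 0)) (by fun_prop)).mul
        continuous_const
    exact this.continuousOn
  diff x ξ hx hξ := by
    have : Differentiable ℂ (bwdKernel u x ξ) :=
      (differentiable_sinKernel (min (x - ξ) 0)).mul_const _
    exact this.differentiableOn
  contr x hx k hk := by
    have hle := integral_mono_of_nonneg (μ := volume.restrict (Ioi (0 : ℝ)))
      (f := fun ξ => ‖bwdKernel u x ξ k‖ * bwdWeight u ξ k)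
      (Eventually.of_forall fun ξ => by unfold bwdWeight; positivity)
      (((integrable_indicator_iff measurableSet_Ioi).2
        (hu.integral_weight_bwd x).1).restrict.const_mul (Real.exp (-(k.im * x))))
      ((ae_restrict_iff' measurableSet_Ioi).2 (Eventually.of_forall fun ξ (hξ : 0 < ξ) =>
        norm_bwdKernel_mul_le u hx hξ hk))
    refine hle.trans ?_
    rw [integral_const_mul, setIntegral_indicator measurableSet_Ioi,
      inter_eq_right.2 (Ioi_subset_Ioi hx)]
    refine (mul_le_mul_of_nonneg_left (hu.integral_weight_bwd x).2
      (Real.exp_pos _).le).trans_eq ?_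
    unfold bwdWeight
    ring
  dom p₀ hp₀ := by
    refine ⟨potWeight u, hu.integrableOn_potWeight, _, self_mem_nhdsWithin, fun p hp ξ hξ => ?_⟩
    refine (norm_bwdKernel_mul_le u hp.1 hξ hp.2).trans ?_
    have h0 : ∀ η, 0 ≤ potWeight u η * Real.exp (-(2 * cumWeight u η)) := fun η =>
      mul_nonneg (potWeight_nonneg _ _) (Real.exp_pos _).le
    refine (mul_le_of_le_one_left (indicator_nonneg (fun _ _ => h0 _) _) ?_).trans
      ((indicator_le_self' (fun _ _ => h0 _) _).trans ?_)
    · exact Real.exp_le_one_iff.2 (neg_nonpos.2 (mul_nonneg hp.2 hp.1))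
    · refine mul_le_of_le_one_right (potWeight_nonneg _ _) (Real.exp_le_one_iff.2 ?_)
      linarith [Admissible.cumWeight_nonneg (u := u) hξ.le]

end QuarterPlane

/-! ### Existence, uniqueness and bounds for φ, the regular solution and the Jost solution. -/

namespace QuarterPlane

open Filter Topology

/-- `f` solves `f x = m₀ x - ∫₀ˣ sinKernel k (x - ξ) u(ξ) f(ξ) dξ` on `[0, ∞)`. -/
def IsFwd (m₀ : ℝ → ℂ) (u : ℝ → ℝ) (k : ℂ) (f : ℝ → ℂ) : Prop :=
  ContinuousOn f (Ici 0) ∧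
  ∀ x : ℝ, 0 ≤ x → f x = m₀ x - ∫ ξ in (0 : ℝ)..x, sinKernel k (x - ξ) * (u ξ : ℂ) * f ξ

/-- The solution of `f'' + (u + k²) f = 0` with `f(0) = 0`, `f'(0) = 1`. -/
noncomputable def regSol (u : ℝ → ℝ) (k : ℂ) : ℝ → ℂ :=
  Classical.epsilon (IsFwd (sinKernel k) u k)

/-- `f` solves `f'' + (u + k²) f = 0` on `[0, ∞)` and `f'` is its derivative. -/
structure IsSol (u : ℝ → ℝ) (k : ℂ) (f f' : ℝ → ℂ) : Prop where
  deriv_fst : ∀ x, 0 ≤ x → HasDerivWithinAt f (f' x) (Ici 0) x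
  deriv_snd : ∀ x, 0 ≤ x → HasDerivWithinAt f' (-((u x + k ^ 2) * f x)) (Ici 0) x

variable {u : ℝ → ℝ}

theorem integral_fwdKernel {x : ℝ} (hx : 0 ≤ x) (k : ℂ) (f : ℝ → ℂ) :
    ∫ ξ in Ioi (0 : ℝ), fwdKernel u x ξ k * f ξ
      = -∫ ξ in (0 : ℝ)..x, sinKernel k (x - ξ) * (u ξ : ℂ) * f ξ := by
  rw [intervalIntegral.integral_of_le hx, ← integral_neg,
    setIntegral_eq_of_subset_of_forall_sdiff_eq_zero measurableSet_Ioi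
      (Ioc_subset_Ioi_self : Ioc 0 x ⊆ Ioi 0)]
  · refine setIntegral_congr_fun measurableSet_Ioc fun ξ hξ => ?_
    simp [fwdKernel, max_eq_left (sub_nonneg.2 hξ.2)]
  · intro ξ hξ
    have : x ≤ ξ := le_of_not_ge fun h => hξ.2 ⟨hξ.1, h⟩
    simp [fwdKernel_eq_zero u this]

theorem integral_bwdKernel {x : ℝ} (hx : 0 ≤ x) (k : ℂ) (f : ℝ → ℂ) :
    ∫ ξ in Ioi (0 : ℝ), bwdKernel u x ξ k * f ξ
      = ∫ ξ in Ioi x, sinKernel k (x - ξ) * (u ξ : ℂ) * f ξ := by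
  rw [setIntegral_eq_of_subset_of_forall_sdiff_eq_zero measurableSet_Ioi (Ioi_subset_Ioi hx)]
  · refine setIntegral_congr_fun measurableSet_Ioi fun ξ (hξ : x < ξ) => ?_
    simp [bwdKernel, min_eq_left (sub_nonpos.2 hξ.le)]
  · intro ξ hξ
    have : ξ ≤ x := not_lt.1 fun h => hξ.2 h
    simp [bwdKernel_eq_zero u this]

theorem intervalIntegrable_fwd (hu : Admissible u) {f : ℝ → ℂ} (hf : ContinuousOn f (Ici 0))
    {x : ℝ} (hx : 0 ≤ x) {κ : ℝ → ℂ} (hκ : Continuous κ) :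
    IntervalIntegrable (fun ξ => κ ξ * (u ξ : ℂ) * f ξ) volume 0 x := by
  refine ContinuousOn.intervalIntegrable ?_
  rw [uIcc_of_le hx]
  have := hu.cont
  exact (Continuous.continuousOn (by fun_prop)).mul (hf.mono Icc_subset_Ici_self)

theorem continuous_sinKernel_sub (k : ℂ) (x : ℝ) : Continuous fun ξ : ℝ => sinKernel k (x - ξ) :=
  continuous_sinKernel.comp (f := fun ξ : ℝ => (k, x - ξ)) (by fun_prop)

theorem IsFwd.unique (hu : Admissible u) {m₀ : ℝ → ℂ} {k : ℂ} {f g : ℝ → ℂ}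
    (hf : IsFwd m₀ u k f) (hg : IsFwd m₀ u k g) : ∀ x, 0 ≤ x → f x = g x := by
  intro X hX
  have hd : ContinuousOn (fun x => f x - g x) (Icc 0 X) :=
    (hf.1.sub hg.1).mono Icc_subset_Ici_self
  obtain ⟨M, hM⟩ := isCompact_Icc.exists_bound_of_continuousOn hd
  refine sub_eq_zero.1 (hu.volterraKernel_fwd.eq_zero_of_fixed (S := Icc 0 X) Icc_subset_Ici_self
    (mem_univ k) (d := fun x => f x - g x) (M := |M|) (abs_nonneg _) ?_ ?_ ?_ X ⟨hX, le_rfl⟩)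
  · intro x hx
    refine ((hM x hx).trans (le_abs_self M)).trans ?_
    exact le_mul_of_one_le_right (abs_nonneg _) (one_le_fwdWeight hx.1 k)
  · intro x hx ξ hξ hξX
    exact fwdKernel_eq_zero u (hx.2.trans (le_of_not_ge fun h => hξX ⟨hξ.le, h⟩)) k
  · intro x hx
    rw [integral_fwdKernel hx.1, hf.2 x hx.1, hg.2 x hx.1]
    simp only [mul_sub]
    rw [intervalIntegral.integral_sub
      (intervalIntegrable_fwd hu hf.1 hx.1 (continuous_sinKernel_sub k x))
      (intervalIntegrable_fwd hu hg.1 hx.1 (continuous_sinKernel_sub k x))]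
    ring

theorem exists_isFwd (hu : Admissible u) {m₀ : ℝ → ℂ → ℂ} (hm₀ : JointHol univ univ m₀)
    (hM : ∀ x, 0 ≤ x → ∀ k, ‖m₀ x k‖ ≤ fwdWeight u x k) :
    ∃ m : ℝ → ℂ → ℂ, JointHol univ univ m ∧
      (∀ x, 0 ≤ x → ∀ k, ‖m x k‖ ≤ 2 * fwdWeight u x k) ∧
      ∀ k, IsFwd (fun x => m₀ x k) u k (fun x => m x k) := by
  obtain ⟨m, h1, h2, h3⟩ := hu.volterraKernel_fwd.exists_solution zero_le_one hm₀
    (fun x hx k _ => by simpa using hM x hx k)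
  refine ⟨m, h1, fun x hx k => by simpa using h2 x hx k (mem_univ k), fun k =>
    ⟨h1.continuousOn_left (mem_univ k), fun x hx => ?_⟩⟩
  refine (h3 x hx k (mem_univ k)).trans ?_
  rw [integral_fwdKernel hx k (fun ξ => m ξ k), sub_eq_add_neg]

/-- By uniqueness the solution selected by `Classical.epsilon` agrees on [0, ∞) with the Neumann
series and inherits its holomorphy and its bound. -/
theorem epsilon_isFwd (hu : Admissible u) {m₀ : ℝ → ℂ → ℂ} (hm₀ : JointHol univ univ m₀)
    (hM : ∀ x, 0 ≤ x → ∀ k, ‖m₀ x k‖ ≤ fwdWeight u x k) :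
    JointHol univ univ (fun x k => Classical.epsilon (IsFwd (fun x => m₀ x k) u k) x) ∧
      (∀ x, 0 ≤ x → ∀ k, ‖Classical.epsilon (IsFwd (fun x => m₀ x k) u k) x‖
        ≤ 2 * fwdWeight u x k) ∧
      ∀ k, IsFwd (fun x => m₀ x k) u k (Classical.epsilon (IsFwd (fun x => m₀ x k) u k)) := by
  obtain ⟨m, h1, h2, h3⟩ := exists_isFwd hu hm₀ hM
  have hsp : ∀ k, IsFwd (fun x => m₀ x k) u k (Classical.epsilon (IsFwd (fun x => m₀ x k) u k)) :=
    fun k => Classical.epsilon_spec ⟨_, h3 k⟩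
  have heq : ∀ x, 0 ≤ x → ∀ k, Classical.epsilon (IsFwd (fun x => m₀ x k) u k) x = m x k :=
    fun x hx k => (hsp k).unique hu (h3 k) x hx
  exact ⟨h1.congr (subset_univ _) fun x hx k _ => heq x hx k,
    fun x hx k => by rw [heq x hx k]; exact h2 x hx k, hsp⟩

theorem norm_exp_I_mul (k : ℂ) (x : ℝ) :
    ‖Complex.exp (Complex.I * k * x)‖ = Real.exp (-(k.im * x)) := by
  rw [Complex.norm_exp]; simp

theorem epsilon_phi (hu : Admissible u) :
    JointHol univ univ (fun x k => phi u k x) ∧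
      (∀ x, 0 ≤ x → ∀ k, ‖phi u k x‖ ≤ 2 * fwdWeight u x k) ∧
      ∀ k, IsFwd (fun x => Complex.exp (-(Complex.I * k * x))) u k (phi u k) := by
  refine epsilon_isFwd hu (m₀ := fun x k => Complex.exp (-(Complex.I * k * x)))
    ⟨Continuous.continuousOn (by fun_prop), fun x hx =>
      Differentiable.differentiableOn (by fun_prop)⟩ fun x hx k => ?_
  refine le_trans ?_ (le_fwdWeight hx k)
  refine le_trans ?_ (le_mul_of_one_le_left (Real.exp_pos _).le (by linarith))
  rw [Complex.norm_exp]
  refine Real.exp_le_exp.2 ?_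
  simpa using mul_le_mul_of_nonneg_right (le_abs_self k.im) hx

theorem epsilon_regSol (hu : Admissible u) :
    JointHol univ univ (fun x k => regSol u k x) ∧
      (∀ x, 0 ≤ x → ∀ k, ‖regSol u k x‖ ≤ 2 * fwdWeight u x k) ∧
      ∀ k, IsFwd (sinKernel k) u k (regSol u k) := by
  refine epsilon_isFwd hu (m₀ := fun x k => sinKernel k x)
    ⟨Continuous.continuousOn (continuous_sinKernel.comp (f := fun p : ℝ × ℂ => (p.2, p.1))
      (by fun_prop)), fun x hx => (differentiable_sinKernel x).differentiableOn⟩ fun x hx k => ?_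
  refine le_trans ?_ (le_fwdWeight hx k)
  refine (norm_sinKernel_le k x).trans ?_
  rw [abs_of_nonneg hx]
  exact mul_le_mul_of_nonneg_right (by linarith) (Real.exp_pos _).le

theorem isFwd_phi (hu : Admissible u) (k : ℂ) :
    IsFwd (fun x => Complex.exp (-(Complex.I * k * x))) u k (phi u k) := (epsilon_phi hu).2.2 k

theorem isFwd_regSol (hu : Admissible u) (k : ℂ) : IsFwd (sinKernel k) u k (regSol u k) :=
  (epsilon_regSol hu).2.2 k

theorem jointHol_phi (hu : Admissible u) : JointHol univ univ (fun x k => phi u k x) :=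
  (epsilon_phi hu).1

theorem jointHol_regSol (hu : Admissible u) : JointHol univ univ (fun x k => regSol u k x) :=
  (epsilon_regSol hu).1

theorem norm_phi_le (hu : Admissible u) {x : ℝ} (hx : 0 ≤ x) (k : ℂ) :
    ‖phi u k x‖ ≤ 2 * Real.exp (2 * totWeight u) * ((1 + x) * Real.exp (|k.im| * x)) := by
  have := (epsilon_phi hu).2.1 x hx k
  linarith [hu.fwdWeight_le hx k]

theorem norm_regSol_le (hu : Admissible u) {x : ℝ} (hx : 0 ≤ x) (k : ℂ) :
    ‖regSol u k x‖ ≤ 2 * Real.exp (2 * totWeight u) * ((1 + x) * Real.exp (|k.im| * x)) := by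
  have := (epsilon_regSol hu).2.1 x hx k
  linarith [hu.fwdWeight_le hx k]

section Jost

/-- One estimate for three kernels: sin(k·)/k with c = 1 or c = 1/‖k‖, and cos(k·) with c = 1. The
remaining factor is a tail of the weight integral, which vanishes as x → ∞. -/
theorem integrableOn_bwd (hu : Admissible u) {k : ℂ} {f : ℝ → ℂ}
    (hf : ContinuousOn f (Ici 0)) {L c : ℝ} {x : ℝ} (hx : 0 ≤ x)
    (hfL : ∀ ξ, 0 ≤ ξ → ‖f ξ‖ ≤ L * Real.exp (-(k.im * ξ))) {κ : ℝ → ℂ} (hκ : Continuous κ)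
    (hκc : ∀ ξ, x < ξ → ‖κ ξ‖ * |u ξ| ≤ c * Real.exp (k.im * (ξ - x)) * potWeight u ξ) :
    IntegrableOn (fun ξ => κ ξ * (u ξ : ℂ) * f ξ) (Ioi x) ∧
    ‖∫ ξ in Ioi x, κ ξ * (u ξ : ℂ) * f ξ‖
      ≤ c * L * Real.exp (-(k.im * x)) * ∫ ξ in Ioi x, potWeight u ξ := by
  have hsub : Ioi x ⊆ Ici 0 := fun ξ (hξ : x < ξ) => hx.trans hξ.le
  have hint := (hu.integrableOn_potWeight.mono_set (Ioi_subset_Ioi hx)).const_mul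
    (c * L * Real.exp (-(k.im * x)))
  have hle : ∀ᵐ ξ ∂volume.restrict (Ioi x), ‖κ ξ * (u ξ : ℂ) * f ξ‖
      ≤ c * L * Real.exp (-(k.im * x)) * potWeight u ξ := by
    refine (ae_restrict_iff' measurableSet_Ioi).2 (Eventually.of_forall fun ξ (hξ : x < ξ) => ?_)
    rw [norm_mul, norm_mul, Complex.norm_real, Real.norm_eq_abs]
    have h1 := hκc ξ hξ
    have h2 := hfL ξ (hx.trans hξ.le)
    calc _ ≤ (c * Real.exp (k.im * (ξ - x)) * potWeight u ξ) * (L * Real.exp (-(k.im * ξ))) := by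
          refine mul_le_mul h1 h2 (norm_nonneg _) (le_trans (by positivity) h1)
      _ = c * L * (Real.exp (k.im * (ξ - x)) * Real.exp (-(k.im * ξ))) * potWeight u ξ := by ring
      _ = _ := by rw [← Real.exp_add]; congr 3; ring
  have hu' := hu.cont
  refine ⟨hint.mono' (((Continuous.continuousOn (by fun_prop)).mul
    (hf.mono hsub)).aestronglyMeasurable measurableSet_Ioi) hle, ?_⟩
  rw [← integral_const_mul]
  exact norm_integral_le_of_norm_le hint hle

theorem norm_sinKernel_sub_mul_le (u : ℝ → ℝ) {k : ℂ} (hk : 0 ≤ k.im) {x : ℝ} (hx : 0 ≤ x) (ξ : ℝ)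
    (hξ : x < ξ) : ‖sinKernel k (x - ξ)‖ * |u ξ|
      ≤ 1 * Real.exp (k.im * (ξ - x)) * potWeight u ξ := by
  have h := norm_sinKernel_le k (x - ξ)
  rw [abs_of_neg (sub_neg.2 hξ), abs_of_nonneg hk, neg_sub] at h
  unfold potWeight
  rw [abs_of_pos (hx.trans_lt hξ)]
  calc _ ≤ (ξ - x) * Real.exp (k.im * (ξ - x)) * |u ξ| :=
        mul_le_mul_of_nonneg_right h (abs_nonneg _)
    _ ≤ (1 + ξ) * Real.exp (k.im * (ξ - x)) * |u ξ| := by gcongr; linarith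
    _ = _ := by ring

theorem norm_sinKernel_sub_mul_le_div (u : ℝ → ℝ) {k : ℂ} (hk : 0 ≤ k.im) (hk0 : k ≠ 0) {x : ℝ}
    (ξ : ℝ) (hξ : x < ξ) : ‖sinKernel k (x - ξ)‖ * |u ξ|
      ≤ 1 / ‖k‖ * Real.exp (k.im * (ξ - x)) * potWeight u ξ := by
  have h := norm_sinKernel_le_div hk0 (x - ξ)
  rw [abs_of_neg (sub_neg.2 hξ), abs_of_nonneg hk, neg_sub] at h
  refine mul_le_mul (h.trans_eq (by ring)) (Admissible.abs_le_potWeight u ξ) (abs_nonneg _)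
    (by positivity)

theorem norm_cos_sub_mul_le (u : ℝ → ℝ) {k : ℂ} (hk : 0 ≤ k.im) {x : ℝ} (ξ : ℝ)
    (hξ : x < ξ) : ‖Complex.cos (k * ((x - ξ : ℝ) : ℂ))‖ * |u ξ|
      ≤ 1 * Real.exp (k.im * (ξ - x)) * potWeight u ξ := by
  rw [one_mul]
  refine mul_le_mul ((norm_cos_le _).trans_eq ?_) (Admissible.abs_le_potWeight u ξ) (abs_nonneg _)
    (Real.exp_pos _).le
  have : (k * ((x - ξ : ℝ) : ℂ)).im = k.im * (x - ξ) := by simp [Complex.mul_im]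
  rw [this, abs_mul, abs_of_nonneg hk, abs_of_neg (sub_neg.2 hξ), neg_sub]

theorem IsPsi.unique (hu : Admissible u) {k : ℂ} (hk : 0 ≤ k.im) {f g : ℝ → ℂ}
    (hf : IsPsi u k f) (hg : IsPsi u k g) : ∀ x, 0 ≤ x → f x = g x := by
  obtain ⟨hfc, ⟨Cf, hCf⟩, hfe⟩ := hf
  obtain ⟨hgc, ⟨Cg, hCg⟩, hge⟩ := hg
  have hCf' : ∀ x, 0 ≤ x → ‖f x‖ ≤ |Cf| * Real.exp (-(k.im * x)) := fun x hx =>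
    (hCf x hx).trans (mul_le_mul_of_nonneg_right (le_abs_self _) (Real.exp_pos _).le)
  have hCg' : ∀ x, 0 ≤ x → ‖g x‖ ≤ |Cg| * Real.exp (-(k.im * x)) := fun x hx =>
    (hCg x hx).trans (mul_le_mul_of_nonneg_right (le_abs_self _) (Real.exp_pos _).le)
  intro X hX
  refine sub_eq_zero.1 (hu.volterraKernel_bwd.eq_zero_of_fixed (S := Ici 0) subset_rfl
    hk (d := fun x => f x - g x) (M := (|Cf| + |Cg|) * Real.exp (2 * totWeight u)) (by positivity)
    ?_ ?_ ?_ X hX)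
  · intro x hx
    refine (norm_sub_le _ _).trans ?_
    have h1 := hCf' x hx
    have h2 := hCg' x hx
    calc _ ≤ (|Cf| + |Cg|) * Real.exp (-(k.im * x)) := by linarith
      _ ≤ (|Cf| + |Cg|) * (Real.exp (2 * totWeight u) * bwdWeight u x k) :=
          mul_le_mul_of_nonneg_left (hu.le_bwdWeight hx k) (by positivity)
      _ = _ := by ring
  · intro x hx ξ hξ hξX
    exact absurd (mem_Ici.2 hξ.le) hξX
  · intro x hx
    rw [integral_bwdKernel hx, hfe x hx, hge x hx]
    simp only [mul_sub]
    rw [integral_sub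
      (integrableOn_bwd hu hfc hx hCf' (continuous_sinKernel_sub k x)
        (norm_sinKernel_sub_mul_le u hk hx)).1
      (integrableOn_bwd hu hgc hx hCg' (continuous_sinKernel_sub k x)
        (norm_sinKernel_sub_mul_le u hk hx)).1]
    ring

/-- A bound for the Jost solution `|ψ(x, k)| e^{x Im k}`. -/
noncomputable def jostBound (u : ℝ → ℝ) : ℝ := 2 * Real.exp (2 * totWeight u)

theorem jostBound_pos (u : ℝ → ℝ) : 0 < jostBound u := by unfold jostBound; positivity

theorem psi_spec (hu : Admissible u) :
    JointHol upperOpen upperClosed (fun x k => psi u k x) ∧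
      (∀ x, 0 ≤ x → ∀ k, 0 ≤ k.im → ‖psi u k x‖ ≤ jostBound u * Real.exp (-(k.im * x))) ∧
      ∀ k, 0 ≤ k.im → IsPsi u k (psi u k) := by
  obtain ⟨m, h1, h2, h3⟩ := hu.volterraKernel_bwd.exists_solution
    (m₀ := fun x k => Complex.exp (Complex.I * k * x)) (Real.exp_pos (2 * totWeight u)).le
    ⟨Continuous.continuousOn (by fun_prop), fun x hx =>
      Differentiable.differentiableOn (by fun_prop)⟩
    (fun x hx k _ => (norm_exp_I_mul k x).trans_le (hu.le_bwdWeight hx k))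
  have hb : ∀ x, 0 ≤ x → ∀ k, 0 ≤ k.im → ‖m x k‖ ≤ jostBound u * Real.exp (-(k.im * x)) :=
    fun x hx k hk => (h2 x hx k hk).trans
      (mul_le_mul_of_nonneg_left (bwdWeight_le hx k) (jostBound_pos u).le)
  have hm : ∀ k, 0 ≤ k.im → IsPsi u k (fun x => m x k) := fun k hk =>
    ⟨h1.continuousOn_left hk, ⟨_, fun x hx => hb x hx k hk⟩, fun x hx => by
      refine (h3 x hx k hk).trans ?_
      rw [integral_bwdKernel hx k (fun ξ => m ξ k)]⟩
  have hsp : ∀ k, 0 ≤ k.im → IsPsi u k (psi u k) := fun k hk =>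
    Classical.epsilon_spec ⟨_, hm k hk⟩
  have heq : ∀ x, 0 ≤ x → ∀ k, 0 ≤ k.im → psi u k x = m x k := fun x hx k hk =>
    (hsp k hk).unique hu hk (hm k hk) x hx
  exact ⟨h1.congr upperOpen_subset heq,
    fun x hx k hk => by rw [heq x hx k hk]; exact hb x hx k hk, hsp⟩

theorem isPsi_psi (hu : Admissible u) {k : ℂ} (hk : 0 ≤ k.im) : IsPsi u k (psi u k) :=
  (psi_spec hu).2.2 k hk

theorem jointHol_psi (hu : Admissible u) :
    JointHol upperOpen upperClosed (fun x k => psi u k x) := (psi_spec hu).1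

theorem norm_psi_le (hu : Admissible u) {x : ℝ} (hx : 0 ≤ x) {k : ℂ} (hk : 0 ≤ k.im) :
    ‖psi u k x‖ ≤ jostBound u * Real.exp (-(k.im * x)) := (psi_spec hu).2.1 x hx k hk

/-- The derivative `ψ_x(x, k)`. -/
noncomputable def psiD (u : ℝ → ℝ) (k : ℂ) (x : ℝ) : ℂ :=
  Complex.I * k * Complex.exp (Complex.I * k * x)
    + ∫ ξ in Ioi x, Complex.cos (k * ((x - ξ : ℝ) : ℂ)) * (u ξ : ℂ) * psi u k ξ

theorem norm_psi_sub_exp_le (hu : Admissible u) {x : ℝ} (hx : 0 ≤ x) {k : ℂ} (hk : 0 ≤ k.im) :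
    ‖psi u k x - Complex.exp (Complex.I * k * x)‖
      ≤ jostBound u * Real.exp (-(k.im * x)) * ∫ ξ in Ioi x, potWeight u ξ := by
  rw [(isPsi_psi hu hk).2.2 x hx, add_sub_cancel_left]
  have := (integrableOn_bwd hu (isPsi_psi hu hk).1 hx
    (fun ξ hξ => norm_psi_le hu hξ hk) (continuous_sinKernel_sub k x)
    (norm_sinKernel_sub_mul_le u hk hx)).2
  rwa [one_mul] at this

/-- Where `norm_psi_sub_exp_le` gives the asymptotics as x → ∞ uniformly in k, this version gives
those as k → ∞. -/
theorem norm_psi_sub_exp_le_div (hu : Admissible u) {x : ℝ} (hx : 0 ≤ x) {k : ℂ} (hk : 0 ≤ k.im)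
    (hk0 : k ≠ 0) : ‖psi u k x - Complex.exp (Complex.I * k * x)‖
      ≤ 1 / ‖k‖ * jostBound u * Real.exp (-(k.im * x)) * ∫ ξ in Ioi x, potWeight u ξ := by
  rw [(isPsi_psi hu hk).2.2 x hx, add_sub_cancel_left]
  exact (integrableOn_bwd hu (isPsi_psi hu hk).1 hx
    (fun ξ hξ => norm_psi_le hu hξ hk) (continuous_sinKernel_sub k x)
    (norm_sinKernel_sub_mul_le_div u hk hk0)).2

theorem norm_psiD_sub_exp_le (hu : Admissible u) {x : ℝ} (hx : 0 ≤ x) {k : ℂ} (hk : 0 ≤ k.im) :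
    ‖psiD u k x - Complex.I * k * Complex.exp (Complex.I * k * x)‖
      ≤ jostBound u * Real.exp (-(k.im * x)) * ∫ ξ in Ioi x, potWeight u ξ := by
  rw [psiD, add_sub_cancel_left]
  have := (integrableOn_bwd hu (isPsi_psi hu hk).1 hx
    (fun ξ hξ => norm_psi_le hu hξ hk)
    (κ := fun ξ => Complex.cos (k * ((x - ξ : ℝ) : ℂ))) (by fun_prop)
    (norm_cos_sub_mul_le u hk)).2
  rwa [one_mul] at this

theorem integral_Ioi_potWeight_le (hu : Admissible u) {x : ℝ} (hx : 0 ≤ x) :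
    ∫ ξ in Ioi x, potWeight u ξ ≤ totWeight u :=
  setIntegral_mono_set hu.integrableOn_potWeight
    (Eventually.of_forall fun _ => potWeight_nonneg u _) (Ioi_subset_Ioi hx).eventuallyLE

theorem tendsto_integral_Ioi_potWeight (hu : Admissible u) :
    Tendsto (fun x => ∫ ξ in Ioi x, potWeight u ξ) atTop (𝓝 0) := by
  have h := hu.tendsto_cumWeight.const_sub (totWeight u)
  rw [sub_self] at h
  refine h.congr' ?_
  filter_upwards [eventually_ge_atTop 0] with x hx
  have := intervalIntegral.integral_Ioi_sub_Ioi (f := potWeight u) hu.integrableOn_potWeight hx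
  unfold totWeight cumWeight
  linarith

theorem norm_psiD_le (hu : Admissible u) {x : ℝ} (hx : 0 ≤ x) {k : ℂ} (hk : 0 ≤ k.im) :
    ‖psiD u k x‖ ≤ (‖k‖ + jostBound u * totWeight u) * Real.exp (-(k.im * x)) := by
  have h1 := norm_psiD_sub_exp_le hu hx hk
  have h2 : ‖Complex.I * k * Complex.exp (Complex.I * k * x)‖ = ‖k‖ * Real.exp (-(k.im * x)) := by
    rw [norm_mul, norm_exp_I_mul]; simp
  have h3 := norm_le_norm_sub_add (psiD u k x) (Complex.I * k * Complex.exp (Complex.I * k * x))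
  have h4 : jostBound u * Real.exp (-(k.im * x)) * ∫ ξ in Ioi x, potWeight u ξ
      ≤ jostBound u * Real.exp (-(k.im * x)) * totWeight u :=
    mul_le_mul_of_nonneg_left (integral_Ioi_potWeight_le hu hx)
      (mul_nonneg (jostBound_pos u).le (Real.exp_pos _).le)
  rw [h2] at h3
  nlinarith

end Jost

end QuarterPlane

/-! ### From integral equations to the differential equation; Wronskians, bounds and symmetries. -/

namespace QuarterPlane

open Filter Topology

variable {u : ℝ → ℝ}

theorem cos_mul_sub (k : ℂ) (x ξ : ℝ) : Complex.cos (k * ((x - ξ : ℝ) : ℂ))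
    = Complex.cos (k * x) * Complex.cos (k * ξ) + k ^ 2 * (sinKernel k x * sinKernel k ξ) := by
  rw [Complex.ofReal_sub, mul_sub, Complex.cos_sub, ← mul_sinKernel, ← mul_sinKernel]
  ring

theorem continuous_sinKernel_right (k : ℂ) : Continuous (sinKernel k) :=
  continuous_sinKernel.comp (f := fun ξ : ℝ => (k, ξ)) (by fun_prop)

theorem integral_sinKernel_sub (k : ℂ) {g : ℝ → ℂ} (hg : Continuous g) (x : ℝ) :
    ∫ ξ in (0 : ℝ)..x, sinKernel k (x - ξ) * g ξ
      = sinKernel k x * (∫ ξ in (0 : ℝ)..x, Complex.cos (k * ξ) * g ξ)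
        - Complex.cos (k * x) * ∫ ξ in (0 : ℝ)..x, sinKernel k ξ * g ξ := by
  have := continuous_sinKernel_right k
  rw [← intervalIntegral.integral_const_mul, ← intervalIntegral.integral_const_mul,
    ← intervalIntegral.integral_sub (Continuous.intervalIntegrable (by fun_prop) _ _)
      (Continuous.intervalIntegrable (by fun_prop) _ _)]
  congr 1 with ξ
  rw [sinKernel_sub]
  ring

theorem integral_cos_sub (k : ℂ) {g : ℝ → ℂ} (hg : Continuous g) (x : ℝ) :
    ∫ ξ in (0 : ℝ)..x, Complex.cos (k * ((x - ξ : ℝ) : ℂ)) * g ξ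
      = Complex.cos (k * x) * (∫ ξ in (0 : ℝ)..x, Complex.cos (k * ξ) * g ξ)
        + k ^ 2 * sinKernel k x * ∫ ξ in (0 : ℝ)..x, sinKernel k ξ * g ξ := by
  have := continuous_sinKernel_right k
  rw [← intervalIntegral.integral_const_mul, ← intervalIntegral.integral_const_mul,
    ← intervalIntegral.integral_add (Continuous.intervalIntegrable (by fun_prop) _ _)
      (Continuous.intervalIntegrable (by fun_prop) _ _)]
  congr 1 with ξ
  rw [cos_mul_sub]
  ring

/-- The addition formula separates x from ξ, after which only the fundamental theorem of calculus
and the product rule are needed. -/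
theorem hasDerivAt_integral_sinKernel_sub (k : ℂ) {g : ℝ → ℂ} (hg : Continuous g) (x : ℝ) :
    HasDerivAt (fun x => ∫ ξ in (0 : ℝ)..x, sinKernel k (x - ξ) * g ξ)
      (∫ ξ in (0 : ℝ)..x, Complex.cos (k * ((x - ξ : ℝ) : ℂ)) * g ξ) x := by
  have hsc := continuous_sinKernel_right k
  have h1 : HasDerivAt (fun x : ℝ => ∫ ξ in (0 : ℝ)..x, Complex.cos (k * ξ) * g ξ)
      (Complex.cos (k * x) * g x) x :=
    (Continuous.integral_hasStrictDerivAt (by fun_prop) 0 x).hasDerivAt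
  have h2 : HasDerivAt (fun x : ℝ => ∫ ξ in (0 : ℝ)..x, sinKernel k ξ * g ξ)
      (sinKernel k x * g x) x :=
    (Continuous.integral_hasStrictDerivAt (by fun_prop) 0 x).hasDerivAt
  have := ((hasDerivAt_sinKernel k x).fun_mul h1).fun_sub ((hasDerivAt_cos_mul k x).fun_mul h2)
  rw [funext (integral_sinKernel_sub k hg), integral_cos_sub k hg]
  exact this.congr_deriv (by ring)

theorem hasDerivAt_integral_cos_sub (k : ℂ) {g : ℝ → ℂ} (hg : Continuous g) (x : ℝ) :
    HasDerivAt (fun x => ∫ ξ in (0 : ℝ)..x, Complex.cos (k * ((x - ξ : ℝ) : ℂ)) * g ξ)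
      (g x - k ^ 2 * ∫ ξ in (0 : ℝ)..x, sinKernel k (x - ξ) * g ξ) x := by
  have hsc := continuous_sinKernel_right k
  have h1 : HasDerivAt (fun x : ℝ => ∫ ξ in (0 : ℝ)..x, Complex.cos (k * ξ) * g ξ)
      (Complex.cos (k * x) * g x) x :=
    (Continuous.integral_hasStrictDerivAt (by fun_prop) 0 x).hasDerivAt
  have h2 : HasDerivAt (fun x : ℝ => ∫ ξ in (0 : ℝ)..x, sinKernel k ξ * g ξ)
      (sinKernel k x * g x) x :=
    (Continuous.integral_hasStrictDerivAt (by fun_prop) 0 x).hasDerivAt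
  have := ((hasDerivAt_cos_mul k x).fun_mul h1).fun_add
    (((hasDerivAt_sinKernel k x).const_mul (k ^ 2)).fun_mul h2)
  rw [funext (integral_cos_sub k hg), integral_sinKernel_sub k hg]
  refine this.congr_deriv ?_
  -- This is cos² + sin² = 1 in a form that also covers k = 0.
  have h3 : Complex.cos (k * x) ^ 2 + k ^ 2 * sinKernel k x ^ 2 = 1 := by
    rw [← mul_pow, mul_sinKernel, add_comm, Complex.sin_sq_add_cos_sq]
  linear_combination g x * h3

theorem IsFwd.isSol (hu : Admissible u) {m₀ m₁ : ℝ → ℂ} {k : ℂ} {f : ℝ → ℂ}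
    (hf : IsFwd m₀ u k f) (h0 : ∀ x, HasDerivAt m₀ (m₁ x) x)
    (h1 : ∀ x, HasDerivAt m₁ (-(k ^ 2 * m₀ x)) x) :
    IsSol u k f fun x => m₁ x
      - ∫ ξ in (0 : ℝ)..x, Complex.cos (k * ((x - ξ : ℝ) : ℂ)) * (u ξ : ℂ) * f ξ := by
  -- Reading f at |ξ| makes the integrand continuous on all of ℝ, so that two-sided derivatives
  -- exist even at 0.
  let g : ℝ → ℂ := fun ξ => u ξ * f |ξ|
  have hg : Continuous g := by
    have h := hf.1.comp_continuous continuous_abs fun x => abs_nonneg x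
    have := hu.cont
    exact Continuous.mul (by fun_prop) h
  have hS : ∀ x, 0 ≤ x → ∀ κ : ℝ → ℂ, ∫ ξ in (0 : ℝ)..x, κ ξ * (u ξ : ℂ) * f ξ
      = ∫ ξ in (0 : ℝ)..x, κ ξ * g ξ := fun x hx κ => by
    refine intervalIntegral.integral_congr fun ξ hξ => ?_
    rw [uIcc_of_le hx] at hξ
    simp only [g, abs_of_nonneg hξ.1, mul_assoc]
  have hfe : ∀ x, 0 ≤ x → f x = m₀ x - ∫ ξ in (0 : ℝ)..x, sinKernel k (x - ξ) * g ξ :=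
    fun x hx => by rw [hf.2 x hx, hS x hx]
  constructor
  · intro x hx
    have h := ((h0 x).sub (hasDerivAt_integral_sinKernel_sub k hg x)).hasDerivWithinAt (s := Ici 0)
    rw [hS x hx]
    exact h.congr (fun y hy => hfe y hy) (hfe x hx)
  · intro x hx
    have h := ((h1 x).sub (hasDerivAt_integral_cos_sub k hg x)).hasDerivWithinAt (s := Ici 0)
    refine (h.congr (fun y hy => by simp only [hS y hy]; rfl) (by simp only [hS x hx]; rfl)
      ).congr_deriv ?_
    have := hfe x hx
    simp only [g, abs_of_nonneg hx] at this ⊢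
    linear_combination k ^ 2 * this

theorem IsSol.congr_deriv {k : ℂ} {f f' g' : ℝ → ℂ} (hf : IsSol u k f f')
    (h : ∀ x, 0 ≤ x → g' x = f' x) : IsSol u k f g' :=
  ⟨fun x hx => (hf.deriv_fst x hx).congr_deriv (h x hx).symm,
    fun x hx => (hf.deriv_snd x hx).congr h (h x hx)⟩

theorem hasDerivAt_exp_mul (c : ℂ) (x : ℝ) :
    HasDerivAt (fun x : ℝ => Complex.exp (c * x)) (c * Complex.exp (c * x)) x := by
  have h0 : HasDerivAt (fun t : ℝ => (t : ℂ)) 1 x := Complex.ofRealCLM.hasDerivAt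
  have h := (Complex.hasDerivAt_exp (c * x)).comp x (h0.const_mul c)
  exact h.congr_deriv (by ring)

/-- The derivative `φ_x(x, k)`. -/
noncomputable def phiD (u : ℝ → ℝ) (k : ℂ) (x : ℝ) : ℂ :=
  -(Complex.I * k) * Complex.exp (-(Complex.I * k) * x)
    - ∫ ξ in (0 : ℝ)..x, Complex.cos (k * ((x - ξ : ℝ) : ℂ)) * (u ξ : ℂ) * phi u k ξ

/-- The derivative of `regSol u k`. -/
noncomputable def regSolD (u : ℝ → ℝ) (k : ℂ) (x : ℝ) : ℂ :=
  Complex.cos (k * x)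
    - ∫ ξ in (0 : ℝ)..x, Complex.cos (k * ((x - ξ : ℝ) : ℂ)) * (u ξ : ℂ) * regSol u k ξ

theorem isSol_phi (hu : Admissible u) (k : ℂ) : IsSol u k (phi u k) (phiD u k) := by
  have h : IsFwd (fun x => Complex.exp (-(Complex.I * k) * x)) u k (phi u k) := by
    simpa only [neg_mul] using isFwd_phi hu k
  refine h.isSol hu (fun x => hasDerivAt_exp_mul _ x) fun x => ?_
  refine ((hasDerivAt_exp_mul (-(Complex.I * k)) x).const_mul (-(Complex.I * k))).congr_deriv ?_
  linear_combination k ^ 2 * Complex.exp (-(Complex.I * k) * x) * Complex.I_sq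

theorem isSol_regSol (hu : Admissible u) (k : ℂ) : IsSol u k (regSol u k) (regSolD u k) :=
  (isFwd_regSol hu k).isSol hu (fun x => hasDerivAt_sinKernel k x) fun x => hasDerivAt_cos_mul k x

/-- Writing the integral over (x, ∞) as the one over (0, ∞) minus the one over (0, x), the first is
a combination A sin(kx)/k - B cos(kx) by the addition formula. Hence ψ solves a forward equation
with a new free term, and `IsFwd.isSol` applies. -/
theorem isSol_psi (hu : Admissible u) {k : ℂ} (hk : 0 ≤ k.im) :
    IsSol u k (psi u k) (psiD u k) := by
  have hpsi := isPsi_psi hu hk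
  have hint : ∀ κ : ℝ → ℂ, Continuous κ → (∃ c, ∀ ξ, 0 < ξ → ‖κ ξ‖ * |u ξ|
      ≤ c * Real.exp (k.im * (ξ - 0)) * potWeight u ξ) →
      IntegrableOn (fun ξ => κ ξ * (u ξ : ℂ) * psi u k ξ) (Ioi 0) := fun κ hκ ⟨c, hc⟩ =>
    (integrableOn_bwd hu hpsi.1 le_rfl (fun ξ hξ => norm_psi_le hu hξ hk) hκ hc).1
  have hs := hint (sinKernel k) (continuous_sinKernel_right k) ⟨1, fun ξ hξ => by
    have := norm_sinKernel_sub_mul_le u hk le_rfl ξ hξ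
    rwa [zero_sub, sinKernel_neg_right, norm_neg] at this⟩
  have hc := hint (fun ξ => Complex.cos (k * ξ)) (by fun_prop) ⟨1, fun ξ hξ => by
    have := norm_cos_sub_mul_le u hk (x := 0) ξ hξ
    rwa [zero_sub, Complex.ofReal_neg, mul_neg, Complex.cos_neg] at this⟩
  let A := ∫ ξ in Ioi (0 : ℝ), Complex.cos (k * ξ) * (u ξ : ℂ) * psi u k ξ
  let B := ∫ ξ in Ioi (0 : ℝ), sinKernel k ξ * (u ξ : ℂ) * psi u k ξ
  have hsplit : ∀ x, 0 ≤ x → ∀ κ : ℝ → ℂ,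
      IntegrableOn (fun ξ => κ ξ * (u ξ : ℂ) * psi u k ξ) (Ioi 0) →
      ∫ ξ in Ioi x, κ ξ * (u ξ : ℂ) * psi u k ξ
        = (∫ ξ in Ioi (0 : ℝ), κ ξ * (u ξ : ℂ) * psi u k ξ)
          - ∫ ξ in (0 : ℝ)..x, κ ξ * (u ξ : ℂ) * psi u k ξ := fun x hx κ hκ => by
    rw [← intervalIntegral.integral_Ioi_sub_Ioi hκ hx]
    ring
  have hsx : ∀ x, IntegrableOn
      (fun ξ => sinKernel k (x - ξ) * (u ξ : ℂ) * psi u k ξ) (Ioi 0) ∧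
      ∫ ξ in Ioi (0 : ℝ), sinKernel k (x - ξ) * (u ξ : ℂ) * psi u k ξ
        = sinKernel k x * A - Complex.cos (k * x) * B := fun x => by
    have heq : (fun ξ : ℝ => sinKernel k (x - ξ) * (u ξ : ℂ) * psi u k ξ)
        = fun ξ : ℝ => sinKernel k x * (Complex.cos (k * ξ) * (u ξ : ℂ) * psi u k ξ)
          - Complex.cos (k * x) * (sinKernel k ξ * (u ξ : ℂ) * psi u k ξ) := by
      ext ξ; rw [sinKernel_sub]; ring
    rw [heq]
    exact ⟨(hc.const_mul _).sub (hs.const_mul _), by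
      rw [integral_sub (hc.const_mul _) (hs.const_mul _), integral_const_mul, integral_const_mul]⟩
  have hcx : ∀ x : ℝ, IntegrableOn
      (fun ξ : ℝ => Complex.cos (k * ((x - ξ : ℝ) : ℂ)) * (u ξ : ℂ) * psi u k ξ) (Ioi 0) ∧
      ∫ ξ in Ioi (0 : ℝ), Complex.cos (k * ((x - ξ : ℝ) : ℂ)) * (u ξ : ℂ) * psi u k ξ
        = Complex.cos (k * x) * A + k ^ 2 * sinKernel k x * B := fun x => by
    have heq : (fun ξ : ℝ => Complex.cos (k * ((x - ξ : ℝ) : ℂ)) * (u ξ : ℂ) * psi u k ξ)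
        = fun ξ : ℝ => Complex.cos (k * x) * (Complex.cos (k * ξ) * (u ξ : ℂ) * psi u k ξ)
          + k ^ 2 * sinKernel k x * (sinKernel k ξ * (u ξ : ℂ) * psi u k ξ) := by
      ext ξ; rw [cos_mul_sub]; ring
    rw [heq]
    exact ⟨(hc.const_mul _).add (hs.const_mul _), by
      rw [integral_add (hc.const_mul _) (hs.const_mul _), integral_const_mul, integral_const_mul]⟩
  have hfwd : IsFwd (fun x => Complex.exp (Complex.I * k * x)
      + (sinKernel k x * A - Complex.cos (k * x) * B)) u k (psi u k) := by
    refine ⟨hpsi.1, fun x hx => ?_⟩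
    rw [hpsi.2.2 x hx, hsplit x hx _ (hsx x).1, (hsx x).2]
    ring
  have hsol := hfwd.isSol hu (m₁ := fun x => Complex.I * k * Complex.exp (Complex.I * k * x)
      + (Complex.cos (k * x) * A + k ^ 2 * sinKernel k x * B))
    (fun x => ((hasDerivAt_exp_mul (Complex.I * k) x).fun_add
      (((hasDerivAt_sinKernel k x).mul_const A).fun_sub
        ((hasDerivAt_cos_mul k x).mul_const B))).congr_deriv (by ring))
    (fun x => (((hasDerivAt_exp_mul (Complex.I * k) x).const_mul (Complex.I * k)).fun_add
      (((hasDerivAt_cos_mul k x).mul_const A).fun_add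
        (((hasDerivAt_sinKernel k x).const_mul (k ^ 2)).mul_const B))).congr_deriv (by
          linear_combination k ^ 2 * Complex.exp (Complex.I * k * x) * Complex.I_sq))
  have hD : ∀ x, 0 ≤ x → psiD u k x = Complex.I * k * Complex.exp (Complex.I * k * x)
      + (Complex.cos (k * x) * A + k ^ 2 * sinKernel k x * B)
      - ∫ ξ in (0 : ℝ)..x, Complex.cos (k * ((x - ξ : ℝ) : ℂ)) * (u ξ : ℂ) * psi u k ξ :=
    fun x hx => by rw [psiD, hsplit x hx _ (hcx x).1, (hcx x).2]; ring
  exact hsol.congr_deriv hD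

namespace IsSol

variable {k l : ℂ} {f f' g g' : ℝ → ℂ}

theorem continuousOn (hf : IsSol u k f f') : ContinuousOn f (Ici 0) :=
  fun x hx => (hf.deriv_fst x hx).continuousWithinAt

theorem continuousOn_deriv (hf : IsSol u k f f') : ContinuousOn f' (Ici 0) :=
  fun x hx => (hf.deriv_snd x hx).continuousWithinAt

theorem derivWithin_zero (hf : IsSol u k f f') : derivWithin f (Ici 0) 0 = f' 0 :=
  (hf.deriv_fst 0 le_rfl).derivWithin (uniqueDiffOn_Ici 0 0 self_mem_Ici)

theorem lagrange (hf : IsSol u k f f') (hg : IsSol u l g g') {x : ℝ} (hx : 0 ≤ x) :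
    HasDerivWithinAt (fun x => f x * g' x - f' x * g x) ((k ^ 2 - l ^ 2) * (f x * g x))
      (Ici 0) x := by
  refine (((hf.deriv_fst x hx).fun_mul (hg.deriv_snd x hx)).fun_sub
    ((hf.deriv_snd x hx).fun_mul (hg.deriv_fst x hx))).congr_deriv ?_
  ring

/-- For k² = l² this is constancy of the Wronskian; for k² ≠ l² it turns integrals of products into
boundary terms, which is how zeros of ψ(0,k) are excluded. -/
theorem integral_lagrange (hf : IsSol u k f f') (hg : IsSol u l g g') {x : ℝ} (hx : 0 ≤ x) :
    (k ^ 2 - l ^ 2) * ∫ ξ in (0 : ℝ)..x, f ξ * g ξ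
      = (f x * g' x - f' x * g x) - (f 0 * g' 0 - f' 0 * g 0) := by
  rw [← intervalIntegral.integral_const_mul]
  refine intervalIntegral.integral_eq_sub_of_hasDeriv_right_of_le
    (f := fun x => f x * g' x - f' x * g x) hx ?_ (fun ξ hξ => ?_) ?_
  · exact fun ξ hξ => ((hf.lagrange hg hξ.1).continuousWithinAt).mono Icc_subset_Ici_self
  · exact (hf.lagrange hg hξ.1.le).mono fun y (hy : ξ < y) => hξ.1.le.trans hy.le
  · refine ContinuousOn.intervalIntegrable ?_
    rw [uIcc_of_le hx]
    exact continuousOn_const.mul ((hf.continuousOn.mul hg.continuousOn).mono Icc_subset_Ici_self)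

theorem wronskian (hf : IsSol u k f f') (hg : IsSol u l g g') (h : k ^ 2 = l ^ 2) {x : ℝ}
    (hx : 0 ≤ x) : f x * g' x - f' x * g x = f 0 * g' 0 - f' 0 * g 0 := by
  have := hf.integral_lagrange hg hx
  rw [h, sub_self, zero_mul] at this
  exact (sub_eq_zero.1 this.symm)

end IsSol

theorem phi_zero (hu : Admissible u) (k : ℂ) : phi u k 0 = 1 := by
  rw [(isFwd_phi hu k).2 0 le_rfl]; simp

theorem phiX0_eq (hu : Admissible u) (k : ℂ) : phiX0 u k = -(Complex.I * k) := by
  rw [phiX0, (isSol_phi hu k).derivWithin_zero, phiD]; simp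

theorem psiX0_eq (hu : Admissible u) {k : ℂ} (hk : 0 ≤ k.im) : psiX0 u k = psiD u k 0 :=
  (isSol_psi hu hk).derivWithin_zero

theorem regSol_zero (hu : Admissible u) (k : ℂ) : regSol u k 0 = 0 := by
  rw [(isFwd_regSol hu k).2 0 le_rfl]; simp [sinKernel_zero_right]

theorem regSolD_zero (u : ℝ → ℝ) (k : ℂ) : regSolD u k 0 = 1 := by
  simp [regSolD]

theorem holCont_psiX0 (hu : Admissible u) : HolCont upperOpen upperClosed (psiX0 u) := by
  have h : HolCont upperOpen upperClosed (fun k => Complex.I * k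
      + ∫ ξ in Ioi (0 : ℝ), Complex.cos (k * ((0 - ξ : ℝ) : ℂ)) * (u ξ : ℂ) * psi u k ξ) := by
    refine (HolCont.of_differentiable (by fun_prop)).add
      (HolCont.integral isOpen_upperOpen upperOpen_subset (fun k hk => ?_) ?_ fun k₀ hk₀ => ?_)
    · exact (integrableOn_bwd hu (isPsi_psi hu hk).1 le_rfl
        (fun ξ hξ => norm_psi_le hu hξ hk)
        (κ := fun ξ => Complex.cos (k * ((0 - ξ : ℝ) : ℂ))) (by fun_prop)
        (norm_cos_sub_mul_le u hk)).1.aestronglyMeasurable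
    · refine (ae_restrict_iff' measurableSet_Ioi).2
        (Eventually.of_forall fun ξ (hξ : 0 < ξ) => ?_)
      exact (HolCont.of_differentiable (by fun_prop)).mul ((jointHol_psi hu).holCont hξ.le)
    · refine ⟨fun ξ => jostBound u * potWeight u ξ, hu.integrableOn_potWeight.const_mul _, _,
        self_mem_nhdsWithin, (ae_restrict_iff' measurableSet_Ioi).2
        (Eventually.of_forall fun ξ (hξ : 0 < ξ) k hk => ?_)⟩
      have hk' : 0 ≤ k.im := hk
      rw [norm_mul, norm_mul, Complex.norm_real, Real.norm_eq_abs]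
      have h1 := norm_cos_sub_mul_le u hk' (x := 0) ξ hξ
      have h2 := norm_psi_le hu hξ.le hk'
      calc _ ≤ (1 * Real.exp (k.im * (ξ - 0)) * potWeight u ξ) *
            (jostBound u * Real.exp (-(k.im * ξ))) :=
            mul_le_mul h1 h2 (norm_nonneg _) (le_trans (by positivity) h1)
        _ = (Real.exp (k.im * (ξ - 0)) * Real.exp (-(k.im * ξ))) *
              (jostBound u * potWeight u ξ) := by ring
        _ = _ := by rw [← Real.exp_add]; simp
  refine h.congr upperOpen_subset fun k hk => ?_
  rw [psiX0_eq hu hk, psiD]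
  simp

/-- The linear factor 1 + ξ of f is absorbed by the weight of u, so the integral grows only like
e^{bx}. -/
theorem norm_integral_fwd_le (hu : Admissible u) {f : ℝ → ℂ} {κ : ℝ → ℂ} {b c L x : ℝ}
    (hx : 0 ≤ x) (hf : ∀ ξ, 0 ≤ ξ → ‖f ξ‖ ≤ L * ((1 + ξ) * Real.exp (b * ξ)))
    (hκ : ∀ ξ, 0 ≤ ξ → ξ ≤ x → ‖κ ξ‖ ≤ c * Real.exp (b * (x - ξ))) (hc : 0 ≤ c) (hL : 0 ≤ L) :
    ‖∫ ξ in (0 : ℝ)..x, κ ξ * (u ξ : ℂ) * f ξ‖ ≤ c * L * totWeight u * Real.exp (b * x) := by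
  have hle : ∀ᵐ ξ, ξ ∈ Ioc 0 x → ‖κ ξ * (u ξ : ℂ) * f ξ‖
      ≤ c * L * Real.exp (b * x) * potWeight u ξ := by
    refine Eventually.of_forall fun ξ hξ => ?_
    rw [norm_mul, norm_mul, Complex.norm_real, Real.norm_eq_abs]
    have h1 := hκ ξ hξ.1.le hξ.2
    have h2 := hf ξ hξ.1.le
    calc _ ≤ (c * Real.exp (b * (x - ξ)) * |u ξ|) * (L * ((1 + ξ) * Real.exp (b * ξ))) := by
          gcongr
      _ = c * L * (Real.exp (b * (x - ξ)) * Real.exp (b * ξ)) * ((1 + ξ) * |u ξ|) := by ring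
      _ = _ := by
          rw [← Real.exp_add, potWeight, abs_of_pos hξ.1]; congr 3; ring
  refine (intervalIntegral.norm_integral_le_of_norm_le hx hle
    (hu.continuous_potWeight.intervalIntegrable _ _ |>.const_mul _)).trans ?_
  rw [intervalIntegral.integral_const_mul]
  calc _ ≤ c * L * Real.exp (b * x) * totWeight u :=
        mul_le_mul_of_nonneg_left (hu.cumWeight_le hx) (by positivity)
    _ = _ := by ring

/-- Bootstrap: the crude bound with factor 1 + x is inserted into the integral equation with the 1/k
kernel bound, and the factor disappears. The global relation for φ needs this, since only e^{|Im
k|x} q(x,0), without a factor 1 + x, is assumed integrable there. -/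
theorem norm_phi_le_of_ne_zero (hu : Admissible u) {x : ℝ} (hx : 0 ≤ x) {k : ℂ} (hk : k ≠ 0) :
    ‖phi u k x‖ ≤ (1 + 1 / ‖k‖ * (2 * Real.exp (2 * totWeight u)) * totWeight u) *
      Real.exp (|k.im| * x) := by
  rw [(isFwd_phi hu k).2 x hx]
  refine (norm_sub_le _ _).trans ?_
  rw [add_mul, one_mul]
  refine add_le_add ?_ (norm_integral_fwd_le hu hx (fun ξ hξ => norm_phi_le hu hξ k)
    (fun ξ _ hξ => ?_) (by positivity) (by positivity))
  · rw [Complex.norm_exp]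
    refine Real.exp_le_exp.2 ?_
    simpa using mul_le_mul_of_nonneg_right (le_abs_self k.im) hx
  · refine (norm_sinKernel_le_div hk _).trans_eq ?_
    rw [abs_of_nonneg (sub_nonneg.2 hξ)]
    ring

theorem norm_phiD_le (hu : Admissible u) {x : ℝ} (hx : 0 ≤ x) {k : ℂ} (hk : k.im = 0) :
    ‖phiD u k x‖ ≤ ‖k‖ + 2 * Real.exp (2 * totWeight u) * totWeight u := by
  have h := norm_integral_fwd_le hu (κ := fun ξ => Complex.cos (k * ((x - ξ : ℝ) : ℂ)))
    (c := 1) hx (fun ξ hξ => norm_phi_le hu hξ k) (fun ξ _ hξ => ?_) zero_le_one (by positivity)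
  · rw [phiD]
    refine (norm_sub_le _ _).trans ?_
    refine add_le_add (le_of_eq ?_) (h.trans_eq ?_)
    · rw [norm_mul, Complex.norm_exp]
      simp [hk]
    · simp [hk]
  · refine (norm_cos_le _).trans_eq ?_
    simp [Complex.mul_im, hk]

theorem neg_conj_im (k : ℂ) : (-(starRingEnd ℂ) k).im = k.im := by simp

/-- The map k ↦ -k̄ preserves the upper half plane, and conjugation carries the equation at k to the
one at -k̄; uniqueness does the rest. So ψ is real on the imaginary axis, and ψ(·,-k) is the
conjugate of ψ(·,k) for real k. -/
theorem psi_neg_conj (hu : Admissible u) {k : ℂ} (hk : 0 ≤ k.im) {x : ℝ} (hx : 0 ≤ x) :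
    psi u (-(starRingEnd ℂ) k) x = (starRingEnd ℂ) (psi u k x) := by
  have hk' : 0 ≤ (-(starRingEnd ℂ) k).im := by rwa [neg_conj_im]
  obtain ⟨hc, ⟨C, hC⟩, he⟩ := isPsi_psi hu hk
  refine (isPsi_psi hu hk').unique hu hk'
    (g := fun x => (starRingEnd ℂ) (psi u k x)) ⟨?_, ⟨C, fun x hx => ?_⟩, fun x hx => ?_⟩ x hx
  · exact Complex.continuous_conj.comp_continuousOn hc
  · rw [neg_conj_im, RCLike.norm_conj]
    exact hC x hx
  · refine (congrArg (starRingEnd ℂ) (he x hx)).trans ?_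
    rw [map_add, ← Complex.exp_conj, ← integral_conj]
    congr 1
    · simp
    · refine integral_congr_ae (Eventually.of_forall fun ξ => ?_)
      simp only [map_mul, conj_sinKernel, Complex.conj_ofReal, sinKernel_neg_left]

theorem psiD_neg_conj (hu : Admissible u) {k : ℂ} (hk : 0 ≤ k.im) {x : ℝ} (hx : 0 ≤ x) :
    psiD u (-(starRingEnd ℂ) k) x = (starRingEnd ℂ) (psiD u k x) := by
  rw [psiD, psiD, map_add, ← integral_conj, map_mul, map_mul, ← Complex.exp_conj]
  congr 1
  · simp
  · refine setIntegral_congr_fun measurableSet_Ioi fun ξ (hξ : x < ξ) => ?_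
    simp only [map_mul, Complex.conj_ofReal, psi_neg_conj hu hk (hx.trans hξ.le),
      ← Complex.cos_conj, neg_mul, Complex.cos_neg]

theorem regSol_neg (u : ℝ → ℝ) (k : ℂ) : regSol u (-k) = regSol u k := by
  have : IsFwd (sinKernel (-k)) u (-k) = IsFwd (sinKernel k) u k := by
    unfold IsFwd
    simp only [sinKernel_neg_left]
  rw [regSol, regSol, this]

theorem regSol_conj (hu : Admissible u) (k : ℂ) {x : ℝ} (hx : 0 ≤ x) :
    regSol u ((starRingEnd ℂ) k) x = (starRingEnd ℂ) (regSol u k x) := by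
  obtain ⟨hc, he⟩ := isFwd_regSol hu k
  refine (isFwd_regSol hu _).unique hu
    (g := fun x => (starRingEnd ℂ) (regSol u k x)) ⟨?_, fun x hx => ?_⟩ x hx
  · exact Complex.continuous_conj.comp_continuousOn hc
  · refine (congrArg (starRingEnd ℂ) (he x hx)).trans ?_
    rw [map_sub, conj_sinKernel, intervalIntegral.integral_of_le hx, intervalIntegral.integral_of_le hx, ← integral_conj]
    simp only [map_mul, conj_sinKernel, Complex.conj_ofReal]

end QuarterPlane

/-! ### Absence of zeros of ψ(0,k) in the closed upper half plane. -/

namespace QuarterPlane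

open Filter Topology

variable {u : ℝ → ℝ}

/-- The Wronskian is constant in x and, as x → ∞, tends to that of e^{ikx} and e^{-ikx}; the error
is a multiple of the tail of the weight integral. -/
theorem psi_wronskian_real (hu : Admissible u) {k : ℂ} (hk : k.im = 0) {x : ℝ} (hx : 0 ≤ x) :
    psi u k x * psiD u (-k) x - psiD u k x * psi u (-k) x = -(2 * Complex.I * k) := by
  have hk1 : 0 ≤ k.im := hk.ge
  have hk2 : 0 ≤ (-k).im := by simp [hk]
  have hw := fun x hx => (isSol_psi hu hk1).wronskian (isSol_psi hu hk2) (neg_sq k).symm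
    (x := x) hx
  rw [hw x hx]
  set c := psi u k 0 * psiD u (-k) 0 - psiD u k 0 * psi u (-k) 0 with hc
  let K := jostBound u
  have hK : 0 < K := jostBound_pos u
  let T := totWeight u
  have hT : 0 ≤ T := totWeight_nonneg u
  have hb : ∀ x, 0 ≤ x → ‖c + 2 * Complex.I * k‖
      ≤ (2 * (K * (‖k‖ + K * T)) + 2 * K * (‖k‖ + K)) * ∫ ξ in Ioi x, potWeight u ξ := by
    intro x hx
    set t := ∫ ξ in Ioi x, potWeight u ξ
    have ht : 0 ≤ t := integral_nonneg fun _ => potWeight_nonneg u _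
    rw [← hw x hx]
    have a1 := norm_psi_sub_exp_le hu hx hk1
    have a2 := norm_psi_sub_exp_le hu hx hk2
    have a3 := norm_psiD_sub_exp_le hu hx hk1
    have a4 := norm_psiD_sub_exp_le hu hx hk2
    have a5 := norm_psiD_le hu hx hk2
    have a6 := norm_psi_le hu hx hk2
    have e1 : ‖Complex.exp (Complex.I * k * x)‖ = 1 := by rw [norm_exp_I_mul]; simp [hk]
    simp only [Complex.neg_im, hk, neg_zero, zero_mul, Real.exp_zero, mul_one, norm_neg] at *
    have hE : Complex.exp (Complex.I * k * x) * Complex.exp (Complex.I * -k * x) = 1 := by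
      rw [← Complex.exp_add]; simp
    set e := Complex.exp (Complex.I * k * x)
    set e' := Complex.exp (Complex.I * -k * x)
    -- Replacing one factor at a time by its free counterpart leaves four errors, each containing
    -- one small difference.
    have hid : psi u k x * psiD u (-k) x - psiD u k x * psi u (-k) x + 2 * Complex.I * k
        = (psi u k x - e) * psiD u (-k) x + e * (psiD u (-k) x - Complex.I * -k * e')
          - ((psiD u k x - Complex.I * k * e) * psi u (-k) x
            + Complex.I * k * e * (psi u (-k) x - e')) := by
      linear_combination -(2 * Complex.I * k) * hE
    rw [hid]
    refine (norm_sub_le _ _).trans ((add_le_add (norm_add_le _ _) (norm_add_le _ _)).trans ?_)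
    simp only [norm_mul, e1, Complex.norm_I, one_mul, mul_one]
    have b1 : ‖psi u k x - e‖ * ‖psiD u (-k) x‖ ≤ (K * t) * (‖k‖ + K * T) :=
      mul_le_mul a1 a5 (norm_nonneg _) (by positivity)
    have b3 : ‖psiD u k x - Complex.I * k * e‖ * ‖psi u (-k) x‖ ≤ (K * t) * K :=
      mul_le_mul a3 a6 (norm_nonneg _) (by positivity)
    have b4 : ‖k‖ * ‖psi u (-k) x - e'‖ ≤ ‖k‖ * (K * t) :=
      mul_le_mul_of_nonneg_left a2 (norm_nonneg _)
    have b2 : ‖psiD u (-k) x - Complex.I * -k * e'‖ ≤ K * t := a4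
    have : K ≤ K * K := by
      have h1 : (1 : ℝ) ≤ K := by
        have := Real.one_le_exp (mul_nonneg zero_le_two hT)
        simp only [K, jostBound]
        linarith
      nlinarith
    have h2 : K * t ≤ K * K * t := mul_le_mul_of_nonneg_right this ht
    have h3 : 0 ≤ ‖k‖ * (K * t) := by positivity
    have h4 : 0 ≤ K * t * (K * T) := by positivity
    nlinarith
  have hlim := (tendsto_integral_Ioi_potWeight hu).const_mul
    (2 * (K * (‖k‖ + K * T)) + 2 * K * (‖k‖ + K))
  rw [mul_zero] at hlim
  have h0 := ge_of_tendsto hlim ((eventually_ge_atTop 0).mono hb)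
  exact eq_neg_of_add_eq_zero_left (norm_le_zero_iff.1 h0)

/-- ψ(0,-k) is the conjugate of ψ(0,k), so a zero of one is a zero of both and would annihilate the
Wronskian -2ik. -/
theorem psi_zero_ne_zero_of_real (hu : Admissible u) {k : ℂ} (hk : k.im = 0) (hk0 : k ≠ 0) :
    psi u k 0 ≠ 0 := by
  intro h
  have hw := psi_wronskian_real hu hk le_rfl
  have hconj := psi_neg_conj hu hk.ge le_rfl
  rw [Complex.conj_eq_iff_im.2 hk, h, map_zero] at hconj
  rw [h, hconj] at hw
  simp at hw
  exact hk0 hw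

/-- The point X is uniform in k; beyond it ψ cannot vanish, and on the imaginary axis it is
positive. -/
theorem exists_norm_psi_sub_exp_le_half (hu : Admissible u) :
    ∃ X, 0 ≤ X ∧ ∀ x, X ≤ x → ∀ k : ℂ, 0 ≤ k.im →
      ‖psi u k x - Complex.exp (Complex.I * k * x)‖ ≤ 1 / 2 * Real.exp (-(k.im * x)) := by
  have hlim := (tendsto_integral_Ioi_potWeight hu).const_mul (jostBound u)
  rw [mul_zero] at hlim
  obtain ⟨X, hX⟩ := eventually_atTop.1 (hlim.eventually_le_const (show (0 : ℝ) < 1 / 2 by norm_num))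
  refine ⟨max X 0, le_max_right _ _, fun x hx k hk => ?_⟩
  refine (norm_psi_sub_exp_le hu ((le_max_right _ _).trans hx) hk).trans ?_
  have := hX x ((le_max_left _ _).trans hx)
  rw [mul_right_comm]
  exact mul_le_mul_of_nonneg_right this (Real.exp_pos _).le

theorem tendsto_psi_wronskian_zero (hu : Admissible u) {k l : ℂ} (hk : 0 ≤ k.im) (hl : 0 ≤ l.im)
    (h : 0 < k.im + l.im) :
    Tendsto (fun x => psi u k x * psiD u l x - psiD u k x * psi u l x) atTop (𝓝 0) := by
  let K := jostBound u
  have hK : 0 < K := jostBound_pos u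
  have hT : 0 ≤ totWeight u := totWeight_nonneg u
  have hexp : Tendsto (fun x : ℝ => (K * (‖l‖ + K * totWeight u) + (‖k‖ + K * totWeight u) * K) *
      Real.exp (-((k.im + l.im) * x))) atTop (𝓝 0) := by
    have := (Real.tendsto_exp_neg_atTop_nhds_zero.comp (tendsto_id.const_mul_atTop h)).const_mul
      (K * (‖l‖ + K * totWeight u) + (‖k‖ + K * totWeight u) * K)
    rwa [mul_zero] at this
  refine squeeze_zero_norm' ?_ hexp
  filter_upwards [eventually_ge_atTop 0] with x hx
  refine (norm_sub_le _ _).trans ?_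
  rw [norm_mul, norm_mul]
  have h1 := mul_le_mul (norm_psi_le hu hx hk) (norm_psiD_le hu hx hl) (norm_nonneg _)
    (mul_nonneg hK.le (Real.exp_pos _).le)
  have h2 := mul_le_mul (norm_psiD_le hu hx hk) (norm_psi_le hu hx hl) (norm_nonneg _)
    (by positivity)
  have he : Real.exp (-((k.im + l.im) * x)) = Real.exp (-(k.im * x)) * Real.exp (-(l.im * x)) := by
    rw [← Real.exp_add]; congr 1; ring
  rw [he]
  refine (add_le_add h1 h2).trans_eq ?_
  ring

/-- A Dirichlet eigenvalue k² must be real: if ψ(0,k) = 0, Lagrange's identity for ψ(·,k) and its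
conjugate makes (k² - k̄²) ∫₀ˣ |ψ|² tend to 0, whereas the integral is eventually at least a fixed δ
> 0. -/
theorem psi_zero_ne_zero_of_re_ne_zero (hu : Admissible u) {k : ℂ} (hk : 0 < k.im)
    (hre : k.re ≠ 0) : psi u k 0 ≠ 0 := by
  intro h
  have hl : 0 < (-(starRingEnd ℂ) k).im := by rwa [neg_conj_im]
  have hsol := isSol_psi hu hk.le
  have hint : ∀ x, 0 ≤ x → (k ^ 2 - (-(starRingEnd ℂ) k) ^ 2) *
      ((∫ ξ in (0 : ℝ)..x, Complex.normSq (psi u k ξ) : ℝ) : ℂ)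
      = psi u k x * psiD u (-(starRingEnd ℂ) k) x
        - psiD u k x * psi u (-(starRingEnd ℂ) k) x := by
    intro x hx
    have := hsol.integral_lagrange (isSol_psi hu hl.le) hx
    rw [psi_neg_conj hu hk.le le_rfl, h] at this
    simp only [map_zero, zero_mul, mul_zero, sub_zero] at this
    rw [← this, ← intervalIntegral.integral_ofReal]
    congr 1
    refine intervalIntegral.integral_congr fun ξ hξ => ?_
    rw [uIcc_of_le hx] at hξ
    simp only [psi_neg_conj hu hk.le hξ.1, Complex.mul_conj]
  have hne : k ^ 2 - (-(starRingEnd ℂ) k) ^ 2 ≠ 0 := by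
    intro h0
    have := congrArg Complex.im h0
    simp [pow_two] at this
    have : k.re * k.im = 0 := by linarith
    rcases mul_eq_zero.1 this with h1 | h1
    · exact hre h1
    · exact hk.ne' h1
  have hlim := (tendsto_psi_wronskian_zero hu hk.le hl.le (add_pos hk hl)).norm
  rw [norm_zero] at hlim
  obtain ⟨X, hX0, hX⟩ := exists_norm_psi_sub_exp_le_half hu
  have hcont : ContinuousOn (fun ξ => Complex.normSq (psi u k ξ)) (Ici 0) :=
    Complex.continuous_normSq.comp_continuousOn hsol.continuousOn
  have hii : ∀ a b, 0 ≤ a → a ≤ b →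
      IntervalIntegrable (fun ξ => Complex.normSq (psi u k ξ)) volume a b := fun a b ha hab =>
    (hcont.mono (by rw [uIcc_of_le hab]; exact fun y hy => ha.trans hy.1)).intervalIntegrable
  have hpos : 0 < ∫ ξ in X..(X + 1), Complex.normSq (psi u k ξ) := by
    refine intervalIntegral.intervalIntegral_pos_of_pos_on (hii _ _ hX0 (by linarith))
      (fun ξ hξ => ?_) (by linarith)
    refine Complex.normSq_pos.2 fun h0 => ?_
    have := hX ξ hξ.1.le k hk.le
    rw [h0, zero_sub, norm_neg, norm_exp_I_mul] at this
    linarith [Real.exp_pos (-(k.im * ξ))]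
  set δ := ∫ ξ in X..(X + 1), Complex.normSq (psi u k ξ)
  have hge : ∀ x, X + 1 ≤ x → ‖k ^ 2 - (-(starRingEnd ℂ) k) ^ 2‖ * δ
      ≤ ‖psi u k x * psiD u (-(starRingEnd ℂ) k) x
        - psiD u k x * psi u (-(starRingEnd ℂ) k) x‖ := by
    intro x hx
    rw [← hint x (by linarith), norm_mul, Complex.norm_real]
    refine mul_le_mul_of_nonneg_left ?_ (norm_nonneg _)
    refine le_trans ?_ (le_abs_self _)
    exact intervalIntegral.integral_mono_interval hX0 (by linarith) hx
      (Eventually.of_forall fun ξ => Complex.normSq_nonneg _) (hii _ _ le_rfl (by linarith))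
  have := ge_of_tendsto hlim ((eventually_ge_atTop (X + 1)).mono hge)
  have h2 : 0 < ‖k ^ 2 - (-(starRingEnd ℂ) k) ^ 2‖ * δ := mul_pos (norm_pos_iff.2 hne) hpos
  linarith

theorem psi_imag_axis (hu : Admissible u) {κ : ℝ} (hκ : 0 ≤ κ) {x : ℝ} (hx : 0 ≤ x) :
    psi u (Complex.I * κ) x = ((psi u (Complex.I * κ) x).re : ℂ) := by
  have hk : 0 ≤ (Complex.I * (κ : ℂ)).im := by simpa using hκ
  have h := psi_neg_conj hu hk hx
  have h2 : -(starRingEnd ℂ) (Complex.I * (κ : ℂ)) = Complex.I * κ := by simp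
  rw [h2] at h
  exact (Complex.conj_eq_iff_re.1 h.symm).symm

theorem psiD_imag_axis (hu : Admissible u) {κ : ℝ} (hκ : 0 ≤ κ) {x : ℝ} (hx : 0 ≤ x) :
    psiD u (Complex.I * κ) x = ((psiD u (Complex.I * κ) x).re : ℂ) := by
  have hk : 0 ≤ (Complex.I * (κ : ℂ)).im := by simpa using hκ
  have h := psiD_neg_conj hu hk hx
  have h2 : -(starRingEnd ℂ) (Complex.I * (κ : ℂ)) = Complex.I * κ := by simp
  rw [h2] at h
  exact (Complex.conj_eq_iff_re.1 h.symm).symm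

theorem jostA_eq (hu : Admissible u) {k : ℂ} (hk : 0 ≤ k.im) :
    jostA u k = (psiD u k 0 + Complex.I * k * psi u k 0) / (2 * Complex.I * k) := by
  rw [jostA, phi_zero hu, phiX0_eq hu, psiX0_eq hu hk]
  ring

set_option maxHeartbeats 1000000 in
/-- Without bound states of the full-line problem (with `u = 0` on the negative half line), the
half-line Dirichlet problem has neither bound states nor a zero-energy resonance. -/
theorem psi_zero_ne_zero_of_imag (hu : Admissible u)
    (ha : ∀ k : ℂ, k ≠ 0 → 0 ≤ k.im → jostA u k ≠ 0) {κ₁ : ℝ} (hκ₁ : 0 ≤ κ₁) :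
    psi u (Complex.I * κ₁) 0 ≠ 0 := by
  have him : ∀ κ : ℝ, 0 ≤ κ → 0 ≤ (Complex.I * (κ : ℂ)).im := fun κ h => by simpa using h
  let r : ℝ → ℝ → ℝ := fun κ x => (psi u (Complex.I * κ) x).re
  let P : ℝ → ℝ := fun κ => (psiD u (Complex.I * κ) 0).re
  have hr : ∀ κ : ℝ, 0 ≤ κ → ∀ x, 0 ≤ x → psi u (Complex.I * κ) x = (r κ x : ℂ) :=
    fun κ h x hx => psi_imag_axis hu h hx
  have hP : ∀ κ : ℝ, 0 ≤ κ → psiD u (Complex.I * κ) 0 = (P κ : ℂ) :=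
    fun κ h => psiD_imag_axis hu h le_rfl
  have hmap : MapsTo (fun κ : ℝ => Complex.I * (κ : ℂ)) (Ici 0) upperClosed :=
    fun κ hκ => him κ hκ
  have hrc : ∀ x, 0 ≤ x → ContinuousOn (fun κ => r κ x) (Ici 0) := fun x hx =>
    Complex.continuous_re.comp_continuousOn
      (((jointHol_psi hu).holCont hx).cont.comp (by fun_prop) hmap)
  have hPc : ContinuousOn P (Ici 0) := by
    have h : ContinuousOn (fun k => psiD u k 0) upperClosed :=
      (holCont_psiX0 hu).cont.congr fun k hk => (psiX0_eq hu hk).symm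
    exact Complex.continuous_re.comp_continuousOn (h.comp (by fun_prop) hmap)
  have hAc : ContinuousOn (fun κ => P κ - κ * r κ 0) (Ici 0) :=
    hPc.sub (continuousOn_id.mul (hrc 0 le_rfl))
  -- Up to the factor -2κ this quantity is a(iκ), which is real.
  have hA0 : ∀ κ, 0 < κ → P κ - κ * r κ 0 ≠ 0 := by
    intro κ hκ h0
    refine ha (Complex.I * κ) (by simp [hκ.ne']) (him κ hκ.le) ?_
    rw [jostA_eq hu (him κ hκ.le), hP κ hκ.le, hr κ hκ.le 0 le_rfl]
    have : Complex.I * (Complex.I * κ) = -(κ : ℂ) := by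
      rw [← mul_assoc, Complex.I_mul_I]; ring
    rw [this]
    have h1 : ((P κ : ℂ) + -(κ : ℂ) * (r κ 0 : ℂ)) = ((P κ - κ * r κ 0 : ℝ) : ℂ) := by
      push_cast; ring
    rw [h1, h0]
    simp
  let B := jostBound u * totWeight u
  have hB : 0 ≤ B := mul_nonneg (jostBound_pos u).le (totWeight_nonneg u)
  -- For large κ, r(κ,0) is within B/κ < 1 of 1 and P(κ) within B of -κ; hence P - κ r ≤ 2B - 2κ <
  -- 0.
  have hbig : ∀ κ, B < κ → 0 < r κ 0 ∧ P κ - κ * r κ 0 < 0 := by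
    intro κ hκ
    have hκ0 : 0 < κ := hB.trans_lt hκ
    have h1 := norm_psi_sub_exp_le_div hu le_rfl (him κ hκ0.le) (by simp [hκ0.ne'])
    have h2 := norm_psiD_sub_exp_le hu le_rfl (him κ hκ0.le)
    rw [hr κ hκ0.le 0 le_rfl] at h1
    rw [hP κ hκ0.le] at h2
    have e1 : (r κ 0 : ℂ) - Complex.exp (Complex.I * (Complex.I * κ) * (0 : ℝ))
        = ((r κ 0 - 1 : ℝ) : ℂ) := by simp
    have e2 : (P κ : ℂ) - Complex.I * (Complex.I * κ) *
        Complex.exp (Complex.I * (Complex.I * κ) * (0 : ℝ)) = ((P κ + κ : ℝ) : ℂ) := by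
      rw [← mul_assoc, Complex.I_mul_I]; simp
    have e3 : ‖Complex.I * (κ : ℂ)‖ = κ := by simp [abs_of_pos hκ0]
    rw [e1, Complex.norm_real, e3] at h1
    rw [e2, Complex.norm_real] at h2
    simp only [mul_zero, neg_zero, Real.exp_zero, mul_one] at h1 h2
    have h1' : |r κ 0 - 1| ≤ 1 / κ * B := h1.trans_eq (by simp only [B, totWeight]; ring)
    have h2' : |P κ + κ| ≤ B := h2
    have h3 : 1 / κ * B < 1 := by rw [one_div, inv_mul_lt_iff₀ hκ0]; linarith
    have h4 : κ * (1 / κ * B) = B := by field_simp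
    rw [abs_le] at h1' h2'
    refine ⟨by linarith, ?_⟩
    nlinarith
  have hAneg : ∀ κ, 0 < κ → P κ - κ * r κ 0 < 0 := by
    intro κ hκ
    by_contra hcon
    rw [not_lt] at hcon
    let κ' := max κ (B + 1)
    have hle : κ ≤ κ' := le_max_left _ _
    have hneg := (hbig κ' (by linarith [le_max_right κ (B + 1)])).2
    obtain ⟨c, hc, hc0⟩ := intermediate_value_Icc' hle
      (hAc.mono fun y hy => hκ.le.trans hy.1) ⟨hneg.le, hcon⟩
    exact hA0 c (hκ.trans_le hc.1) hc0
  -- At κ = 0 nothing is assumed on a, so only the weak inequality survives, by continuity.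
  have hAle : ∀ κ, 0 ≤ κ → P κ - κ * r κ 0 ≤ 0 := by
    intro κ hκ
    rcases hκ.eq_or_lt with h0 | h0
    · rw [← h0]
      have h := (hAc 0 self_mem_Ici).mono Ioi_subset_Ici_self
      exact le_of_tendsto h (eventually_nhdsWithin_of_forall fun κ hκ => (hAneg κ hκ).le)
    · exact (hAneg κ h0).le
  intro hzero
  have hZc : IsCompact {κ | κ ∈ Icc 0 B ∧ r κ 0 = 0} := by
    refine isCompact_Icc.of_isClosed_subset ?_ fun κ hκ => hκ.1
    have : {κ | κ ∈ Icc 0 B ∧ r κ 0 = 0} = Icc 0 B ∩ (fun κ => r κ 0) ⁻¹' {0} := rfl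
    rw [this]
    exact ((hrc 0 le_rfl).mono Icc_subset_Ici_self).preimage_isClosed_of_isClosed isClosed_Icc
      isClosed_singleton
  have hleB : ∀ κ, r κ 0 = 0 → κ ≤ B := fun κ h0 => not_lt.1 fun h => (hbig κ h).1.ne' h0
  have hz1 : r κ₁ 0 = 0 := by simp only [r, hzero, Complex.zero_re]
  -- κ₀ is the largest zero of κ ↦ ψ(0,iκ); beyond it the function is positive, since it is positive
  -- for large κ.
  obtain ⟨κ₀, ⟨hκ₀, hr0⟩, hmax⟩ := hZc.exists_isGreatest ⟨κ₁, ⟨hκ₁, hleB κ₁ hz1⟩, hz1⟩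
  have hκ₀0 : 0 ≤ κ₀ := hκ₀.1
  have hDpos : ∀ κ, κ₀ < κ → 0 < r κ 0 := by
    intro κ hκ
    by_contra hcon
    rw [not_lt] at hcon
    let κ' := max κ (B + 1)
    have hle : κ ≤ κ' := le_max_left _ _
    have hp := (hbig κ' (by linarith [le_max_right κ (B + 1)])).1
    obtain ⟨c, hc, hc0⟩ := intermediate_value_Icc hle
      ((hrc 0 le_rfl).mono fun y hy => (hκ₀0.trans hκ.le).trans hy.1) ⟨hcon, hp.le⟩
    have hc0' : r c 0 = 0 := hc0
    have := hmax ⟨⟨(hκ₀0.trans hκ.le).trans hc.1, hleB c hc0'⟩, hc0'⟩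
    linarith [hc.1]
  have hP0 : P κ₀ ≤ 0 := by
    have := hAle κ₀ hκ₀0
    rwa [hr0, mul_zero, sub_zero] at this
  obtain ⟨X, hX0, hX⟩ := exists_norm_psi_sub_exp_le_half hu
  have htail : ∀ κ, 0 ≤ κ → ∀ x, X ≤ x → 1 / 2 * Real.exp (-(κ * x)) ≤ r κ x := by
    intro κ hκ x hx
    have h := hX x hx (Complex.I * κ) (him κ hκ)
    rw [hr κ hκ x (hX0.trans hx)] at h
    have e1 : (r κ x : ℂ) - Complex.exp (Complex.I * (Complex.I * κ) * x)
        = ((r κ x - Real.exp (-(κ * x)) : ℝ) : ℂ) := by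
      rw [← mul_assoc, Complex.I_mul_I]; push_cast; congr 2; ring
    rw [e1, Complex.norm_real, Real.norm_eq_abs, abs_le] at h
    have e2 : (Complex.I * (κ : ℂ)).im = κ := by simp
    rw [e2] at h
    linarith
  have hcont : ∀ κ, 0 ≤ κ → ContinuousOn (r κ) (Ici 0) := fun κ hκ =>
    Complex.continuous_re.comp_continuousOn (isSol_psi hu (him κ hκ)).continuousOn
  have hcont2 : ∀ κ, 0 ≤ κ → ContinuousOn (fun x => r κ x * r κ₀ x) (Ici 0) := fun κ hκ =>
    (hcont κ hκ).mul (hcont κ₀ hκ₀0)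
  have hii : ∀ κ, 0 ≤ κ → ∀ a b, 0 ≤ a → a ≤ b →
      IntervalIntegrable (fun x => r κ x * r κ₀ x) volume a b := fun κ hκ a b ha hab =>
    ((hcont2 κ hκ).mono (by
      rw [uIcc_of_le hab]; exact fun y hy => ha.trans hy.1)).intervalIntegrable
  -- Lagrange's identity gives (κ² - κ₀²) ∫₀ˣ r_κ r_κ₀ → r(κ,0) P(κ₀) ≤ 0 as x → ∞. The integrand is
  -- positive beyond X, so only the slice [X, X+1] of the tail is kept, bounded below by ½·½ times
  -- an exponential. No integrability of r_κ₀² is used, so κ₀ = 0 is allowed.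
  have hkey : ∀ κ, κ₀ < κ → (∫ x in (0 : ℝ)..X, r κ x * r κ₀ x)
      + 1 / 4 * Real.exp (-((κ + κ₀) * (X + 1))) ≤ 0 := by
    intro κ hκ
    have hκ0 : 0 ≤ κ := hκ₀0.trans hκ.le
    have hsq : 0 < κ ^ 2 - κ₀ ^ 2 := by nlinarith
    have hlag : ∀ x, 0 ≤ x → psi u (Complex.I * κ) x * psiD u (Complex.I * κ₀) x
        - psiD u (Complex.I * κ) x * psi u (Complex.I * κ₀) x
        = ((r κ 0 * P κ₀ - (κ ^ 2 - κ₀ ^ 2) * ∫ ξ in (0 : ℝ)..x, r κ ξ * r κ₀ ξ : ℝ) : ℂ) := by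
      intro x hx
      have h := (isSol_psi hu (him κ hκ0)).integral_lagrange (isSol_psi hu (him κ₀ hκ₀0)) hx
      have h1 : ∫ ξ in (0 : ℝ)..x, psi u (Complex.I * κ) ξ * psi u (Complex.I * κ₀) ξ
          = ((∫ ξ in (0 : ℝ)..x, r κ ξ * r κ₀ ξ : ℝ) : ℂ) := by
        rw [← intervalIntegral.integral_ofReal]
        refine intervalIntegral.integral_congr fun ξ hξ => ?_
        rw [uIcc_of_le hx] at hξ
        simp only [hr κ hκ0 ξ hξ.1, hr κ₀ hκ₀0 ξ hξ.1, Complex.ofReal_mul]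
      rw [h1, hr κ hκ0 0 le_rfl, hr κ₀ hκ₀0 0 le_rfl, hP κ₀ hκ₀0, hr0] at h
      generalize (∫ ξ in (0 : ℝ)..x, r κ ξ * r κ₀ ξ) = J at h ⊢
      push_cast at h ⊢
      linear_combination -h + (κ ^ 2 - κ₀ ^ 2) * (J : ℂ) * Complex.I_sq
    have hlim := tendsto_psi_wronskian_zero hu (him κ hκ0) (him κ₀ hκ₀0) (by
      simpa using add_pos_of_pos_of_nonneg (hκ₀0.trans_lt hκ) hκ₀0)
    have hlim2 : Tendsto (fun x => r κ 0 * P κ₀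
        - (κ ^ 2 - κ₀ ^ 2) * ∫ ξ in (0 : ℝ)..x, r κ ξ * r κ₀ ξ) atTop (𝓝 0) := by
      have h1 := hlim.congr' ((eventually_ge_atTop 0).mono hlag)
      have h2 := (Complex.continuous_re.tendsto _).comp h1
      simpa only [Function.comp_def, Complex.ofReal_re, Complex.zero_re] using h2
    have hge : ∀ x, X + 1 ≤ x → r κ 0 * P κ₀
        - (κ ^ 2 - κ₀ ^ 2) * ∫ ξ in (0 : ℝ)..x, r κ ξ * r κ₀ ξ
        ≤ -((κ ^ 2 - κ₀ ^ 2) * ((∫ x in (0 : ℝ)..X, r κ x * r κ₀ x)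
          + 1 / 4 * Real.exp (-((κ + κ₀) * (X + 1))))) := by
      intro x hx
      have hnn : ∀ ξ, X ≤ ξ → 1 / 4 * Real.exp (-((κ + κ₀) * ξ)) ≤ r κ ξ * r κ₀ ξ := by
        intro ξ hξ
        have := mul_le_mul (htail κ hκ0 ξ hξ) (htail κ₀ hκ₀0 ξ hξ) (by positivity)
          (le_trans (by positivity) (htail κ hκ0 ξ hξ))
        refine le_trans (le_of_eq ?_) this
        have he : Real.exp (-((κ + κ₀) * ξ)) = Real.exp (-(κ * ξ)) * Real.exp (-(κ₀ * ξ)) := by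
          rw [← Real.exp_add]; congr 1; ring
        rw [he]; ring
      have h1 : 1 / 4 * Real.exp (-((κ + κ₀) * (X + 1)))
          ≤ ∫ ξ in X..(X + 1), r κ ξ * r κ₀ ξ := by
        have := intervalIntegral.integral_mono_on (by linarith : X ≤ X + 1)
          (intervalIntegrable_const (c := 1 / 4 * Real.exp (-((κ + κ₀) * (X + 1)))))
          (hii κ hκ0 X (X + 1) hX0 (by linarith)) (fun ξ hξ => ?_)
        · simpa using this
        · refine le_trans ?_ (hnn ξ hξ.1)
          refine mul_le_mul_of_nonneg_left (Real.exp_le_exp.2 ?_) (by norm_num)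
          have := mul_le_mul_of_nonneg_left hξ.2 (add_nonneg hκ0 hκ₀0)
          linarith
      have h2 : 0 ≤ ∫ ξ in (X + 1)..x, r κ ξ * r κ₀ ξ :=
        intervalIntegral.integral_nonneg hx fun ξ hξ =>
          le_trans (by positivity) (hnn ξ (by linarith [hξ.1]))
      have h3 : (∫ ξ in (0 : ℝ)..x, r κ ξ * r κ₀ ξ) = (∫ ξ in (0 : ℝ)..X, r κ ξ * r κ₀ ξ)
          + (∫ ξ in X..(X + 1), r κ ξ * r κ₀ ξ) + ∫ ξ in (X + 1)..x, r κ ξ * r κ₀ ξ := by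
        rw [intervalIntegral.integral_add_adjacent_intervals (hii κ hκ0 _ _ le_rfl hX0)
          (hii κ hκ0 _ _ hX0 (by linarith)), intervalIntegral.integral_add_adjacent_intervals
          (hii κ hκ0 _ _ le_rfl (by linarith)) (hii κ hκ0 _ _ (by linarith) hx)]
      have h4 : r κ 0 * P κ₀ ≤ 0 := mul_nonpos_of_nonneg_of_nonpos (hDpos κ hκ).le hP0
      rw [h3]
      nlinarith
    have h0 := le_of_tendsto hlim2 ((eventually_ge_atTop (X + 1)).mono hge)
    by_contra hcon
    rw [not_le] at hcon
    have := mul_pos hsq hcon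
    linarith
  -- Letting κ decrease to κ₀ turns the product into a square, which contradicts `hkey`.
  have hlim : Tendsto (fun κ => (∫ x in (0 : ℝ)..X, r κ x * r κ₀ x)
      + 1 / 4 * Real.exp (-((κ + κ₀) * (X + 1)))) (𝓝[>] κ₀)
      (𝓝 ((∫ x in (0 : ℝ)..X, r κ₀ x * r κ₀ x)
        + 1 / 4 * Real.exp (-((κ₀ + κ₀) * (X + 1))))) := by
    refine Tendsto.add ?_ ?_
    · refine intervalIntegral.tendsto_integral_filter_of_dominated_convergence
        (fun _ => jostBound u * jostBound u) ?_ ?_ intervalIntegrable_const ?_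
      · filter_upwards [self_mem_nhdsWithin] with κ hκ
        have := (hii κ (hκ₀0.trans (le_of_lt hκ)) 0 X le_rfl hX0).aestronglyMeasurable
        rwa [uIoc_of_le hX0]
      · filter_upwards [self_mem_nhdsWithin] with κ hκ
        refine Eventually.of_forall fun x hx => ?_
        rw [uIoc_of_le hX0] at hx
        have hb : ∀ κ, 0 ≤ κ → |r κ x| ≤ jostBound u := fun κ hκ => by
          refine (Complex.abs_re_le_norm _).trans ((norm_psi_le hu hx.1.le (him κ hκ)).trans ?_)
          refine mul_le_of_le_one_right (jostBound_pos u).le (Real.exp_le_one_iff.2 ?_)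
          exact neg_nonpos.2 (mul_nonneg (him κ hκ) hx.1.le)
        rw [norm_mul]
        exact mul_le_mul (hb κ (hκ₀0.trans (le_of_lt hκ))) (hb κ₀ hκ₀0) (norm_nonneg _)
          (jostBound_pos u).le
      · refine Eventually.of_forall fun x hx => ?_
        rw [uIoc_of_le hX0] at hx
        refine Tendsto.mul_const _ ?_
        exact ((hrc x hx.1.le) κ₀ hκ₀0).mono_left
          (nhdsWithin_mono _ fun κ (hκ : κ₀ < κ) => hκ₀0.trans hκ.le)
    · have : Continuous fun κ : ℝ => 1 / 4 * Real.exp (-((κ + κ₀) * (X + 1))) := by fun_prop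
      exact (this.tendsto κ₀).mono_left nhdsWithin_le_nhds
  have hfin := le_of_tendsto hlim (eventually_nhdsWithin_of_forall hkey)
  have h1 : 0 ≤ ∫ x in (0 : ℝ)..X, r κ₀ x * r κ₀ x :=
    intervalIntegral.integral_nonneg hX0 fun x _ => mul_self_nonneg _
  have h2 : 0 < 1 / 4 * Real.exp (-((κ₀ + κ₀) * (X + 1))) := by positivity
  linarith

theorem psi_zero_ne_zero (hu : Admissible u)
    (ha : ∀ k : ℂ, k ≠ 0 → 0 ≤ k.im → jostA u k ≠ 0) {k : ℂ} (hk : 0 ≤ k.im) :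
    psi u k 0 ≠ 0 := by
  by_cases hre : k.re = 0
  · have : k = Complex.I * (k.im : ℝ) := by
      apply Complex.ext <;> simp [hre]
    rw [this]
    exact psi_zero_ne_zero_of_imag hu ha hk
  · rcases hk.eq_or_lt with h0 | h0
    · exact psi_zero_ne_zero_of_real hu h0.symm fun h => hre (by simp [h])
    · exact psi_zero_ne_zero_of_re_ne_zero hu h0 hre

/-- `1 / ψ(0, k)` is bounded in the closed upper half plane. -/
theorem exists_norm_inv_psi_zero_le (hu : Admissible u)
    (ha : ∀ k : ℂ, k ≠ 0 → 0 ≤ k.im → jostA u k ≠ 0) :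
    ∃ C, 0 < C ∧ ∀ k : ℂ, 0 ≤ k.im → ‖(psi u k 0)⁻¹‖ ≤ C := by
  -- Outside the disc of radius R, |ψ(0,k) - 1| ≤ 1/2 and the inverse is at most 2; inside it
  -- compactness gives a bound.
  let R := 2 * (jostBound u * totWeight u) + 1
  have hBn : 0 ≤ jostBound u * totWeight u :=
    mul_nonneg (jostBound_pos u).le (totWeight_nonneg u)
  have hR : 0 < R := by positivity
  have hcomp : IsCompact (upperClosed ∩ Metric.closedBall (0 : ℂ) R) :=
    (isCompact_closedBall _ _).inter_left (isClosed_le continuous_const Complex.continuous_im)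
  have hc : ContinuousOn (fun k => (psi u k 0)⁻¹) (upperClosed ∩ Metric.closedBall (0 : ℂ) R) :=
    (((jointHol_psi hu).holCont le_rfl).cont.mono inter_subset_left).inv₀
      fun k hk => psi_zero_ne_zero hu ha hk.1
  obtain ⟨C, hC⟩ := hcomp.exists_bound_of_continuousOn hc
  refine ⟨max C 2, lt_max_of_lt_right zero_lt_two, fun k hk => ?_⟩
  by_cases hkR : ‖k‖ ≤ R
  · exact (hC k ⟨hk, by simpa using hkR⟩).trans (le_max_left _ _)
  · rw [not_le] at hkR
    refine le_trans ?_ (le_max_right _ _)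
    have hk0 : 0 < ‖k‖ := hR.trans hkR
    have h1 := norm_psi_sub_exp_le_div hu le_rfl hk (norm_pos_iff.1 hk0)
    simp only [Complex.ofReal_zero, mul_zero, Complex.exp_zero, neg_zero, Real.exp_zero,
      mul_one] at h1
    have h2 : 1 / ‖k‖ * jostBound u * (∫ ξ in Ioi (0 : ℝ), potWeight u ξ) ≤ 1 / 2 := by
      rw [mul_assoc, one_div, inv_mul_le_iff₀ hk0]
      have : jostBound u * (∫ ξ in Ioi (0 : ℝ), potWeight u ξ)
        = jostBound u * totWeight u := rfl
      rw [this]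
      simp only [R] at hkR
      linarith
    have h3 : (1 : ℝ) - 1 / 2 ≤ ‖psi u k 0‖ := by
      have h4 := norm_sub_norm_le (1 : ℂ) (psi u k 0)
      rw [norm_one, norm_sub_rev] at h4
      linarith
    rw [norm_inv]
    refine inv_le_of_inv_le₀ zero_lt_two ?_
    linarith

end QuarterPlane

/-! ### Derivatives of q up to the boundary and Green's identity. -/

namespace QuarterPlane

open Filter Topology

section Smooth

variable {q : ℝ → ℝ → ℝ}

/-- The closed quarter plane. -/
abbrev quarter : Set (ℝ × ℝ) := Ici 0 ×ˢ Ici 0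

theorem uniqueDiffOn_quarter : UniqueDiffOn ℝ quarter :=
  (uniqueDiffOn_Ici 0).prod (uniqueDiffOn_Ici 0)

theorem hasDerivWithinAt_fst (hq : ContDiffOn ℝ 2 (fun z : ℝ × ℝ => q z.1 z.2) quarter) {x y : ℝ}
    (hx : 0 ≤ x) (hy : 0 ≤ y) : HasDerivWithinAt (fun s => q s y)
      (fderivWithin ℝ (fun z : ℝ × ℝ => q z.1 z.2) quarter (x, y) (1, 0)) (Ici 0) x := by
  have h := (hq.differentiableOn (by norm_num) (x, y) (mk_mem_prod hx hy)).hasFDerivWithinAt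
  have hc : HasDerivWithinAt (fun s : ℝ => (s, y)) ((1 : ℝ), (0 : ℝ)) (Ici 0) x :=
    ((hasDerivAt_id x).prodMk (hasDerivAt_const x y)).hasDerivWithinAt
  exact h.comp_hasDerivWithinAt x hc fun s hs => mk_mem_prod hs hy

theorem hasDerivWithinAt_snd (hq : ContDiffOn ℝ 2 (fun z : ℝ × ℝ => q z.1 z.2) quarter) {x y : ℝ}
    (hx : 0 ≤ x) (hy : 0 ≤ y) : HasDerivWithinAt (fun t => q x t)
      (fderivWithin ℝ (fun z : ℝ × ℝ => q z.1 z.2) quarter (x, y) (0, 1)) (Ici 0) y := by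
  have h := (hq.differentiableOn (by norm_num) (x, y) (mk_mem_prod hx hy)).hasFDerivWithinAt
  have hc : HasDerivWithinAt (fun t : ℝ => (x, t)) ((0 : ℝ), (1 : ℝ)) (Ici 0) y :=
    ((hasDerivAt_const y x).prodMk (hasDerivAt_id y)).hasDerivWithinAt
  exact h.comp_hasDerivWithinAt y hc fun s hs => mk_mem_prod hx hs

theorem partialX_eq (hq : ContDiffOn ℝ 2 (fun z : ℝ × ℝ => q z.1 z.2) quarter) {x y : ℝ}
    (hx : 0 ≤ x) (hy : 0 ≤ y) : partialX q x y
      = fderivWithin ℝ (fun z : ℝ × ℝ => q z.1 z.2) quarter (x, y) (1, 0) :=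
  (hasDerivWithinAt_fst hq hx hy).derivWithin (uniqueDiffOn_Ici 0 x hx)

theorem partialY_eq (hq : ContDiffOn ℝ 2 (fun z : ℝ × ℝ => q z.1 z.2) quarter) {x y : ℝ}
    (hx : 0 ≤ x) (hy : 0 ≤ y) : partialY q x y
      = fderivWithin ℝ (fun z : ℝ × ℝ => q z.1 z.2) quarter (x, y) (0, 1) :=
  (hasDerivWithinAt_snd hq hx hy).derivWithin (uniqueDiffOn_Ici 0 y hy)

theorem contDiffOn_partialX (hq : ContDiffOn ℝ 2 (fun z : ℝ × ℝ => q z.1 z.2) quarter) :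
    ContDiffOn ℝ 1 (fun z : ℝ × ℝ => partialX q z.1 z.2) quarter :=
  ((hq.fderivWithin uniqueDiffOn_quarter (by norm_num)).clm_apply contDiffOn_const).congr
    fun z hz => partialX_eq hq hz.1 hz.2

theorem contDiffOn_partialY (hq : ContDiffOn ℝ 2 (fun z : ℝ × ℝ => q z.1 z.2) quarter) :
    ContDiffOn ℝ 1 (fun z : ℝ × ℝ => partialY q z.1 z.2) quarter :=
  ((hq.fderivWithin uniqueDiffOn_quarter (by norm_num)).clm_apply contDiffOn_const).congr
    fun z hz => partialY_eq hq hz.1 hz.2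

theorem quarter_mem_nhds {x y : ℝ} (hx : 0 < x) (hy : 0 < y) : quarter ∈ 𝓝 (x, y) :=
  prod_mem_nhds (Ici_mem_nhds hx) (Ici_mem_nhds hy)

theorem hasDerivAt_fst (hq : ContDiffOn ℝ 2 (fun z : ℝ × ℝ => q z.1 z.2) quarter) {x y : ℝ}
    (hx : 0 < x) (hy : 0 ≤ y) : HasDerivAt (fun s => q s y) (partialX q x y) x := by
  rw [partialX_eq hq hx.le hy]
  exact (hasDerivWithinAt_fst hq hx.le hy).hasDerivAt (Ici_mem_nhds hx)

theorem hasDerivAt_snd (hq : ContDiffOn ℝ 2 (fun z : ℝ × ℝ => q z.1 z.2) quarter) {x y : ℝ}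
    (hx : 0 ≤ x) (hy : 0 < y) : HasDerivAt (fun t => q x t) (partialY q x y) y := by
  rw [partialY_eq hq hx hy.le]
  exact (hasDerivWithinAt_snd hq hx hy.le).hasDerivAt (Ici_mem_nhds hy)

theorem hasDerivAt_partialX (hq : ContDiffOn ℝ 2 (fun z : ℝ × ℝ => q z.1 z.2) quarter) {x y : ℝ}
    (hx : 0 < x) (hy : 0 < y) :
    HasDerivAt (fun s => partialX q s y) (iteratedDeriv 2 (fun s => q s y) x) x := by
  have hd : DifferentiableAt ℝ (fun z : ℝ × ℝ => partialX q z.1 z.2) (x, y) :=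
    ((contDiffOn_partialX hq).differentiableOn one_ne_zero).differentiableAt
      (quarter_mem_nhds hx hy)
  have hc : HasDerivAt (fun s : ℝ => (s, y)) ((1 : ℝ), (0 : ℝ)) x :=
    (hasDerivAt_id x).prodMk (hasDerivAt_const x y)
  have h := hd.hasFDerivAt.comp_hasDerivAt x hc
  have he : iteratedDeriv 2 (fun s => q s y) x = deriv (fun s => partialX q s y) x := by
    rw [iteratedDeriv_succ, iteratedDeriv_one]
    refine EventuallyEq.deriv_eq ?_
    filter_upwards [Ioi_mem_nhds hx] with s hs using (hasDerivAt_fst hq hs hy.le).deriv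
  rw [he]
  exact h.differentiableAt.hasDerivAt

theorem hasDerivAt_partialY (hq : ContDiffOn ℝ 2 (fun z : ℝ × ℝ => q z.1 z.2) quarter) {x y : ℝ}
    (hx : 0 < x) (hy : 0 < y) :
    HasDerivAt (fun t => partialY q x t) (iteratedDeriv 2 (fun t => q x t) y) y := by
  have hd : DifferentiableAt ℝ (fun z : ℝ × ℝ => partialY q z.1 z.2) (x, y) :=
    ((contDiffOn_partialY hq).differentiableOn one_ne_zero).differentiableAt
      (quarter_mem_nhds hx hy)
  have hc : HasDerivAt (fun t : ℝ => (x, t)) ((0 : ℝ), (1 : ℝ)) y :=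
    (hasDerivAt_const y x).prodMk (hasDerivAt_id y)
  have h := hd.hasFDerivAt.comp_hasDerivAt y hc
  have he : iteratedDeriv 2 (fun t => q x t) y = deriv (fun t => partialY q x t) y := by
    rw [iteratedDeriv_succ, iteratedDeriv_one]
    refine EventuallyEq.deriv_eq ?_
    filter_upwards [Ioi_mem_nhds hy] with t ht using (hasDerivAt_snd hq hx.le ht).deriv
  rw [he]
  exact h.differentiableAt.hasDerivAt

end Smooth

/-- A classical solution on the quarter plane with quantitative decay. -/
structure IsDecayingSol (u : ℝ → ℝ) (q : ℝ → ℝ → ℝ) (C p : ℝ) : Prop where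
  smooth : ContDiffOn ℝ 2 (fun z : ℝ × ℝ => q z.1 z.2) quarter
  pde : SolvesPDE u q
  const_nonneg : 0 ≤ C
  two_lt : 2 < p
  bound : ∀ x y, 0 ≤ x → 0 ≤ y → |q x y| ≤ C * (1 + x + y) ^ (-p)
  boundX : ∀ x y, 0 ≤ x → 0 ≤ y → |partialX q x y| ≤ C * (1 + x + y) ^ (-p)
  boundY : ∀ x y, 0 ≤ x → 0 ≤ y → |partialY q x y| ≤ C * (1 + x + y) ^ (-p)

/-- Solutions of `v'' = k² v`. -/
structure IsExpSol (k : ℂ) (v v' : ℝ → ℂ) : Prop where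
  deriv_fst : ∀ y, HasDerivAt v (v' y) y
  deriv_snd : ∀ y, HasDerivAt v' (k ^ 2 * v y) y

theorem IsExpSol.continuous {k : ℂ} {v v' : ℝ → ℂ} (hv : IsExpSol k v v') : Continuous v :=
  continuous_iff_continuousAt.2 fun y => (hv.deriv_fst y).continuousAt

theorem IsExpSol.continuous_deriv {k : ℂ} {v v' : ℝ → ℂ} (hv : IsExpSol k v v') :
    Continuous v' :=
  continuous_iff_continuousAt.2 fun y => (hv.deriv_snd y).continuousAt

theorem integrableOn_one_add_rpow {s : ℝ} (hs : s < -1) :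
    IntegrableOn (fun x : ℝ => (1 + x) ^ s) (Ioi 0) := by
  simpa only [add_comm] using integrableOn_add_rpow_Ioi_of_lt (m := 1) hs (by norm_num)

/-- The decay is shared equally between x and y; because p > 2, each factor with exponent -p/2 is
integrable. -/
theorem rpow_split {x y p : ℝ} (hx : 0 ≤ x) (hy : 0 ≤ y) (hp : 0 ≤ p) :
    (1 + x + y) ^ (-p) ≤ (1 + x) ^ (-(p / 2)) * (1 + y) ^ (-(p / 2)) := by
  have h : (1 + x + y) ^ (-p) = (1 + x + y) ^ (-(p / 2)) * (1 + x + y) ^ (-(p / 2)) := by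
    rw [← Real.rpow_add (by linarith)]; congr 1; ring
  rw [h]
  refine mul_le_mul (Real.rpow_le_rpow_of_nonpos (by linarith) (by linarith) (by linarith))
    (Real.rpow_le_rpow_of_nonpos (by linarith) (by linarith) (by linarith)) ?_ ?_ <;> positivity

namespace IsDecayingSol

variable {u : ℝ → ℝ} {q : ℝ → ℝ → ℝ} {C p : ℝ}

theorem continuousOn (h : IsDecayingSol u q C p) :
    ContinuousOn (fun z : ℝ × ℝ => q z.1 z.2) quarter := h.smooth.continuousOn

theorem continuousOnX (h : IsDecayingSol u q C p) :
    ContinuousOn (fun z : ℝ × ℝ => partialX q z.1 z.2) quarter :=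
  (contDiffOn_partialX h.smooth).continuousOn

theorem continuousOnY (h : IsDecayingSol u q C p) :
    ContinuousOn (fun z : ℝ × ℝ => partialY q z.1 z.2) quarter :=
  (contDiffOn_partialY h.smooth).continuousOn

/-- The field with components f and g is divergence free: the equations for w, v and q cancel
against each other, k² entering with opposite signs. The divergence theorem then leaves the four
edges. -/
theorem green_rectangle (h : IsDecayingSol u q C p) {k : ℂ} {w w' v v' : ℝ → ℂ}
    (hw : IsSol u k w w') (hv : IsExpSol k v v') {a b R : ℝ} (ha : 0 ≤ a) (hab : a ≤ b)
    (hR : 0 ≤ R) :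
    (∫ x in a..b, w x * (partialY q x R * v R - q x R * v' R))
      - (∫ x in a..b, w x * (partialY q x 0 * v 0 - q x 0 * v' 0))
      + (∫ y in (0 : ℝ)..R, v y * (partialX q b y * w b - q b y * w' b))
      - (∫ y in (0 : ℝ)..R, v y * (partialX q a y * w a - q a y * w' a)) = 0 := by
  classical
  let f : ℝ × ℝ → ℂ := fun z => v z.2 * (partialX q z.1 z.2 * w z.1 - q z.1 z.2 * w' z.1)
  let g : ℝ × ℝ → ℂ := fun z => w z.1 * (partialY q z.1 z.2 * v z.2 - q z.1 z.2 * v' z.2)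
  let I : Set (ℝ × ℝ) := Ioi 0 ×ˢ Ioi 0
  have hIq : ∀ z ∈ I, quarter ∈ 𝓝 z := fun z hz => quarter_mem_nhds hz.1 hz.2
  have hcast : Differentiable ℝ (fun r : ℝ => (r : ℂ)) := Complex.ofRealCLM.differentiable
  have dq : ∀ z ∈ I, DifferentiableAt ℝ (fun z : ℝ × ℝ => (q z.1 z.2 : ℂ)) z := fun z hz =>
    (hcast _).comp z ((h.smooth.differentiableOn (by norm_num)).differentiableAt (hIq z hz))
  have dX : ∀ z ∈ I, DifferentiableAt ℝ (fun z : ℝ × ℝ => (partialX q z.1 z.2 : ℂ)) z :=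
    fun z hz => (hcast _).comp z
      (((contDiffOn_partialX h.smooth).differentiableOn one_ne_zero).differentiableAt (hIq z hz))
  have dY : ∀ z ∈ I, DifferentiableAt ℝ (fun z : ℝ × ℝ => (partialY q z.1 z.2 : ℂ)) z :=
    fun z hz => (hcast _).comp z
      (((contDiffOn_partialY h.smooth).differentiableOn one_ne_zero).differentiableAt (hIq z hz))
  have aw : ∀ x, 0 < x → HasDerivAt w (w' x) x := fun x hx =>
    (hw.deriv_fst x hx.le).hasDerivAt (Ici_mem_nhds hx)
  have aw' : ∀ x, 0 < x → HasDerivAt w' (-((u x + k ^ 2) * w x)) x := fun x hx =>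
    (hw.deriv_snd x hx.le).hasDerivAt (Ici_mem_nhds hx)
  have dw : ∀ z ∈ I, DifferentiableAt ℝ (fun z : ℝ × ℝ => w z.1) z := fun z hz =>
    (aw z.1 hz.1).differentiableAt.comp z differentiableAt_fst
  have dw' : ∀ z ∈ I, DifferentiableAt ℝ (fun z : ℝ × ℝ => w' z.1) z := fun z hz =>
    (aw' z.1 hz.1).differentiableAt.comp z differentiableAt_fst
  have dv : ∀ z : ℝ × ℝ, DifferentiableAt ℝ (fun z : ℝ × ℝ => v z.2) z := fun z =>
    (hv.deriv_fst z.2).differentiableAt.comp z differentiableAt_snd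
  have dv' : ∀ z : ℝ × ℝ, DifferentiableAt ℝ (fun z : ℝ × ℝ => v' z.2) z := fun z =>
    (hv.deriv_snd z.2).differentiableAt.comp z differentiableAt_snd
  have df : ∀ z ∈ I, DifferentiableAt ℝ f z := fun z hz =>
    (dv z).mul (((dX z hz).mul (dw z hz)).sub ((dq z hz).mul (dw' z hz)))
  have dg : ∀ z ∈ I, DifferentiableAt ℝ g z := fun z hz =>
    (dw z hz).mul (((dY z hz).mul (dv z)).sub ((dq z hz).mul (dv' z)))
  -- Set to 0 off the open quadrant, where two-sided derivatives need not exist, so that the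
  -- divergence vanishes identically.
  let f' : ℝ × ℝ → ℝ × ℝ →L[ℝ] ℂ := fun z => if z ∈ I then fderiv ℝ f z else 0
  let g' : ℝ × ℝ → ℝ × ℝ →L[ℝ] ℂ := fun z => if z ∈ I then fderiv ℝ g z else 0
  have hdiv : ∀ z, f' z (1, 0) + g' z (0, 1) = 0 := by
    intro z
    by_cases hz : z ∈ I
    · obtain ⟨x, y⟩ := z
      have hx : 0 < x := hz.1
      have hy : 0 < y := hz.2
      simp only [f', g', if_pos hz]
      have c1 : HasDerivAt (fun s : ℝ => (s, y)) ((1 : ℝ), (0 : ℝ)) x :=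
        (hasDerivAt_id x).prodMk (hasDerivAt_const x y)
      have c2 : HasDerivAt (fun t : ℝ => (x, t)) ((0 : ℝ), (1 : ℝ)) y :=
        (hasDerivAt_const y x).prodMk (hasDerivAt_id y)
      have e1 := (df _ hz).hasFDerivAt.comp_hasDerivAt x c1
      have e2 := (dg _ hz).hasFDerivAt.comp_hasDerivAt y c2
      have e1' : HasDerivAt (f ∘ fun s : ℝ => (s, y)) _ x :=
        ((((hasDerivAt_partialX h.smooth hx hy).ofReal_comp.fun_mul (aw x hx)).fun_sub
          ((hasDerivAt_fst h.smooth hx hy.le).ofReal_comp.fun_mul (aw' x hx))).const_mul (v y))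
      have e2' : HasDerivAt (g ∘ fun t : ℝ => (x, t)) _ y :=
        ((((hasDerivAt_partialY h.smooth hx hy).ofReal_comp.fun_mul (hv.deriv_fst y)).fun_sub
          ((hasDerivAt_snd h.smooth hx.le hy).ofReal_comp.fun_mul (hv.deriv_snd y))).const_mul
            (w x))
      rw [e1.unique e1', e2.unique e2']
      have hp := congrArg (fun r : ℝ => (r : ℂ)) (h.pde x y hx hy)
      simp only [Complex.ofReal_add, Complex.ofReal_mul, Complex.ofReal_zero] at hp
      linear_combination v y * w x * hp
    · simp [f', g', hz]
  have hb : 0 ≤ b := ha.trans hab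
  have hsub : uIcc a b ×ˢ uIcc 0 R ⊆ quarter := by
    rw [uIcc_of_le hab, uIcc_of_le hR]
    exact prod_mono (fun x hx => ha.trans hx.1) fun y hy => hy.1
  have cw := hw.continuousOn.comp (continuousOn_fst (s := quarter)) fun z hz => hz.1
  have cw' := hw.continuousOn_deriv.comp (continuousOn_fst (s := quarter)) fun z hz => hz.1
  have cv := (hv.continuous.comp continuous_snd).continuousOn (s := quarter)
  have cv' := (hv.continuous_deriv.comp continuous_snd).continuousOn (s := quarter)
  have cq := Complex.continuous_ofReal.comp_continuousOn h.continuousOn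
  have cX := Complex.continuous_ofReal.comp_continuousOn h.continuousOnX
  have cY := Complex.continuous_ofReal.comp_continuousOn h.continuousOnY
  have hopen : Ioo (min a b) (max a b) ×ˢ Ioo (min 0 R) (max 0 R) ⊆ I := by
    rw [min_eq_left hab, min_eq_left hR]
    exact prod_mono (fun x hx => ha.trans_lt hx.1) fun y hy => hy.1
  have key := integral2_divergence_prod_of_hasFDerivAt f g f' g' a 0 b R
    ((cv.mul ((cX.mul cw).sub (cq.mul cw'))).mono hsub)
    ((cw.mul ((cY.mul cv).sub (cq.mul cv'))).mono hsub)
    (fun z hz => by simpa only [f', if_pos (hopen hz)] using (df z (hopen hz)).hasFDerivAt)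
    (fun z hz => by simpa only [g', if_pos (hopen hz)] using (dg z (hopen hz)).hasFDerivAt)
    (by simp only [hdiv]; exact integrableOn_zero)
  simp only [hdiv, intervalIntegral.integral_zero] at key
  exact key.symm

theorem half_lt (h : IsDecayingSol u q C p) : 1 < p / 2 := by linarith [h.two_lt]

theorem integrableOn_mul_y (h : IsDecayingSol u q C p) {x L : ℝ} (hx : 0 ≤ x) {v : ℝ → ℂ}
    (hv : ContinuousOn v (Ioi 0)) (hL : ∀ y, 0 < y → ‖v y‖ ≤ L) {r : ℝ → ℝ → ℝ}
    (hr : ContinuousOn (fun z : ℝ × ℝ => r z.1 z.2) quarter)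
    (hrb : ∀ x y, 0 ≤ x → 0 ≤ y → |r x y| ≤ C * (1 + x + y) ^ (-p)) :
    IntegrableOn (fun y => v y * (r x y : ℂ)) (Ioi 0) ∧
    ‖∫ y in Ioi (0 : ℝ), v y * (r x y : ℂ)‖
      ≤ L * C * (1 + x) ^ (-(p / 2)) * ∫ y in Ioi (0 : ℝ), (1 + y) ^ (-(p / 2)) := by
  have hL0 : 0 ≤ L := (norm_nonneg _).trans (hL 1 one_pos)
  have hC := h.const_nonneg
  have hint := (integrableOn_one_add_rpow (s := -(p / 2)) (by linarith [h.half_lt])).const_mul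
    (L * C * (1 + x) ^ (-(p / 2)))
  have hle : ∀ᵐ y ∂volume.restrict (Ioi (0 : ℝ)), ‖v y * (r x y : ℂ)‖
      ≤ L * C * (1 + x) ^ (-(p / 2)) * (1 + y) ^ (-(p / 2)) := by
    refine (ae_restrict_iff' measurableSet_Ioi).2 (Eventually.of_forall fun y (hy : 0 < y) => ?_)
    rw [norm_mul, Complex.norm_real, Real.norm_eq_abs]
    have h1 := (hrb x y hx hy.le).trans
      (mul_le_mul_of_nonneg_left (rpow_split hx hy.le (by linarith [h.two_lt])) hC)
    calc _ ≤ L * (C * ((1 + x) ^ (-(p / 2)) * (1 + y) ^ (-(p / 2)))) :=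
          mul_le_mul (hL y hy) h1 (abs_nonneg _) hL0
      _ = _ := by ring
  have hc : ContinuousOn (fun y => r x y) (Ioi 0) :=
    hr.comp (f := fun y : ℝ => (x, y)) (by fun_prop) fun y (hy : 0 < y) => ⟨hx, hy.le⟩
  refine ⟨hint.mono' ((hv.mul (Complex.continuous_ofReal.comp_continuousOn
    hc)).aestronglyMeasurable measurableSet_Ioi) hle, ?_⟩
  rw [← integral_const_mul]
  exact norm_integral_le_of_norm_le hint hle

theorem integrable_weight_x (h : IsDecayingSol u q C p) :
    IntegrableOn (fun x : ℝ => C * ((1 + x) * (1 + x) ^ (-p))) (Ioi 0) := by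
  have := (integrableOn_one_add_rpow (s := 1 - p) (by linarith [h.two_lt])).const_mul C
  refine IntegrableOn.congr_fun this (fun x (hx : 0 < x) => ?_) measurableSet_Ioi
  rw [sub_eq_add_neg, Real.rpow_add (by linarith), Real.rpow_one]

theorem integrableOn_mul_x (h : IsDecayingSol u q C p) {a L : ℝ} (ha : 0 ≤ a) {w : ℝ → ℂ}
    (hw : ContinuousOn w (Ici 0)) (hL : ∀ x, 0 ≤ x → ‖w x‖ ≤ L * (1 + x)) {r : ℝ → ℝ → ℝ}
    (hr : ContinuousOn (fun z : ℝ × ℝ => r z.1 z.2) quarter)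
    (hrb : ∀ x y, 0 ≤ x → 0 ≤ y → |r x y| ≤ C * (1 + x + y) ^ (-p)) :
    IntegrableOn (fun x => w x * (r x 0 : ℂ)) (Ioi a) := by
  have hc : ContinuousOn (fun x => r x 0) (Ici 0) :=
    hr.comp (f := fun x : ℝ => (x, (0 : ℝ))) (by fun_prop) fun x hx => ⟨hx, le_refl (0 : ℝ)⟩
  refine IntegrableOn.mono_set ?_ (Ioi_subset_Ioi ha)
  refine (h.integrable_weight_x.const_mul L).mono' (((hw.mul
    (Complex.continuous_ofReal.comp_continuousOn hc)).mono
      Ioi_subset_Ici_self).aestronglyMeasurable measurableSet_Ioi) ?_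
  refine (ae_restrict_iff' measurableSet_Ioi).2 (Eventually.of_forall fun x (hx : 0 < x) => ?_)
  rw [norm_mul, Complex.norm_real, Real.norm_eq_abs]
  have h1 := hrb x 0 hx.le le_rfl
  rw [add_zero] at h1
  calc _ ≤ (L * (1 + x)) * (C * (1 + x) ^ (-p)) :=
        mul_le_mul (hL x hx.le) h1 (abs_nonneg _) ((norm_nonneg _).trans (hL x hx.le))
    _ = _ := by ring

theorem integrableOn_flux_y (h : IsDecayingSol u q C p) {x L : ℝ} (hx : 0 ≤ x) {v : ℝ → ℂ}
    (hv : ContinuousOn v (Ioi 0)) (hL : ∀ y, 0 < y → ‖v y‖ ≤ L) (c d : ℂ) :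
    IntegrableOn (fun y => v y * (partialX q x y * c - q x y * d)) (Ioi 0) := by
  have h1 := (h.integrableOn_mul_y hx hv hL h.continuousOnX h.boundX).1.mul_const c
  have h2 := (h.integrableOn_mul_y hx hv hL h.continuousOn h.bound).1.mul_const d
  refine IntegrableOn.congr_fun (h1.sub h2) (fun y _ => ?_) measurableSet_Ioi
  simp only [Pi.sub_apply]
  ring

/-- The top edge y = R of the rectangle contributes O((1+R)^{-p}) and disappears as R → ∞. -/
theorem green_strip (h : IsDecayingSol u q C p) {k : ℂ} {w w' v v' : ℝ → ℂ}
    (hw : IsSol u k w w') (hv : IsExpSol k v v') {L : ℝ} (hL : ∀ y, 0 ≤ y → ‖v y‖ ≤ L)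
    (hL' : ∀ y, 0 ≤ y → ‖v' y‖ ≤ L) {a b : ℝ} (ha : 0 ≤ a) (hab : a ≤ b) :
    ∫ x in a..b, w x * (q x 0 * v' 0 - partialY q x 0 * v 0)
      = (∫ y in Ioi (0 : ℝ), v y * (partialX q a y * w a - q a y * w' a))
        - ∫ y in Ioi (0 : ℝ), v y * (partialX q b y * w b - q b y * w' b) := by
  have hb : 0 ≤ b := ha.trans hab
  have hC := h.const_nonneg
  have hL0 : 0 ≤ L := (norm_nonneg _).trans (hL 0 le_rfl)
  have hlim : ∀ x, 0 ≤ x → ∀ c d : ℂ, Tendsto (fun R : ℝ => ∫ y in (0 : ℝ)..R,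
      v y * (partialX q x y * c - q x y * d)) atTop
      (𝓝 (∫ y in Ioi (0 : ℝ), v y * (partialX q x y * c - q x y * d))) := fun x hx c d =>
    intervalIntegral_tendsto_integral_Ioi 0
      (h.integrableOn_flux_y hx hv.continuous.continuousOn (fun y hy => hL y hy.le) c d) tendsto_id
  obtain ⟨M, hM⟩ := (isCompact_Icc (a := a) (b := b)).exists_bound_of_continuousOn
    (hw.continuousOn.mono fun x hx => ha.trans hx.1)
  have htop : Tendsto (fun R : ℝ => ∫ x in a..b, w x * (partialY q x R * v R - q x R * v' R))
      atTop (𝓝 0) := by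
    have h0 : Tendsto (fun R : ℝ => |M| * (2 * (C * L)) * (1 + R) ^ (-p) * |b - a|) atTop
        (𝓝 (|M| * (2 * (C * L)) * 0 * |b - a|)) :=
      (((tendsto_rpow_neg_atTop (by linarith [h.two_lt])).comp
        (tendsto_atTop_add_const_left _ 1 tendsto_id)).const_mul _).mul_const _
    rw [mul_zero, zero_mul] at h0
    refine squeeze_zero_norm' ?_ h0
    filter_upwards [eventually_ge_atTop 0] with R hR
    refine intervalIntegral.norm_integral_le_of_norm_le_const fun x hx => ?_
    rw [uIoc_of_le hab] at hx
    have hx0 : 0 ≤ x := ha.trans hx.1.le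
    have hmono : (1 + x + R) ^ (-p) ≤ (1 + R) ^ (-p) :=
      Real.rpow_le_rpow_of_nonpos (by linarith) (by linarith) (by linarith [h.two_lt])
    have h1 := (h.boundY x R hx0 hR).trans (mul_le_mul_of_nonneg_left hmono hC)
    have h2 := (h.bound x R hx0 hR).trans (mul_le_mul_of_nonneg_left hmono hC)
    rw [norm_mul]
    have h3 : ‖(partialY q x R : ℂ) * v R - q x R * v' R‖
        ≤ 2 * (C * L) * (1 + R) ^ (-p) := by
      refine (norm_sub_le _ _).trans ?_
      rw [norm_mul, norm_mul, Complex.norm_real, Complex.norm_real, Real.norm_eq_abs,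
        Real.norm_eq_abs]
      have h4 := mul_le_mul h1 (hL R hR) (norm_nonneg _) ((abs_nonneg _).trans h1)
      have h5 := mul_le_mul h2 (hL' R hR) (norm_nonneg _) ((abs_nonneg _).trans h1)
      linarith
    calc _ ≤ |M| * (2 * (C * L) * (1 + R) ^ (-p)) :=
          mul_le_mul ((hM x ⟨hx.1.le, hx.2⟩).trans (le_abs_self M)) h3 (norm_nonneg _)
            (abs_nonneg _)
      _ = _ := by ring
  have hall := ((htop.sub_const (∫ x in a..b, w x * (partialY q x 0 * v 0 - q x 0 * v' 0))).add
    (hlim b hb (w b) (w' b))).sub (hlim a ha (w a) (w' a))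
  have hz := tendsto_nhds_unique (hall.congr' (by
    filter_upwards [eventually_ge_atTop 0] with R hR
    exact h.green_rectangle hw hv ha hab hR)) tendsto_const_nhds
  have hneg : ∫ x in a..b, w x * (q x 0 * v' 0 - partialY q x 0 * v 0)
      = -∫ x in a..b, w x * (partialY q x 0 * v 0 - q x 0 * v' 0) := by
    rw [← intervalIntegral.integral_neg]
    congr 1 with x
    ring
  rw [hneg]
  linear_combination hz

/-- The flux through x = b is O((1+b)^{1-p/2}) even for w of linear growth, so it vanishes as b → ∞
exactly because p > 2. Linear growth is what the available bound allows φ at k = 0. -/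
theorem green_half (h : IsDecayingSol u q C p) {k : ℂ} {w w' v v' : ℝ → ℂ}
    (hw : IsSol u k w w') (hv : IsExpSol k v v') {L : ℝ} (hL : ∀ y, 0 ≤ y → ‖v y‖ ≤ L)
    (hL' : ∀ y, 0 ≤ y → ‖v' y‖ ≤ L) {M : ℝ} (hM : ∀ x, 0 ≤ x → ‖w x‖ ≤ M * (1 + x))
    (hM' : ∀ x, 0 ≤ x → ‖w' x‖ ≤ M * (1 + x)) {a : ℝ} (ha : 0 ≤ a) :
    IntegrableOn (fun x => w x * (q x 0 * v' 0 - partialY q x 0 * v 0)) (Ioi a) ∧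
    ∫ x in Ioi a, w x * (q x 0 * v' 0 - partialY q x 0 * v 0)
      = ∫ y in Ioi (0 : ℝ), v y * (partialX q a y * w a - q a y * w' a) := by
  have hint : IntegrableOn (fun x => w x * (q x 0 * v' 0 - partialY q x 0 * v 0)) (Ioi a) := by
    have h1 := (h.integrableOn_mul_x ha hw.continuousOn hM h.continuousOn h.bound).mul_const (v' 0)
    have h2 := (h.integrableOn_mul_x ha hw.continuousOn hM h.continuousOnY h.boundY).mul_const
      (v 0)
    refine IntegrableOn.congr_fun (h1.sub h2) (fun y _ => ?_) measurableSet_Ioi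
    simp only [Pi.sub_apply]
    ring
  refine ⟨hint, ?_⟩
  let J := ∫ y in Ioi (0 : ℝ), (1 + y) ^ (-(p / 2))
  have hC := h.const_nonneg
  have hL0 : 0 ≤ L := (norm_nonneg _).trans (hL 0 le_rfl)
  have hM0 : 0 ≤ M := by
    have := (norm_nonneg _).trans (hM 0 le_rfl)
    simpa using this
  have hJ : 0 ≤ J := setIntegral_nonneg measurableSet_Ioi fun y (hy : 0 < y) => by positivity
  have hsmall : Tendsto (fun b => ∫ y in Ioi (0 : ℝ),
      v y * (partialX q b y * w b - q b y * w' b)) atTop (𝓝 0) := by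
    have h0 : Tendsto (fun b : ℝ => 2 * (L * C * J * M) * (1 + b) ^ (-(p / 2 - 1))) atTop
        (𝓝 (2 * (L * C * J * M) * 0)) :=
      ((tendsto_rpow_neg_atTop (by linarith [h.half_lt])).comp
        (tendsto_atTop_add_const_left _ 1 tendsto_id)).const_mul _
    rw [mul_zero] at h0
    refine squeeze_zero_norm' ?_ h0
    filter_upwards [eventually_ge_atTop 0] with b hb
    have h1 := h.integrableOn_mul_y hb hv.continuous.continuousOn (fun y hy => hL y hy.le)
      h.continuousOnX h.boundX
    have h2 := h.integrableOn_mul_y hb hv.continuous.continuousOn (fun y hy => hL y hy.le)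
      h.continuousOn h.bound
    have e : ∫ y in Ioi (0 : ℝ), v y * (partialX q b y * w b - q b y * w' b)
        = (∫ y in Ioi (0 : ℝ), v y * (partialX q b y : ℂ)) * w b
          - (∫ y in Ioi (0 : ℝ), v y * (q b y : ℂ)) * w' b := by
      rw [← integral_mul_const, ← integral_mul_const,
        ← integral_sub (h1.1.mul_const _) (h2.1.mul_const _)]
      congr 1 with y
      ring
    rw [e]
    refine (norm_sub_le _ _).trans ?_
    rw [norm_mul, norm_mul]
    have h3 := mul_le_mul h1.2 (hM b hb) (norm_nonneg _) ((norm_nonneg _).trans h1.2)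
    have h4 := mul_le_mul h2.2 (hM' b hb) (norm_nonneg _) ((norm_nonneg _).trans h1.2)
    have h5 : (1 + b) ^ (-(p / 2 - 1)) = (1 + b) ^ (-(p / 2)) * (1 + b) := by
      rw [neg_sub, sub_eq_add_neg, add_comm, Real.rpow_add (by linarith), Real.rpow_one, mul_comm]
    rw [h5]
    refine (add_le_add h3 h4).trans_eq ?_
    ring
  have hl := intervalIntegral_tendsto_integral_Ioi a hint tendsto_id
  have hr := hsmall.const_sub (∫ y in Ioi (0 : ℝ), v y * (partialX q a y * w a - q a y * w' a))
  rw [sub_zero] at hr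
  refine tendsto_nhds_unique hl (hr.congr' ?_)
  filter_upwards [eventually_ge_atTop a] with b hb
  exact (h.green_strip hw hv hL hL' ha hb).symm

end IsDecayingSol

end QuarterPlane

/-! ### The global relations. -/

namespace QuarterPlane

open Filter Topology

variable {u : ℝ → ℝ} {q : ℝ → ℝ → ℝ} {C p : ℝ}

/-- Identity theorem on D, extended to the points of its closure in Ω by continuity. -/
theorem HolCont.eq_zero_of_frequently {D Ω : Set ℂ} {G : ℂ → ℂ} (hG : HolCont D Ω G)
    (hD : IsOpen D) (hDc : IsPreconnected D) (hDΩ : D ⊆ Ω) {z₀ : ℂ} (hz₀ : z₀ ∈ D)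
    (hfreq : ∃ᶠ z in 𝓝[≠] z₀, G z = 0) {k : ℂ} (hk : k ∈ Ω) (hkc : k ∈ closure D) : G k = 0 := by
  have h0 := (hG.diff.analyticOnNhd hD).eqOn_zero_of_preconnected_of_frequently_eq_zero hDc hz₀
    hfreq
  have hne : (𝓝[D] k).NeBot := mem_closure_iff_nhdsWithin_neBot.1 hkc
  have hlim : Tendsto G (𝓝[D] k) (𝓝 (G k)) := (hG.cont k hk).mono hDΩ
  refine tendsto_nhds_unique hlim (tendsto_const_nhds.congr' ?_)
  filter_upwards [self_mem_nhdsWithin] with z hz using (h0 hz).symm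

theorem convex_reProdIm {s t : Set ℝ} (hs : Convex ℝ s) (ht : Convex ℝ t) :
    Convex ℝ (s ×ℂ t) :=
  (hs.linear_preimage Complex.reLm).inter (ht.linear_preimage Complex.imLm)

theorem isExpSol_exp (k : ℂ) :
    IsExpSol k (fun y => Complex.exp (k * y)) (fun y => k * Complex.exp (k * y)) :=
  ⟨fun y => hasDerivAt_exp_mul k y, fun y =>
    ((hasDerivAt_exp_mul k y).const_mul k).congr_deriv (by ring)⟩

theorem norm_exp_mul_ofReal (k : ℂ) (y : ℝ) : ‖Complex.exp (k * y)‖ = Real.exp (k.re * y) := by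
  rw [Complex.norm_exp]; simp

theorem norm_exp_mul_le_one {k : ℂ} (hk : k.re ≤ 0) {y : ℝ} (hy : 0 ≤ y) :
    ‖Complex.exp (k * y)‖ ≤ 1 := by
  rw [norm_exp_mul_ofReal]
  exact Real.exp_le_one_iff.2 (mul_nonpos_of_nonpos_of_nonneg hk hy)

theorem norm_psi_le_jostBound (hu : Admissible u) {k : ℂ} (hk : 0 ≤ k.im) {x : ℝ} (hx : 0 ≤ x) :
    ‖psi u k x‖ ≤ jostBound u :=
  (norm_psi_le hu hx hk).trans (mul_le_of_le_one_right (jostBound_pos u).le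
    (Real.exp_le_one_iff.2 (neg_nonpos.2 (mul_nonneg hk hx))))

theorem norm_psiD_le_const (hu : Admissible u) {k : ℂ} (hk : 0 ≤ k.im) {x : ℝ} (hx : 0 ≤ x) :
    ‖psiD u k x‖ ≤ ‖k‖ + jostBound u * totWeight u := by
  have := totWeight_nonneg u
  have := jostBound_pos u
  exact (norm_psiD_le hu hx hk).trans (mul_le_of_le_one_right (by positivity)
    (Real.exp_le_one_iff.2 (neg_nonpos.2 (mul_nonneg hk hx))))

theorem exists_norm_psi_le_linear (hu : Admissible u) {k : ℂ} (hk : 0 ≤ k.im) :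
    ∃ M : ℝ, (∀ x, 0 ≤ x → ‖psi u k x‖ ≤ M * (1 + x)) ∧
      ∀ x, 0 ≤ x → ‖psiD u k x‖ ≤ M * (1 + x) := by
  have hT := totWeight_nonneg u
  have hK := jostBound_pos u
  have hM : 0 ≤ jostBound u + (‖k‖ + jostBound u * totWeight u) := by positivity
  exact ⟨jostBound u + (‖k‖ + jostBound u * totWeight u),
    fun x hx => ((norm_psi_le_jostBound hu hk hx).trans (le_add_of_nonneg_right
      (by positivity))).trans (le_mul_of_one_le_right hM (by linarith)),
    fun x hx => ((norm_psiD_le_const hu hk hx).trans (le_add_of_nonneg_left hK.le)).trans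
      (le_mul_of_one_le_right hM (by linarith))⟩

theorem eventually_norm_le (S : Set ℂ) (k₀ : ℂ) : ∀ᶠ k in 𝓝[S] k₀, ‖k‖ < ‖k₀‖ + 1 :=
  (continuous_norm.tendsto k₀).mono_left nhdsWithin_le_nhds |>.eventually_lt_const (lt_add_one _)

namespace IsDecayingSol

theorem global_relation_of_le (h : IsDecayingSol u q C p) {k : ℂ} (hk : k.re ≤ 0) {l : ℂ}
    {w w' : ℝ → ℂ} (hw : IsSol u l w w') (hl : l = k) {M : ℝ}
    (hM : ∀ x, 0 ≤ x → ‖w x‖ ≤ M * (1 + x)) (hM' : ∀ x, 0 ≤ x → ‖w' x‖ ≤ M * (1 + x)) :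
    IntegrableOn (fun x : ℝ => (k * q x 0 - partialY q x 0) * w x) (Ioi 0) ∧
      (∫ x in Ioi (0 : ℝ), (k * q x 0 - partialY q x 0) * w x)
        + (∫ y in Ioi (0 : ℝ), Complex.exp (k * y) * (q 0 y * w' 0 - partialX q 0 y * w 0)) = 0 := by
  subst hl
  have hg := h.green_half hw (isExpSol_exp l) (L := 1 + ‖l‖)
    (fun y hy => (norm_exp_mul_le_one hk hy).trans (by linarith [norm_nonneg l]))
    (fun y hy => by
      rw [norm_mul]
      have := mul_le_mul_of_nonneg_left (norm_exp_mul_le_one hk hy) (norm_nonneg l)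
      linarith) hM hM' le_rfl
  have e1 : ∀ x : ℝ, w x * (q x 0 * (l * Complex.exp (l * (0 : ℝ)))
      - partialY q x 0 * Complex.exp (l * (0 : ℝ))) = (l * q x 0 - partialY q x 0) * w x := by
    intro x
    simp only [Complex.ofReal_zero, mul_zero, Complex.exp_zero]
    ring
  simp only [e1] at hg
  refine ⟨hg.1, ?_⟩
  rw [hg.2, ← neg_neg (∫ y in Ioi (0 : ℝ), Complex.exp (l * y) *
    (q 0 y * w' 0 - partialX q 0 y * w 0)), ← integral_neg, ← sub_eq_add_neg, sub_eq_zero]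
  congr 1 with y
  ring

theorem integrableOn_boundary_y (h : IsDecayingSol u q C p) {k : ℂ} (hk : k.re ≤ 0) (c d : ℂ) :
    IntegrableOn (fun y : ℝ => Complex.exp (k * y) * (q 0 y * c - partialX q 0 y * d))
      (Ioi 0) := by
  have := (h.integrableOn_flux_y le_rfl (v := fun y => Complex.exp (k * y))
    (Continuous.continuousOn (by fun_prop)) (fun y hy => norm_exp_mul_le_one hk hy.le) d c).neg
  refine IntegrableOn.congr_fun this (fun y _ => ?_) measurableSet_Ioi
  simp only [Pi.neg_apply]
  ring

theorem continuousOn_bottom (h : IsDecayingSol u q C p) : ContinuousOn (fun x => q x 0) (Ici 0) :=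
  h.continuousOn.comp (f := fun x : ℝ => (x, (0 : ℝ))) (by fun_prop)
    fun x hx => ⟨hx, le_refl (0 : ℝ)⟩

theorem continuousOn_bottomY (h : IsDecayingSol u q C p) :
    ContinuousOn (fun x => partialY q x 0) (Ici 0) :=
  h.continuousOnY.comp (f := fun x : ℝ => (x, (0 : ℝ))) (by fun_prop)
    fun x hx => ⟨hx, le_refl (0 : ℝ)⟩

theorem continuousOn_left (h : IsDecayingSol u q C p) {x : ℝ} (hx : 0 ≤ x) :
    ContinuousOn (fun y => q x y) (Ici 0) :=
  h.continuousOn.comp (f := fun y : ℝ => (x, y)) (by fun_prop) fun y hy => ⟨hx, hy⟩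

theorem continuousOn_leftX (h : IsDecayingSol u q C p) {x : ℝ} (hx : 0 ≤ x) :
    ContinuousOn (fun y => partialX q x y) (Ici 0) :=
  h.continuousOnX.comp (f := fun y : ℝ => (x, y)) (by fun_prop) fun y hy => ⟨hx, hy⟩

theorem continuousOn_bottom_mul (h : IsDecayingSol u q C p) (k : ℂ) {w : ℝ → ℂ}
    (hw : ContinuousOn w (Ici 0)) :
    ContinuousOn (fun x : ℝ => (k * q x 0 - partialY q x 0) * w x) (Ioi 0) :=
  (((continuousOn_const.mul (Complex.continuous_ofReal.comp_continuousOn h.continuousOn_bottom)).sub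
    (Complex.continuous_ofReal.comp_continuousOn h.continuousOn_bottomY)).mul hw).mono
    Ioi_subset_Ici_self

theorem continuousOn_left_mul (h : IsDecayingSol u q C p) (k c d : ℂ) :
    ContinuousOn (fun y : ℝ => Complex.exp (k * y) * (q 0 y * c - partialX q 0 y * d)) (Ioi 0) :=
  ((Continuous.continuousOn (by fun_prop)).mul
    (((Complex.continuous_ofReal.comp_continuousOn (h.continuousOn_left le_rfl)).mul
      continuousOn_const).sub ((Complex.continuous_ofReal.comp_continuousOn
        (h.continuousOn_leftX le_rfl)).mul continuousOn_const))).mono Ioi_subset_Ici_self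

theorem norm_bottom_mul_le {k k₀ : ℂ} (hk : ‖k‖ ≤ ‖k₀‖ + 1) {w : ℂ} {B e : ℝ}
    (he : 0 ≤ e) (hw : ‖w‖ ≤ B * e) (x : ℝ) : ‖(k * q x 0 - partialY q x 0) * w‖
      ≤ B * ((‖k₀‖ + 1) * ‖e * q x 0‖ + ‖e * partialY q x 0‖) := by
  have h1 : ‖k * q x 0 - partialY q x 0‖ ≤ (‖k₀‖ + 1) * |q x 0| + |partialY q x 0| := by
    refine (norm_sub_le _ _).trans ?_
    rw [norm_mul, Complex.norm_real, Complex.norm_real, Real.norm_eq_abs, Real.norm_eq_abs]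
    gcongr
  rw [norm_mul, norm_mul, norm_mul, Real.norm_of_nonneg he, Real.norm_eq_abs, Real.norm_eq_abs]
  calc _ ≤ ((‖k₀‖ + 1) * |q x 0| + |partialY q x 0|) * (B * e) :=
        mul_le_mul h1 hw (norm_nonneg _) (by positivity)
    _ = _ := by ring

theorem norm_left_mul_le {c d v : ℂ} {B e : ℝ} (he : 0 ≤ e) (hc : ‖c‖ ≤ B) (hd : ‖d‖ ≤ B)
    (hv : ‖v‖ ≤ e) (y : ℝ) : ‖v * (q 0 y * c - partialX q 0 y * d)‖
      ≤ B * (‖e * q 0 y‖ + ‖e * partialX q 0 y‖) := by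
  have h1 : ‖q 0 y * c - partialX q 0 y * d‖ ≤ |q 0 y| * B + |partialX q 0 y| * B := by
    refine (norm_sub_le _ _).trans ?_
    rw [norm_mul, norm_mul, Complex.norm_real, Complex.norm_real, Real.norm_eq_abs,
      Real.norm_eq_abs]
    gcongr
  rw [norm_mul, norm_mul, norm_mul, Real.norm_of_nonneg he, Real.norm_eq_abs, Real.norm_eq_abs]
  calc _ ≤ e * (|q 0 y| * B + |partialX q 0 y| * B) :=
        mul_le_mul hv h1 (norm_nonneg _) he
    _ = _ := by ring

/-- For real k ≤ 0, φ and φ_x grow at most linearly and Green's identity applies directly. For other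
k both integrals are holomorphic in the half strip Re z < 0, |Im z| < |Im k| and continuous up to k,
so the identity continues from the negative real axis. -/
theorem global_relation_phi (hu : Admissible u) (h : IsDecayingSol u q C p) {k : ℂ}
    (hk : k.re ≤ 0)
    (h1 : IntegrableOn (fun x : ℝ => Real.exp (|k.im| * x) * q x 0) (Ioi 0))
    (h2 : IntegrableOn (fun x : ℝ => Real.exp (|k.im| * x) * partialY q x 0) (Ioi 0)) :
    IntegrableOn (fun x : ℝ => (k * q x 0 - partialY q x 0) * phi u k x) (Ioi 0) ∧
      IntegrableOn (fun y : ℝ => Complex.exp (k * y) *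
        (q 0 y * phiX0 u k - partialX q 0 y * phi u k 0)) (Ioi 0) ∧
      (∫ x in Ioi (0 : ℝ), (k * q x 0 - partialY q x 0) * phi u k x)
        + (∫ y in Ioi (0 : ℝ), Complex.exp (k * y) *
            (q 0 y * phiX0 u k - partialX q 0 y * phi u k 0)) = 0 := by
  have hreal : ∀ z : ℂ, z.re ≤ 0 → z.im = 0 →
      IntegrableOn (fun x : ℝ => (z * q x 0 - partialY q x 0) * phi u z x) (Ioi 0) ∧
      (∫ x in Ioi (0 : ℝ), (z * q x 0 - partialY q x 0) * phi u z x)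
        + (∫ y in Ioi (0 : ℝ), Complex.exp (z * y) *
            (q 0 y * phiX0 u z - partialX q 0 y * phi u z 0)) = 0 := by
    intro z hz hz0
    have hT := totWeight_nonneg u
    let M := 2 * Real.exp (2 * totWeight u) + (‖z‖ + 2 * Real.exp (2 * totWeight u) * totWeight u)
    have := h.global_relation_of_le hz (isSol_phi hu z) rfl (M := M) (fun x hx => ?_)
      (fun x hx => ?_)
    · rwa [phiX0, (isSol_phi hu z).derivWithin_zero]
    · refine (norm_phi_le hu hx z).trans ?_
      simp only [hz0, abs_zero, zero_mul, Real.exp_zero, mul_one]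
      refine mul_le_mul_of_nonneg_right (le_add_of_nonneg_right (by positivity)) (by linarith)
    · refine (norm_phiD_le hu hx hz0).trans ?_
      refine le_trans (le_add_of_nonneg_left (by positivity)) (le_mul_of_one_le_right
        (by positivity) (by linarith))
  have hy := h.integrableOn_boundary_y hk (phiX0 u k) (phi u k 0)
  by_cases him : k.im = 0
  · exact ⟨(hreal k hk him).1, hy, (hreal k hk him).2⟩
  set κ := |k.im| with hκ
  have hκ0 : 0 < κ := abs_pos.2 him
  let L : ℝ → ℝ := fun r => 1 + 1 / r * (2 * Real.exp (2 * totWeight u)) * totWeight u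
  have hT := totWeight_nonneg u
  -- The origin is removed because the bound on φ without linear growth degenerates there; the
  -- target k has nonzero imaginary part.
  let Ω : Set ℂ := {z | z.re ≤ 0 ∧ |z.im| ≤ κ ∧ z ≠ 0}
  let D : Set ℂ := Iio 0 ×ℂ Ioo (-κ) κ
  have hD : IsOpen D := isOpen_Iio.reProdIm isOpen_Ioo
  have hDc : IsPreconnected D :=
    (convex_reProdIm (convex_Iio 0) (convex_Ioo _ _)).isPreconnected
  have hDΩ : D ⊆ Ω := fun z hz => ⟨le_of_lt hz.1, (abs_lt.2 hz.2).le, fun h0 => by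
    have h3 : z.re < 0 := hz.1
    rw [h0] at h3
    simp at h3⟩
  have hphib : ∀ z : ℂ, |z.im| ≤ κ → ∀ r, 0 < r → r < ‖z‖ → ∀ x, 0 ≤ x →
      ‖phi u z x‖ ≤ L r * Real.exp (κ * x) := by
    intro z hz r hr hrz x hx
    refine (norm_phi_le_of_ne_zero hu hx (norm_pos_iff.1 (hr.trans hrz))).trans ?_
    have hl : 1 + 1 / ‖z‖ * (2 * Real.exp (2 * totWeight u)) * totWeight u ≤ L r := by
      simp only [L]
      gcongr
    exact mul_le_mul hl (Real.exp_le_exp.2 (mul_le_mul_of_nonneg_right hz hx)) (Real.exp_pos _).le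
      (le_trans (by positivity) hl)
  have hmeasx : ∀ z : ℂ, AEStronglyMeasurable
      (fun x : ℝ => (z * q x 0 - partialY q x 0) * phi u z x) (volume.restrict (Ioi 0)) :=
    fun z => (h.continuousOn_bottom_mul z (isSol_phi hu z).continuousOn).aestronglyMeasurable
      measurableSet_Ioi
  have hkΩ : k ∈ Ω := ⟨hk, le_rfl, fun h0 => him (by simp [h0])⟩
  have hmaj : ∀ r s : ℝ, IntegrableOn (fun x : ℝ => L r * (s * ‖Real.exp (κ * x) * q x 0‖
      + ‖Real.exp (κ * x) * partialY q x 0‖)) (Ioi 0) := fun r s =>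
    ((h1.norm.const_mul s).add h2.norm).const_mul (L r)
  have hnear : ∀ k₀ ∈ Ω, ∀ᶠ z in 𝓝[Ω] k₀, ‖k₀‖ / 2 < ‖z‖ := fun k₀ hk₀ =>
    ((continuous_norm.tendsto k₀).mono_left nhdsWithin_le_nhds).eventually_const_lt
      (half_lt_self (norm_pos_iff.2 hk₀.2.2))
  have hG1 : HolCont D Ω (fun z => ∫ x in Ioi (0 : ℝ),
      (z * q x 0 - partialY q x 0) * phi u z x) := by
    refine HolCont.integral hD hDΩ (fun z _ => hmeasx z) ?_ fun k₀ hk₀ => ?_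
    · refine (ae_restrict_iff' measurableSet_Ioi).2
        (Eventually.of_forall fun x (hx : 0 < x) => ?_)
      exact (HolCont.of_differentiable (by fun_prop)).mul
        (((jointHol_phi hu).holCont hx.le).mono (subset_univ _) (subset_univ _))
    · have hk₀n : 0 < ‖k₀‖ / 2 := half_pos (norm_pos_iff.2 hk₀.2.2)
      refine ⟨_, hmaj (‖k₀‖ / 2) (‖k₀‖ + 1), _, inter_mem (hnear k₀ hk₀)
        (inter_mem (eventually_norm_le Ω k₀) self_mem_nhdsWithin),
        (ae_restrict_iff' measurableSet_Ioi).2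
        (Eventually.of_forall fun x (hx : 0 < x) z hz => ?_)⟩
      exact norm_bottom_mul_le (le_of_lt hz.2.1) (Real.exp_pos _).le
        (hphib z hz.2.2.2.1 _ hk₀n hz.1 x hx.le) x
  have hG2 : HolCont D Ω (fun z => ∫ y in Ioi (0 : ℝ), Complex.exp (z * y) *
      (q 0 y * phiX0 u z - partialX q 0 y * phi u z 0)) := by
    simp only [phiX0_eq hu, phi_zero hu]
    refine HolCont.integral hD hDΩ (fun z _ =>
      (h.continuousOn_left_mul z _ _).aestronglyMeasurable measurableSet_Ioi) ?_ fun k₀ hk₀ => ?_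
    · exact Eventually.of_forall fun y => HolCont.of_differentiable (by fun_prop)
    · have hc0 := (h.integrableOn_mul_y le_rfl (v := fun _ => 1) continuousOn_const
        (fun _ _ => norm_one.le) h.continuousOn h.bound).1.norm
      have hc1 := (h.integrableOn_mul_y le_rfl (v := fun _ => 1) continuousOn_const
        (fun _ _ => norm_one.le) h.continuousOnX h.boundX).1.norm
      refine ⟨_, (hc0.add hc1).const_mul (‖k₀‖ + 1), _,
        (inter_mem (eventually_norm_le Ω k₀) self_mem_nhdsWithin),
        (ae_restrict_iff' measurableSet_Ioi).2
        (Eventually.of_forall fun y (hy : 0 < y) z hz => ?_)⟩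
      have := norm_left_mul_le (q := q) (c := -(Complex.I * z)) (d := 1) (B := ‖k₀‖ + 1)
        zero_le_one (by simpa using le_of_lt hz.1) (by simp)
        (norm_exp_mul_le_one hz.2.1 hy.le) y
      simpa using this
  refine ⟨?_, hy, ?_⟩
  · have hkn : 0 < ‖k‖ / 2 := half_pos (norm_pos_iff.2 hkΩ.2.2)
    refine (hmaj (‖k‖ / 2) (‖k‖ + 1)).mono' (hmeasx k) ((ae_restrict_iff' measurableSet_Ioi).2
      (Eventually.of_forall fun x (hx : 0 < x) => ?_))
    exact norm_bottom_mul_le (by linarith) (Real.exp_pos _).le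
      (hphib k le_rfl _ hkn (half_lt_self (norm_pos_iff.2 hkΩ.2.2)) x hx.le) x
  · have hz₀ : (-1 : ℂ) ∈ D := by
      simp [D, Complex.mem_reProdIm, hκ0]
    refine (hG1.add hG2).eq_zero_of_frequently hD hDc hDΩ hz₀ ?_ hkΩ ?_
    -- The points -1 - 1/(n+1) are real and negative, where the relation is known, and accumulate at
    -- -1.
    · have hlim : Tendsto (fun n : ℕ => (-1 : ℂ) - ((1 / ((n : ℝ) + 1) : ℝ) : ℂ)) atTop
          (𝓝[≠] (-1)) := by
        rw [tendsto_nhdsWithin_iff]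
        constructor
        · have := ((Complex.continuous_ofReal.tendsto 0).comp
            tendsto_one_div_add_atTop_nhds_zero_nat).const_sub (-1)
          simpa using this
        · refine Eventually.of_forall fun n => ?_
          have : (1 / ((n : ℝ) + 1) : ℝ) ≠ 0 := by positivity
          simp only [mem_compl_iff, mem_singleton_iff, sub_eq_self]
          exact_mod_cast this
      refine hlim.frequently (Frequently.of_forall fun n => ?_)
      refine (hreal _ ?_ ?_).2
      · rw [Complex.sub_re, Complex.ofReal_re]
        have : (0 : ℝ) ≤ 1 / ((n : ℝ) + 1) := by positivity
        simp only [Complex.neg_re, Complex.one_re]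
        linarith
      · rw [Complex.sub_im, Complex.ofReal_im]; simp
    · rw [Complex.closure_reProdIm, closure_Iio, closure_Ioo (by linarith)]
      exact ⟨hk, abs_le.1 (le_refl κ)⟩

/-- For Re k ≤ 0 this is Green's identity, as ψ is bounded for Im k ≥ 0. Both integrals are
holomorphic for Re z < max(Re k, 0), Im z > 0, so the relation continues from the open second
quadrant and reaches k by continuity. -/
theorem global_relation_psi (hu : Admissible u) (h : IsDecayingSol u q C p) {k : ℂ}
    (hk : 0 ≤ k.im)
    (h1 : IntegrableOn (fun y : ℝ => Real.exp (max k.re 0 * y) * q 0 y) (Ioi 0))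
    (h2 : IntegrableOn (fun y : ℝ => Real.exp (max k.re 0 * y) * partialX q 0 y) (Ioi 0)) :
    IntegrableOn (fun x : ℝ => (k * q x 0 - partialY q x 0) * psi u k x) (Ioi 0) ∧
      IntegrableOn (fun y : ℝ => Complex.exp (k * y) *
        (q 0 y * psiX0 u k - partialX q 0 y * psi u k 0)) (Ioi 0) ∧
      (∫ x in Ioi (0 : ℝ), (k * q x 0 - partialY q x 0) * psi u k x)
        + (∫ y in Ioi (0 : ℝ), Complex.exp (k * y) *
            (q 0 y * psiX0 u k - partialX q 0 y * psi u k 0)) = 0 := by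
  have hT := totWeight_nonneg u
  have hK := jostBound_pos u
  have hpsib : ∀ z : ℂ, 0 ≤ z.im → ∀ x, 0 ≤ x → ‖psi u z x‖ ≤ jostBound u := fun z hz x hx =>
    norm_psi_le_jostBound hu hz hx
  have hpsiDb : ∀ z : ℂ, 0 ≤ z.im → ∀ x, 0 ≤ x →
      ‖psiD u z x‖ ≤ ‖z‖ + jostBound u * totWeight u := fun z hz x hx =>
    norm_psiD_le_const hu hz hx
  have hleft : ∀ z : ℂ, 0 ≤ z.im → z.re ≤ 0 →
      (∫ x in Ioi (0 : ℝ), (z * q x 0 - partialY q x 0) * psi u z x)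
        + (∫ y in Ioi (0 : ℝ), Complex.exp (z * y) *
            (q 0 y * psiX0 u z - partialX q 0 y * psi u z 0)) = 0 := by
    intro z hz hre
    obtain ⟨M, hM, hM'⟩ := exists_norm_psi_le_linear hu hz
    have := h.global_relation_of_le hre (isSol_psi hu hz) rfl hM hM'
    rw [psiX0_eq hu hz]
    exact this.2
  have hbx : IntegrableOn (fun x => (1 : ℂ) * (q x 0 : ℂ)) (Ioi 0) :=
    h.integrableOn_mul_x le_rfl (w := fun _ => 1) (L := 1) continuousOn_const
      (fun x hx => by simpa using hx) h.continuousOn h.bound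
  have hby : IntegrableOn (fun x => (1 : ℂ) * (partialY q x 0 : ℂ)) (Ioi 0) :=
    h.integrableOn_mul_x le_rfl (w := fun _ => 1) (L := 1) continuousOn_const
      (fun x hx => by simpa using hx) h.continuousOnY h.boundY
  have hmajx : ∀ s : ℝ, IntegrableOn (fun x : ℝ => jostBound u * (s * ‖(1 : ℝ) * q x 0‖
      + ‖(1 : ℝ) * partialY q x 0‖)) (Ioi 0) := fun s => by
    have := ((hbx.norm.const_mul s).add hby.norm).const_mul (jostBound u)
    simp only [one_mul, Complex.norm_real] at this ⊢
    exact this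
  set κ := max k.re 0 with hκ
  have hκ0 : 0 ≤ κ := le_max_right _ _
  have hmajy : ∀ B : ℝ, IntegrableOn (fun y : ℝ => B * (‖Real.exp (κ * y) * q 0 y‖
      + ‖Real.exp (κ * y) * partialX q 0 y‖)) (Ioi 0) := fun B =>
    (h1.norm.add h2.norm).const_mul B
  have hmeasx : ∀ z : ℂ, 0 ≤ z.im → AEStronglyMeasurable
      (fun x : ℝ => (z * q x 0 - partialY q x 0) * psi u z x) (volume.restrict (Ioi 0)) :=
    fun z hz => (h.continuousOn_bottom_mul z (isSol_psi hu hz).continuousOn).aestronglyMeasurable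
      measurableSet_Ioi
  have hdomx : ∀ k₀ z : ℂ, ‖z‖ ≤ ‖k₀‖ + 1 → 0 ≤ z.im → ∀ x : ℝ, 0 < x →
      ‖(z * q x 0 - partialY q x 0) * psi u z x‖
        ≤ jostBound u * ((‖k₀‖ + 1) * ‖(1 : ℝ) * q x 0‖ + ‖(1 : ℝ) * partialY q x 0‖) :=
    fun k₀ z hn hz x hx => norm_bottom_mul_le hn zero_le_one
      (by rw [mul_one]; exact hpsib z hz x hx.le) x
  have hdomy : ∀ k₀ z : ℂ, ‖z‖ ≤ ‖k₀‖ + 1 → 0 ≤ z.im → z.re ≤ κ → ∀ y : ℝ, 0 < y →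
      ‖Complex.exp (z * y) * (q 0 y * psiX0 u z - partialX q 0 y * psi u z 0)‖
        ≤ (‖k₀‖ + 1 + jostBound u * totWeight u + jostBound u) *
          (‖Real.exp (κ * y) * q 0 y‖ + ‖Real.exp (κ * y) * partialX q 0 y‖) := by
    intro k₀ z hn hz hre y hy
    refine norm_left_mul_le (Real.exp_pos _).le ?_ ?_ ?_ y
    · rw [psiX0_eq hu hz]
      linarith [hpsiDb z hz 0 le_rfl]
    · have : 0 ≤ jostBound u * totWeight u := by positivity
      linarith [hpsib z hz 0 le_rfl, norm_nonneg k₀]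
    · rw [norm_exp_mul_ofReal]
      exact Real.exp_le_exp.2 (mul_le_mul_of_nonneg_right hre hy.le)
  refine ⟨?_, ?_, ?_⟩
  · exact (hmajx (‖k‖ + 1)).mono' (hmeasx k hk) ((ae_restrict_iff' measurableSet_Ioi).2
      (Eventually.of_forall fun x hx => hdomx k k (by linarith) hk x hx))
  · exact (hmajy _).mono' ((h.continuousOn_left_mul k _ _).aestronglyMeasurable measurableSet_Ioi)
      ((ae_restrict_iff' measurableSet_Ioi).2
        (Eventually.of_forall fun y hy => hdomy k k (by linarith) hk (le_max_left _ _) y hy))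
  · let Ω : Set ℂ := Iic κ ×ℂ Ici 0
    let D : Set ℂ := Iio κ ×ℂ Ioi 0
    have hD : IsOpen D := isOpen_Iio.reProdIm isOpen_Ioi
    have hDc : IsPreconnected D :=
      (convex_reProdIm (convex_Iio κ) (convex_Ioi 0)).isPreconnected
    have hDΩ : D ⊆ Ω := fun z hz =>
      ⟨(show z.re < κ from hz.1).le, (show 0 < z.im from hz.2).le⟩
    have hkΩ : k ∈ Ω := ⟨show k.re ≤ κ from le_max_left _ _, hk⟩
    have hDU : D ⊆ upperOpen := fun z hz => hz.2
    have hΩU : Ω ⊆ upperClosed := fun z hz => hz.2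
    have hG1 : HolCont D Ω (fun z => ∫ x in Ioi (0 : ℝ),
        (z * q x 0 - partialY q x 0) * psi u z x) := by
      refine HolCont.integral hD hDΩ (fun z hz => hmeasx z hz.2) ?_ fun k₀ hk₀ => ?_
      · refine (ae_restrict_iff' measurableSet_Ioi).2
          (Eventually.of_forall fun x (hx : 0 < x) => ?_)
        exact (HolCont.of_differentiable (by fun_prop)).mul
          (((jointHol_psi hu).holCont hx.le).mono hDU hΩU)
      · exact ⟨_, hmajx (‖k₀‖ + 1), _, inter_mem (eventually_norm_le Ω k₀) self_mem_nhdsWithin,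
          (ae_restrict_iff' measurableSet_Ioi).2 (Eventually.of_forall fun x (hx : 0 < x) z hz =>
            hdomx k₀ z (le_of_lt hz.1) hz.2.2 x hx)⟩
    have hG2 : HolCont D Ω (fun z => ∫ y in Ioi (0 : ℝ), Complex.exp (z * y) *
        (q 0 y * psiX0 u z - partialX q 0 y * psi u z 0)) := by
      refine HolCont.integral hD hDΩ (fun z _ =>
        (h.continuousOn_left_mul z _ _).aestronglyMeasurable measurableSet_Ioi) ?_ fun k₀ hk₀ => ?_
      · refine Eventually.of_forall fun y => (HolCont.of_differentiable (by fun_prop)).mul ?_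
        exact ((HolCont.of_differentiable (differentiable_const _)).mul
          ((holCont_psiX0 hu).mono hDU hΩU)).sub
          ((HolCont.of_differentiable (differentiable_const _)).mul
            (((jointHol_psi hu).holCont le_rfl).mono hDU hΩU))
      · exact ⟨_, hmajy _, _, inter_mem (eventually_norm_le Ω k₀) self_mem_nhdsWithin,
          (ae_restrict_iff' measurableSet_Ioi).2 (Eventually.of_forall fun y (hy : 0 < y) z hz =>
            hdomy k₀ z (le_of_lt hz.1) hz.2.2 hz.2.1 y hy)⟩
    have hz₀ : (-1 + Complex.I : ℂ) ∈ D := by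
      simp only [D, Complex.mem_reProdIm, mem_Iio, mem_Ioi]
      simp
      linarith
    refine (hG1.add hG2).eq_zero_of_frequently hD hDc hDΩ hz₀ ?_ hkΩ ?_
    · refine Eventually.frequently (Eventually.filter_mono nhdsWithin_le_nhds ?_)
      have hopen : IsOpen (Iio (0 : ℝ) ×ℂ Ioi (0 : ℝ)) := isOpen_Iio.reProdIm isOpen_Ioi
      filter_upwards [hopen.mem_nhds (show (-1 + Complex.I : ℂ) ∈ Iio (0 : ℝ) ×ℂ Ioi (0 : ℝ) by
        simp [Complex.mem_reProdIm])] with z hz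
      exact hleft z (le_of_lt hz.2) (le_of_lt hz.1)
    · rw [Complex.closure_reProdIm, closure_Iio, closure_Ioi]
      exact hkΩ

end IsDecayingSol

end QuarterPlane

/-! ### The sine transform in y, its inversion, and the Dirichlet resolvent in x. -/

namespace QuarterPlane

open Filter Topology

variable {u : ℝ → ℝ} {q : ℝ → ℝ → ℝ} {C p : ℝ}

/-- The half-line sine transform. -/
noncomputable def sineTransform (g : ℝ → ℝ) (l : ℝ) : ℝ :=
  ∫ y in Ioi (0 : ℝ), Real.sin (l * y) * g y

theorem norm_sineTransform_integrand_le (g : ℝ → ℝ) (l y : ℝ) :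
    ‖Real.sin (l * y) * g y‖ ≤ ‖g y‖ := by
  rw [norm_mul]
  exact mul_le_of_le_one_left (norm_nonneg _) (Real.abs_sin_le_one _)

theorem integrableOn_sin_mul {g : ℝ → ℝ} (hg : IntegrableOn g (Ioi 0)) (l : ℝ) :
    IntegrableOn (fun y => Real.sin (l * y) * g y) (Ioi 0) :=
  hg.norm.mono' ((Continuous.aestronglyMeasurable (by fun_prop)).mul hg.aestronglyMeasurable)
    (Eventually.of_forall fun y => norm_sineTransform_integrand_le g l y)

theorem continuous_sineTransform {g : ℝ → ℝ} (hg : IntegrableOn g (Ioi 0)) :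
    Continuous (sineTransform g) :=
  continuous_of_dominated (fun l => (integrableOn_sin_mul hg l).aestronglyMeasurable)
    (fun l => Eventually.of_forall fun y => norm_sineTransform_integrand_le g l y) hg.norm
    (Eventually.of_forall fun y => by fun_prop)

theorem abs_sineTransform_le {g : ℝ → ℝ} (hg : IntegrableOn g (Ioi 0)) (l : ℝ) :
    |sineTransform g l| ≤ ∫ y in Ioi (0 : ℝ), ‖g y‖ :=
  norm_integral_le_of_norm_le hg.norm
    (Eventually.of_forall fun y => norm_sineTransform_integrand_le g l y)

/-- The damping e^{-εl} makes the double integral absolutely convergent, so Fubini applies. -/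
theorem integral_exp_mul_sineTransform {g : ℝ → ℝ} (hg : IntegrableOn g (Ioi 0)) {ε : ℝ}
    (hε : 0 < ε) (y : ℝ) :
    ∫ l in Ioi (0 : ℝ), Real.exp (-(ε * l)) * Real.sin (l * y) * sineTransform g l
      = ∫ η in Ioi (0 : ℝ), (ε / (ε ^ 2 + (y - η) ^ 2) - ε / (ε ^ 2 + (-y - η) ^ 2)) / 2 * g η := by
  have hint : Integrable (fun z : ℝ × ℝ => Real.exp (-(ε * z.1)) * Real.sin (z.1 * y) *
      (Real.sin (z.1 * z.2) * g z.2))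
      ((volume.restrict (Ioi (0 : ℝ))).prod (volume.restrict (Ioi (0 : ℝ)))) := by
    have h1 : Integrable (fun z : ℝ × ℝ => Real.exp (-(ε * z.1)) * g z.2)
        ((volume.restrict (Ioi (0 : ℝ))).prod (volume.restrict (Ioi (0 : ℝ)))) :=
      (integrableOn_exp_neg_mul hε).mul_prod hg
    have h2 : Continuous fun z : ℝ × ℝ => Real.sin (z.1 * y) * Real.sin (z.1 * z.2) := by
      fun_prop
    refine (h1.bdd_mul (c := 1) h2.aestronglyMeasurable
      (Eventually.of_forall fun z => ?_)).congr (Eventually.of_forall fun z => ?_)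
    · rw [norm_mul]
      exact mul_le_one₀ (Real.abs_sin_le_one _) (norm_nonneg _) (Real.abs_sin_le_one _)
    · ring
  simp only [sineTransform, ← integral_const_mul]
  rw [integral_integral_swap hint]
  congr 1 with η
  rw [← integral_exp_neg_mul_sin_mul_sin hε, ← integral_mul_const]
  congr 1 with l
  ring

/-- Of the two Poisson kernels, the one centred at y recovers π g(y), while the one centred at -y
sees only the extension of g by zero and tends to 0. Abel summation is used because no integrability
of the transform is available. -/
theorem tendsto_sine_inversion {g : ℝ → ℝ} (hc : Continuous g) (hg : IntegrableOn g (Ioi 0))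
    {M : ℝ} (hM : ∀ y, |g y| ≤ M) {y : ℝ} (hy : 0 < y) :
    Tendsto (fun ε : ℝ => ∫ l in Ioi (0 : ℝ),
      Real.exp (-(ε * l)) * Real.sin (l * y) * sineTransform g l) (𝓝[>] 0)
      (𝓝 (Real.pi / 2 * g y)) := by
  let G : ℝ → ℝ := (Ioi 0).indicator g
  have hGm : Measurable G := hc.measurable.indicator measurableSet_Ioi
  have hGb : ∀ η, |G η| ≤ M := fun η => by
    by_cases hη : η ∈ Ioi (0 : ℝ)
    · simpa [G, hη] using hM η
    · simpa [G, hη] using (abs_nonneg _).trans (hM 0)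
  have hGi : Integrable G := (integrable_indicator_iff measurableSet_Ioi).2 hg
  have hGy : G =ᶠ[𝓝 y] g := by
    filter_upwards [Ioi_mem_nhds hy] with η hη using indicator_of_mem hη g
  have hGy' : G =ᶠ[𝓝 (-y)] fun _ => 0 := by
    filter_upwards [Iio_mem_nhds (neg_lt_zero.2 hy)] with η hη
      using indicator_of_notMem (not_lt.2 (le_of_lt hη)) g
  have h1 := tendsto_poisson hGm hGb (hc.continuousAt.congr hGy.symm)
  have h2 := tendsto_poisson hGm hGb (continuousAt_const.congr hGy'.symm)
  rw [hGy.eq_of_nhds] at h1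
  rw [hGy'.eq_of_nhds] at h2
  have h3 := (h1.sub h2).div_const 2
  have e : (Real.pi * g y - Real.pi * 0) / 2 = Real.pi / 2 * g y := by ring
  rw [e] at h3
  refine h3.congr' ?_
  filter_upwards [self_mem_nhdsWithin] with ε hε
  have hε : 0 < ε := hε
  have hP : ∀ z : ℝ, Integrable fun η => ε / (ε ^ 2 + (z - η) ^ 2) * G η := fun z => by
    refine hGi.bdd_mul (c := ε / ε ^ 2) (Continuous.aestronglyMeasurable ?_)
      (Eventually.of_forall fun η => ?_)
    · have : ∀ η : ℝ, ε ^ 2 + (z - η) ^ 2 ≠ 0 := fun η => by positivity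
      fun_prop (disch := exact this _)
    · rw [Real.norm_of_nonneg (by positivity)]
      gcongr
      exact le_add_of_nonneg_right (sq_nonneg _)
  rw [integral_exp_mul_sineTransform hg hε, ← integral_sub (hP _) (hP _), ← integral_div,
    ← integral_indicator measurableSet_Ioi]
  congr 1 with η
  by_cases hη : η ∈ Ioi (0 : ℝ)
  · simp only [G, hη, indicator_of_mem]
    ring
  · simp [G, hη]

/-- The kernel `s(ξ_<, k) ψ(ξ_>, k)` of the Dirichlet Green function, up to `ψ(0, k)`. -/
noncomputable def greenKernel (u : ℝ → ℝ) (x : ℝ) (k : ℂ) (ξ : ℝ) : ℂ :=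
  regSol u k (min ξ x) * psi u k (max ξ x)

/-- The Dirichlet resolvent applied to the boundary values `q(·, 0)`. -/
noncomputable def forcedPart (u : ℝ → ℝ) (q : ℝ → ℝ → ℝ) (x : ℝ) (k : ℂ) : ℂ :=
  (∫ ξ in Ioi (0 : ℝ), greenKernel u x k ξ * (q ξ 0 : ℂ)) / psi u k 0

/-- The quotient `ψ(x, k) / ψ(0, k)`. -/
noncomputable def jostRatio (u : ℝ → ℝ) (x : ℝ) (k : ℂ) : ℂ := psi u k x / psi u k 0

/-- The growth of the regular solution up to min(ξ, x) is compensated by the decay of ψ at max(ξ,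
x), leaving a linear factor uniform in k. -/
theorem norm_greenKernel_le (hu : Admissible u) {k : ℂ} (hk : 0 ≤ k.im) {x ξ : ℝ} (hx : 0 ≤ x)
    (hξ : 0 ≤ ξ) : ‖greenKernel u x k ξ‖
      ≤ 2 * Real.exp (2 * totWeight u) * jostBound u * (1 + ξ) := by
  have h1 := norm_regSol_le hu (le_min hξ hx) k
  have h2 := norm_psi_le hu (hξ.trans (le_max_left ξ x)) hk
  rw [abs_of_nonneg hk] at h1
  have hJ := jostBound_pos u
  have hm : (0 : ℝ) ≤ min ξ x := le_min hξ hx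
  have he : Real.exp (k.im * min ξ x) * Real.exp (-(k.im * max ξ x)) ≤ 1 := by
    rw [← Real.exp_add, Real.exp_le_one_iff]
    have : k.im * min ξ x ≤ k.im * max ξ x := mul_le_mul_of_nonneg_left min_le_max hk
    linarith
  rw [greenKernel, norm_mul]
  calc _ ≤ 2 * Real.exp (2 * totWeight u) * ((1 + min ξ x) * Real.exp (k.im * min ξ x)) *
        (jostBound u * Real.exp (-(k.im * max ξ x))) :=
        mul_le_mul h1 h2 (norm_nonneg _) (by positivity)
    _ = 2 * Real.exp (2 * totWeight u) * jostBound u * (1 + min ξ x) *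
        (Real.exp (k.im * min ξ x) * Real.exp (-(k.im * max ξ x))) := by ring
    _ ≤ 2 * Real.exp (2 * totWeight u) * jostBound u * (1 + min ξ x) :=
        mul_le_of_le_one_right (by positivity) he
    _ ≤ _ := by
        gcongr
        exact min_le_left _ _

theorem continuousOn_greenKernel (hu : Admissible u) {k : ℂ} (hk : 0 ≤ k.im) {x : ℝ}
    (hx : 0 ≤ x) : ContinuousOn (greenKernel u x k) (Ici 0) :=
  ((isSol_regSol hu k).continuousOn.comp (f := fun ξ => min ξ x) (by fun_prop)
    fun ξ (hξ : 0 ≤ ξ) => le_min hξ hx).mul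
    ((isSol_psi hu hk).continuousOn.comp (f := fun ξ => max ξ x) (by fun_prop)
    fun ξ (hξ : 0 ≤ ξ) => hξ.trans (le_max_left ξ x))

theorem greenKernel_neg_conj (hu : Admissible u) {k : ℂ} (hk : 0 ≤ k.im) {x ξ : ℝ} (hx : 0 ≤ x)
    (hξ : 0 ≤ ξ) :
    greenKernel u x (-(starRingEnd ℂ) k) ξ = (starRingEnd ℂ) (greenKernel u x k ξ) := by
  rw [greenKernel, greenKernel, map_mul, psi_neg_conj hu hk (hξ.trans (le_max_left ξ x)),
    regSol_neg, regSol_conj hu k (le_min hξ hx)]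

theorem forcedPart_neg_conj (hu : Admissible u) {k : ℂ} (hk : 0 ≤ k.im) {x : ℝ} (hx : 0 ≤ x) :
    forcedPart u q x (-(starRingEnd ℂ) k) = (starRingEnd ℂ) (forcedPart u q x k) := by
  rw [forcedPart, forcedPart, map_div₀, psi_neg_conj hu hk le_rfl, ← integral_conj]
  congr 1
  refine setIntegral_congr_fun measurableSet_Ioi fun ξ (hξ : 0 < ξ) => ?_
  simp only [map_mul, Complex.conj_ofReal, greenKernel_neg_conj hu hk hx hξ.le]

theorem jostRatio_neg_conj (hu : Admissible u) {k : ℂ} (hk : 0 ≤ k.im) {x : ℝ} (hx : 0 ≤ x) :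
    jostRatio u x (-(starRingEnd ℂ) k) = (starRingEnd ℂ) (jostRatio u x k) := by
  rw [jostRatio, jostRatio, map_div₀, psi_neg_conj hu hk le_rfl, psi_neg_conj hu hk hx]

theorem neg_conj_I_mul (l : ℝ) : -(starRingEnd ℂ) (Complex.I * l) = Complex.I * l := by
  simp

theorem forcedPart_I_mul_im (hu : Admissible u) {l : ℝ} (hl : 0 ≤ l) {x : ℝ} (hx : 0 ≤ x) :
    (forcedPart u q x (Complex.I * l)).im = 0 := by
  rw [← Complex.conj_eq_iff_im, ← forcedPart_neg_conj hu (by simpa using hl) hx, neg_conj_I_mul]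

theorem conj_jostRatio_I_mul (hu : Admissible u) {l : ℝ} (hl : 0 ≤ l) {x : ℝ} (hx : 0 ≤ x) :
    (starRingEnd ℂ) (jostRatio u x (Complex.I * l)) = jostRatio u x (Complex.I * l) := by
  rw [← jostRatio_neg_conj hu (by simpa using hl) hx, neg_conj_I_mul]

theorem holCont_jostRatio (hu : Admissible u) (h0 : ∀ k : ℂ, 0 ≤ k.im → psi u k 0 ≠ 0) {x : ℝ}
    (hx : 0 ≤ x) : HolCont upperOpen upperClosed (jostRatio u x) :=
  ((jointHol_psi hu).holCont hx).div ((jointHol_psi hu).holCont le_rfl) upperOpen_subset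
    fun k hk => h0 k hk

theorem norm_jostRatio_le (hu : Admissible u) {c : ℝ} (hc : ∀ k : ℂ, 0 ≤ k.im →
    ‖(psi u k 0)⁻¹‖ ≤ c) {x : ℝ} (hx : 0 ≤ x) {k : ℂ} (hk : 0 ≤ k.im) :
    ‖jostRatio u x k‖ ≤ jostBound u * c * Real.exp (-(k.im * x)) := by
  have hJ := jostBound_pos u
  rw [jostRatio, div_eq_mul_inv, norm_mul]
  calc _ ≤ jostBound u * Real.exp (-(k.im * x)) * c :=
        mul_le_mul (norm_psi_le hu hx hk) (hc k hk) (norm_nonneg _) (by positivity)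
    _ = _ := by ring

namespace IsDecayingSol

theorem integrableOn_left (h : IsDecayingSol u q C p) {x : ℝ} (hx : 0 ≤ x) :
    IntegrableOn (q x) (Ioi 0) := by
  have := (h.integrableOn_mul_y hx (v := fun _ => 1) continuousOn_const
    (fun _ _ => norm_one.le) h.continuousOn h.bound).1.re
  exact IntegrableOn.congr_fun this (fun y _ => by simp) measurableSet_Ioi

theorem abs_le (h : IsDecayingSol u q C p) {x y : ℝ} (hx : 0 ≤ x) (hy : 0 ≤ y) :
    |q x y| ≤ C :=
  (h.bound x y hx hy).trans (mul_le_of_le_one_right h.const_nonneg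
    (Real.rpow_le_one_of_one_le_of_nonpos (by linarith) (by linarith [h.two_lt])))

theorem integrableOn_greenKernel (hu : Admissible u) (h : IsDecayingSol u q C p) {x : ℝ}
    (hx : 0 ≤ x) {k : ℂ} (hk : 0 ≤ k.im) :
    IntegrableOn (fun ξ => greenKernel u x k ξ * (q ξ 0 : ℂ)) (Ioi 0) :=
  h.integrableOn_mul_x le_rfl (continuousOn_greenKernel hu hk hx)
    (fun _ hξ => norm_greenKernel_le hu hk hx hξ) h.continuousOn h.bound

theorem integrableOn_weight_bottom (h : IsDecayingSol u q C p) (L : ℝ) :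
    IntegrableOn (fun ξ : ℝ => L * (1 + ξ) * ‖(q ξ 0 : ℂ)‖) (Ioi 0) := by
  have := (h.integrableOn_mul_x le_rfl (w := fun ξ : ℝ => (1 + ξ : ℝ)) (L := 1)
    (Continuous.continuousOn (by fun_prop)) (fun ξ hξ => by
      rw [Complex.norm_real, Real.norm_of_nonneg (by linarith), one_mul])
    h.continuousOn h.bound).norm.const_mul L
  refine IntegrableOn.congr_fun this (fun ξ (hξ : 0 < ξ) => ?_) measurableSet_Ioi
  simp only [norm_mul]
  rw [Complex.norm_real (1 + ξ), Real.norm_of_nonneg (by linarith)]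
  ring

theorem holCont_forcedPart (hu : Admissible u) (h : IsDecayingSol u q C p)
    (h0 : ∀ k : ℂ, 0 ≤ k.im → psi u k 0 ≠ 0) {x : ℝ} (hx : 0 ≤ x) :
    HolCont upperOpen upperClosed (forcedPart u q x) := by
  refine HolCont.div ?_ ((jointHol_psi hu).holCont le_rfl) upperOpen_subset fun k hk => h0 k hk
  refine HolCont.integral isOpen_upperOpen upperOpen_subset
    (fun k hk => (h.integrableOn_greenKernel hu hx hk).aestronglyMeasurable) ?_ fun k₀ _ => ?_
  · refine (ae_restrict_iff' measurableSet_Ioi).2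
      (Eventually.of_forall fun ξ (hξ : 0 < ξ) => ?_)
    exact ((((jointHol_regSol hu).holCont (le_min hξ.le hx)).mono (subset_univ _)
      (subset_univ _)).mul ((jointHol_psi hu).holCont (hξ.le.trans (le_max_left ξ x)))).mul
      (HolCont.of_differentiable (differentiable_const _))
  · refine ⟨_, h.integrableOn_weight_bottom (2 * Real.exp (2 * totWeight u) * jostBound u), _,
      self_mem_nhdsWithin, (ae_restrict_iff' measurableSet_Ioi).2
      (Eventually.of_forall fun ξ (hξ : 0 < ξ) k hk => ?_)⟩
    rw [norm_mul]
    exact mul_le_mul_of_nonneg_right (norm_greenKernel_le hu hk hx hξ.le) (norm_nonneg _)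

theorem exists_norm_forcedPart_le (hu : Admissible u) (h : IsDecayingSol u q C p) {c : ℝ}
    (hc : ∀ k : ℂ, 0 ≤ k.im → ‖(psi u k 0)⁻¹‖ ≤ c) {x : ℝ} (hx : 0 ≤ x) :
    ∃ K : ℝ, ∀ k : ℂ, 0 ≤ k.im → ‖forcedPart u q x k‖ ≤ K := by
  refine ⟨(∫ ξ in Ioi (0 : ℝ), 2 * Real.exp (2 * totWeight u) * jostBound u * (1 + ξ) *
    ‖(q ξ 0 : ℂ)‖) * c, fun k hk => ?_⟩
  rw [forcedPart, div_eq_mul_inv, norm_mul]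
  have hle := norm_integral_le_of_norm_le (f := fun ξ => greenKernel u x k ξ * (q ξ 0 : ℂ))
    (h.integrableOn_weight_bottom (2 * Real.exp (2 * totWeight u) * jostBound u))
    ((ae_restrict_iff' measurableSet_Ioi).2 (Eventually.of_forall fun ξ (hξ : 0 < ξ) => by
      rw [norm_mul]
      exact mul_le_mul_of_nonneg_right (norm_greenKernel_le hu hk hx hξ.le) (norm_nonneg _)))
  exact mul_le_mul hle (hc k hk) (norm_nonneg _) ((norm_nonneg _).trans hle)

theorem integral_flux (h : IsDecayingSol u q C p) {x L : ℝ} (hx : 0 ≤ x) {v : ℝ → ℂ}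
    (hv : ContinuousOn v (Ioi 0)) (hL : ∀ y, 0 < y → ‖v y‖ ≤ L) (c d : ℂ) :
    ∫ y in Ioi (0 : ℝ), v y * (partialX q x y * c - q x y * d)
      = (∫ y in Ioi (0 : ℝ), v y * (partialX q x y : ℂ)) * c
        - (∫ y in Ioi (0 : ℝ), v y * (q x y : ℂ)) * d := by
  rw [← integral_mul_const, ← integral_mul_const, ← integral_sub
    ((h.integrableOn_mul_y hx hv hL h.continuousOnX h.boundX).1.mul_const c)
    ((h.integrableOn_mul_y hx hv hL h.continuousOn h.bound).1.mul_const d)]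
  congr 1 with y
  ring

/-- Green's identity with the regular solution on [0, x] and with ψ on [x, ∞) gives two relations
containing the sine transforms of q and q_x at x. Their combination eliminates q_x, and the
Wronskian ψ(0,k) of the two solutions becomes the coefficient of the transform of q. -/
theorem sineTransform_eq (hu : Admissible u) (h : IsDecayingSol u q C p) {l : ℝ} (hl : 0 ≤ l)
    {x : ℝ} (hx : 0 ≤ x) (h0 : psi u (Complex.I * l) 0 ≠ 0) :
    (sineTransform (q x) l : ℂ) = jostRatio u x (Complex.I * l) * sineTransform (q 0) l
      + l * forcedPart u q x (Complex.I * l) := by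
  set k : ℂ := Complex.I * l with hk
  have him : 0 ≤ k.im := by simpa [hk] using hl
  -- This is sin(ly), with v(0) = 0 and v'(0) = l; with k = il it satisfies v'' = k²v, and v(0) = 0
  -- removes q_y(·,0).
  let v : ℝ → ℂ := fun y => l * sinKernel l y
  let v' : ℝ → ℂ := fun y => l * Complex.cos (l * y)
  have hsin : ∀ y : ℝ, v y = (Real.sin (l * y) : ℝ) := fun y => by
    simp only [v, mul_sinKernel]
    push_cast
    rfl
  have hcos : ∀ y : ℝ, v' y = ((l * Real.cos (l * y) : ℝ) : ℂ) := fun y => by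
    simp only [v']
    push_cast
    rfl
  have hv : IsExpSol k v v' := ⟨fun y => (hasDerivAt_sinKernel l y).const_mul _, fun y => by
    refine ((hasDerivAt_cos_mul l y).const_mul (l : ℂ)).congr_deriv ?_
    simp only [v, hk]
    linear_combination -(l : ℂ) ^ 3 * sinKernel l y * Complex.I_sq⟩
  have hL : ∀ y : ℝ, ‖v y‖ ≤ 1 + l := fun y => by
    rw [hsin, Complex.norm_real]
    exact (Real.abs_sin_le_one _).trans (by linarith)
  have hL' : ∀ y : ℝ, ‖v' y‖ ≤ 1 + l := fun y => by
    rw [hcos, Complex.norm_real, norm_mul, Real.norm_of_nonneg hl]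
    have := mul_le_mul_of_nonneg_left (Real.abs_cos_le_one (l * y)) hl
    rw [Real.norm_eq_abs]
    linarith
  have hv0 : v 0 = 0 := by simp [hsin]
  have hv'0 : v' 0 = l := by simp [v']
  obtain ⟨M, hM, hM'⟩ := exists_norm_psi_le_linear hu him
  have hpsi := isSol_psi hu him
  have hreg := isSol_regSol hu k
  have g1 := (h.green_half hpsi hv (fun y _ => hL y) (fun y _ => hL' y) hM hM' hx).2
  have g2 := h.green_strip hreg hv (fun y _ => hL y) (fun y _ => hL' y) le_rfl hx
  rw [h.integral_flux hx hv.continuous.continuousOn (fun y _ => hL y)] at g1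
  rw [h.integral_flux hx hv.continuous.continuousOn (fun y _ => hL y),
    h.integral_flux le_rfl hv.continuous.continuousOn (fun y _ => hL y), regSol_zero hu,
    regSolD_zero] at g2
  have hS : ∀ x : ℝ, ∫ y in Ioi (0 : ℝ), v y * (q x y : ℂ) = (sineTransform (q x) l : ℂ) := by
    intro x
    rw [sineTransform, ← integral_complex_ofReal]
    congr 1 with y
    rw [hsin]
    push_cast
    rfl
  simp only [hS] at g1 g2
  have hW := hpsi.wronskian hreg rfl hx
  rw [regSol_zero hu, regSolD_zero] at hW
  have hG := h.integrableOn_greenKernel hu hx him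
  have hsplit : ∫ ξ in Ioi (0 : ℝ), greenKernel u x k ξ * (q ξ 0 : ℂ)
      = (∫ ξ in (0 : ℝ)..x, greenKernel u x k ξ * (q ξ 0 : ℂ))
        + ∫ ξ in Ioi x, greenKernel u x k ξ * (q ξ 0 : ℂ) := by
    rw [intervalIntegral.integral_of_le hx, ← setIntegral_union
      (Ioc_disjoint_Ioi le_rfl) measurableSet_Ioi (hG.mono_set Ioc_subset_Ioi_self)
      (hG.mono_set (Ioi_subset_Ioi hx)), Ioc_union_Ioi_eq_Ioi hx]
  have hin : (l : ℂ) * ∫ ξ in (0 : ℝ)..x, greenKernel u x k ξ * (q ξ 0 : ℂ)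
      = psi u k x * ∫ ξ in (0 : ℝ)..x, regSol u k ξ * (q ξ 0 * v' 0 - partialY q ξ 0 * v 0) := by
    rw [← intervalIntegral.integral_const_mul, ← intervalIntegral.integral_const_mul]
    refine intervalIntegral.integral_congr fun ξ hξ => ?_
    rw [uIcc_of_le hx] at hξ
    simp only [greenKernel, min_eq_left hξ.2, max_eq_right hξ.2, hv0, hv'0]
    ring
  have hout : (l : ℂ) * ∫ ξ in Ioi x, greenKernel u x k ξ * (q ξ 0 : ℂ)
      = regSol u k x * ∫ ξ in Ioi x, psi u k ξ * (q ξ 0 * v' 0 - partialY q ξ 0 * v 0) := by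
    rw [← integral_const_mul, ← integral_const_mul]
    refine setIntegral_congr_fun measurableSet_Ioi fun ξ (hξ : x < ξ) => ?_
    simp only [greenKernel, min_eq_right hξ.le, max_eq_left hξ.le, hv0, hv'0]
    ring
  rw [jostRatio, forcedPart, hsplit]
  rw [g2] at hin
  rw [g1] at hout
  field_simp
  linear_combination -hin - hout - (sineTransform (q x) l : ℂ) * hW

end IsDecayingSol

end QuarterPlane

/-! ### The sine inversion moved to the real axis, and the identification of ρ. -/

namespace QuarterPlane

open Filter Topology

variable {u : ℝ → ℝ} {q : ℝ → ℝ → ℝ} {C p : ℝ}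

/-- The spectral density `e^{-ky} k H(k)` of the forced part, damped by `e^{iεk}`. -/
noncomputable def dampedForced (u : ℝ → ℝ) (q : ℝ → ℝ → ℝ) (x y ε : ℝ) (k : ℂ) : ℂ :=
  Complex.exp ((Complex.I * ε - y) * k) * (k * forcedPart u q x k)

theorem norm_exp_damped (y ε : ℝ) (k : ℂ) :
    ‖Complex.exp ((Complex.I * ε - y) * k)‖ = Real.exp (-(ε * k.im) - y * k.re) := by
  rw [Complex.norm_exp]
  congr 1
  simp [Complex.mul_re, Complex.mul_im]
  ring

/-- Half of the decay in each direction pays for the factor k in `dampedForced`; the other half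
remains for the rotation. -/
theorem norm_le_mul_exp {y ε : ℝ} (hy : 0 < y) (hε : 0 < ε) {k : ℂ} (hre : 0 ≤ k.re)
    (him : 0 ≤ k.im) :
    ‖k‖ ≤ (2 / y + 2 / ε) * (Real.exp (y / 2 * k.re) * Real.exp (ε / 2 * k.im)) := by
  have hlin : ∀ a r : ℝ, 0 < a → r ≤ 2 / a * Real.exp (a / 2 * r) := fun a r ha => by
    have h1 : a / 2 * r ≤ Real.exp (a / 2 * r) := by linarith [Real.add_one_le_exp (a / 2 * r)]
    calc r = 2 / a * (a / 2 * r) := by field_simp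
      _ ≤ _ := mul_le_mul_of_nonneg_left h1 (by positivity)
  have e1 : 1 ≤ Real.exp (y / 2 * k.re) := Real.one_le_exp (by positivity)
  have e2 : 1 ≤ Real.exp (ε / 2 * k.im) := Real.one_le_exp (by positivity)
  have hk := Complex.norm_le_abs_re_add_abs_im k
  rw [abs_of_nonneg hre, abs_of_nonneg him] at hk
  have h1 : k.re ≤ 2 / y * (Real.exp (y / 2 * k.re) * Real.exp (ε / 2 * k.im)) :=
    (hlin y _ hy).trans (mul_le_mul_of_nonneg_left
      (le_mul_of_one_le_right (Real.exp_pos _).le e2) (by positivity))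
  have h2 : k.im ≤ 2 / ε * (Real.exp (y / 2 * k.re) * Real.exp (ε / 2 * k.im)) :=
    (hlin ε _ hε).trans (mul_le_mul_of_nonneg_left
      (le_mul_of_one_le_left (Real.exp_pos _).le e1) (by positivity))
  linarith [add_mul (2 / y) (2 / ε) (Real.exp (y / 2 * k.re) * Real.exp (ε / 2 * k.im))]

/-- In x, the left side solves the same equation, vanishes at 0 and has slope 2ik there by the
Wronskian of ψ(·,k) and ψ(·,-k); so it is that multiple of the regular solution. -/
theorem psi_mul_conj_sub (hu : Admissible u) (k : ℝ) {x : ℝ} (hx : 0 ≤ x) :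
    psi u k x * (starRingEnd ℂ) (psi u k 0) - (starRingEnd ℂ) (psi u k x) * psi u k 0
      = 2 * Complex.I * k * regSol u k x := by
  have hk : 0 ≤ (k : ℂ).im := by simp
  have hk' : 0 ≤ (-(k : ℂ)).im := by simp
  have hc : -(starRingEnd ℂ) (k : ℂ) = -k := by simp
  rw [← psi_neg_conj hu hk hx, ← psi_neg_conj hu hk le_rfl, hc]
  have w1 := (isSol_psi hu hk).wronskian (isSol_regSol hu k) rfl hx
  have w2 := (isSol_psi hu hk').wronskian (isSol_regSol hu k) (neg_sq _) hx
  have w3 := psi_wronskian_real hu (k := k) (by simp) hx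
  rw [regSol_zero hu, regSolD_zero] at w1 w2
  linear_combination psi u (-k) x * w1 - psi u k x * w2 - regSol u k x * w3

/-- As φ(0,k) = 1, the left side vanishes at x = 0, and its slope there is the Wronskian 2ik a(k) of
φ and ψ. -/
theorem psi_sub_mul_phi (hu : Admissible u) {k : ℂ} (hk : 0 ≤ k.im) (hk0 : k ≠ 0) {x : ℝ}
    (hx : 0 ≤ x) :
    psi u k x - psi u k 0 * phi u k x = 2 * Complex.I * k * jostA u k * regSol u k x := by
  have w1 := (isSol_phi hu k).wronskian (isSol_regSol hu k) rfl hx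
  have w2 := (isSol_psi hu hk).wronskian (isSol_regSol hu k) rfl hx
  have w3 := (isSol_phi hu k).wronskian (isSol_psi hu hk) rfl hx
  rw [regSol_zero hu, regSolD_zero, phi_zero hu] at w1
  rw [regSol_zero hu, regSolD_zero] at w2
  have hA : 2 * Complex.I * k * jostA u k = phi u k 0 * psiD u k 0 - phiD u k 0 * psi u k 0 := by
    rw [jostA, psiX0_eq hu hk, phiX0, (isSol_phi hu k).derivWithin_zero]
    have := Complex.I_ne_zero
    field_simp
  rw [hA, ← w3]
  linear_combination -psi u k x * w1 + phi u k x * w2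

theorem conj_regSol_ofReal (hu : Admissible u) (k : ℝ) {x : ℝ} (hx : 0 ≤ x) :
    (starRingEnd ℂ) (regSol u k x) = regSol u k x := by
  rw [← regSol_conj hu k hx, Complex.conj_ofReal]

/-- The regular solution is real for real k, so the conjugate changes only ψ, and `psi_mul_conj_sub`
replaces the difference by another regular solution. The product at min(ξ, x) and max(ξ, x) is
symmetric, so the dependence on x and ξ factorises. -/
theorem forcedPart_sub_conj (hu : Admissible u) (h : IsDecayingSol u q C p) {k : ℝ}
    (h0 : psi u k 0 ≠ 0) {x : ℝ} (hx : 0 ≤ x) :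
    forcedPart u q x k - (starRingEnd ℂ) (forcedPart u q x k)
      = 2 * Complex.I * k * regSol u k x * (∫ ξ in Ioi (0 : ℝ), (q ξ 0 : ℂ) * regSol u k ξ) /
        (psi u k 0 * (starRingEnd ℂ) (psi u k 0)) := by
  have h0' : (starRingEnd ℂ) (psi u k 0) ≠ 0 := (map_ne_zero _).2 h0
  have hG := h.integrableOn_greenKernel hu hx (k := k) (by simp)
  have hG' : IntegrableOn (fun ξ => (starRingEnd ℂ) (greenKernel u x k ξ * (q ξ 0 : ℂ)))
      (Ioi 0) := Complex.conjCLE.toContinuousLinearMap.integrable_comp hG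
  have hS : (∫ ξ in Ioi (0 : ℝ), greenKernel u x k ξ * (q ξ 0 : ℂ)) *
      (starRingEnd ℂ) (psi u k 0)
      - (∫ ξ in Ioi (0 : ℝ), (starRingEnd ℂ) (greenKernel u x k ξ * (q ξ 0 : ℂ))) * psi u k 0
      = 2 * Complex.I * k * regSol u k x * ∫ ξ in Ioi (0 : ℝ), (q ξ 0 : ℂ) * regSol u k ξ := by
    rw [← integral_mul_const, ← integral_mul_const, ← integral_const_mul,
      ← integral_sub (hG.mul_const _) (hG'.mul_const _)]
    refine setIntegral_congr_fun measurableSet_Ioi fun ξ (hξ : 0 < ξ) => ?_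
    have h1 := psi_mul_conj_sub hu k (hξ.le.trans (le_max_left ξ x))
    have h2 := conj_regSol_ofReal hu k (le_min hξ.le hx)
    have h3 : regSol u k (min ξ x) * regSol u k (max ξ x) = regSol u k ξ * regSol u k x := by
      rcases le_total ξ x with hle | hle
      · rw [min_eq_left hle, max_eq_right hle]
      · rw [min_eq_right hle, max_eq_left hle, mul_comm]
    simp only [greenKernel, map_mul, Complex.conj_ofReal, h2]
    linear_combination (regSol u k (min ξ x) * (q ξ 0 : ℂ)) * h1
      + 2 * Complex.I * k * (q ξ 0 : ℂ) * h3
  rw [← hS, forcedPart, map_div₀, ← integral_conj]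
  field_simp

/-- By `psi_sub_mul_phi` the combination of φ and ψ inside f₀ is a(k) times a regular solution, and
a(k) cancels. -/
theorem rho_eq (hu : Admissible u) (h : IsDecayingSol u q C p) {k : ℝ} (hk : k ≠ 0)
    (ha : jostA u k ≠ 0) (h0 : psi u k 0 ≠ 0) :
    rho u q k = (g0 q (-k) - 2 * k * ∫ ξ in Ioi (0 : ℝ), (q ξ 0 : ℂ) * regSol u k ξ) /
      psi u k 0 := by
  have him : (0 : ℝ) ≤ (k : ℂ).im := by simp
  have hk' : (k : ℂ) ≠ 0 := by exact_mod_cast hk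
  have hphi : IntegrableOn (fun ξ => (q ξ 0 : ℂ) * phi u k ξ) (Ioi 0) := by
    simp only [mul_comm (Complex.ofReal _)]
    refine h.integrableOn_mul_x le_rfl (L := 2 * Real.exp (2 * totWeight u))
      (isSol_phi hu k).continuousOn (fun x hx => ?_) h.continuousOn h.bound
    simpa using norm_phi_le hu hx k
  have hpsi : IntegrableOn (fun ξ => (q ξ 0 : ℂ) * psi u k ξ) (Ioi 0) := by
    simp only [mul_comm (Complex.ofReal _)]
    obtain ⟨M, hM, -⟩ := exists_norm_psi_le_linear hu him
    exact h.integrableOn_mul_x le_rfl (isSol_psi hu him).continuousOn hM h.continuousOn h.bound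
  have hS : (∫ ξ in Ioi (0 : ℝ), (q ξ 0 : ℂ) * psi u k ξ)
      - psi u k 0 * (∫ ξ in Ioi (0 : ℝ), (q ξ 0 : ℂ) * phi u k ξ)
      = 2 * Complex.I * k * jostA u k * ∫ ξ in Ioi (0 : ℝ), (q ξ 0 : ℂ) * regSol u k ξ := by
    rw [← integral_const_mul, ← integral_const_mul, ← integral_sub hpsi (hphi.const_mul _)]
    refine setIntegral_congr_fun measurableSet_Ioi fun ξ (hξ : 0 < ξ) => ?_
    linear_combination (q ξ 0 : ℂ) * psi_sub_mul_phi hu him hk' hξ.le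
  have hI := Complex.I_ne_zero
  rw [rho, f0, phi_zero hu]
  field_simp
  linear_combination -hS

namespace IsDecayingSol

theorem sine_representation (hu : Admissible u) (h : IsDecayingSol u q C p)
    (h0 : ∀ k : ℂ, 0 ≤ k.im → psi u k 0 ≠ 0) {c : ℝ}
    (hc : ∀ k : ℂ, 0 ≤ k.im → ‖(psi u k 0)⁻¹‖ ≤ c) {x y : ℝ} (hx : 0 < x) (hy : 0 < y) :
    IntegrableOn (fun l : ℝ => Real.sin (l * y) *
      ((jostRatio u x (Complex.I * l)).re * sineTransform (q 0) l)) (Ioi 0) ∧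
    IntegrableOn (fun t : ℝ => dampedForced u q x y 0 t) (Ioi 0) ∧
    Real.pi / 2 * q x y = (∫ l in Ioi (0 : ℝ), Real.sin (l * y) *
        ((jostRatio u x (Complex.I * l)).re * sineTransform (q 0) l))
      + (∫ t in Ioi (0 : ℝ), dampedForced u q x y 0 t).im := by
  obtain ⟨K, hK⟩ := h.exists_norm_forcedPart_le hu hc hx.le
  have hJ := jostBound_pos u
  have hc0 : 0 ≤ c := (norm_nonneg _).trans (hc 0 le_rfl)
  have hK0 : 0 ≤ K := (norm_nonneg _).trans (hK 0 le_rfl)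
  have hH := h.holCont_forcedPart hu h0 hx.le
  have hΨ := holCont_jostRatio hu h0 hx.le
  have hQ := h.integrableOn_left (x := 0) le_rfl
  have him : ∀ l : ℝ, 0 < l → 0 ≤ (Complex.I * l).im := fun l hl => by simpa using hl.le
  have hX : IntegrableOn (fun l : ℝ => Real.sin (l * y) *
      ((jostRatio u x (Complex.I * l)).re * sineTransform (q 0) l)) (Ioi 0) := by
    refine ((integrableOn_exp_neg_mul hx).const_mul
      (jostBound u * c * ∫ y in Ioi (0 : ℝ), ‖q 0 y‖)).mono' ?_
      ((ae_restrict_iff' measurableSet_Ioi).2 (Eventually.of_forall fun l (hl : 0 < l) => ?_))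
    · have h1 : ContinuousOn (fun l : ℝ => (jostRatio u x (Complex.I * l)).re) (Ioi 0) :=
        Complex.continuous_re.comp_continuousOn (hΨ.cont.comp
          (f := fun l : ℝ => Complex.I * l) (by fun_prop) fun l hl => him l hl)
      have h2 := continuous_sineTransform hQ
      exact ((Continuous.continuousOn (by fun_prop)).mul
        (h1.mul h2.continuousOn)).aestronglyMeasurable measurableSet_Ioi
    · have h1 := (Complex.abs_re_le_norm _).trans (norm_jostRatio_le hu hc hx.le (him l hl))
      have h2 := abs_sineTransform_le hQ l
      have h3 : (Complex.I * (l : ℂ)).im * x = x * l := by simp [mul_comm]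
      rw [h3] at h1
      rw [norm_mul, norm_mul]
      calc _ ≤ 1 * (jostBound u * c * Real.exp (-(x * l)) * ∫ y in Ioi (0 : ℝ), ‖q 0 y‖) :=
            mul_le_mul (Real.abs_sin_le_one _)
              (mul_le_mul h1 h2 (abs_nonneg _) (by positivity)) (by positivity) zero_le_one
        _ = _ := by ring
  -- For ε > 0 the exponential decays along both axes and dominates the merely bounded resolvent
  -- times k.
  have hrot : ∀ ε : ℝ, 0 < ε → IntegrableOn (fun t : ℝ => dampedForced u q x y ε t) (Ioi 0) ∧
      IntegrableOn (fun t : ℝ => dampedForced u q x y ε (Complex.I * t)) (Ioi 0) ∧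
      ∫ t in Ioi (0 : ℝ), dampedForced u q x y ε t
        = Complex.I * ∫ t in Ioi (0 : ℝ), dampedForced u q x y ε (Complex.I * t) := by
    intro ε hε
    refine integral_quadrant_rotate (C := (2 / y + 2 / ε) * K) (half_pos hy) (half_pos hε) ?_
      fun k hre hk => ?_
    · exact (HolCont.of_differentiable (by fun_prop)).mul
        ((HolCont.of_differentiable differentiable_id).mul
          (hH.mono (fun k hk => hk.2) fun k hk => hk.2))
    · rw [dampedForced, norm_mul, norm_mul, norm_exp_damped]
      have h1 := mul_le_mul (norm_le_mul_exp hy hε hre hk) (hK k hk) (norm_nonneg _)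
        (by positivity)
      refine (mul_le_mul_of_nonneg_left h1 (Real.exp_pos _).le).trans_eq ?_
      have h2 : Real.exp (-(ε * k.im) - y * k.re) * (Real.exp (y / 2 * k.re) *
          Real.exp (ε / 2 * k.im)) = Real.exp (-(y / 2 * k.re) - ε / 2 * k.im) := by
        rw [← Real.exp_add, ← Real.exp_add]
        congr 1
        ring
      rw [← h2]
      ring
  -- On the real axis the damping factor e^{iεt} is a phase, so one majorant serves all ε, and ε = 0
  -- is integrable too.
  have hnorm : ∀ ε t : ℝ, ‖dampedForced u q x y ε t‖ = ‖dampedForced u q x y 0 t‖ := by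
    intro ε t
    simp only [dampedForced, norm_mul, norm_exp_damped, Complex.ofReal_im, mul_zero]
  have hmeas : ∀ ε : ℝ, AEStronglyMeasurable (fun t : ℝ => dampedForced u q x y ε t)
      (volume.restrict (Ioi 0)) := fun ε => by
    have h1 : ContinuousOn (fun t : ℝ => forcedPart u q x t) (Ioi 0) :=
      hH.cont.comp (f := fun t : ℝ => (t : ℂ)) (by fun_prop) fun t _ => by
        simp [upperClosed]
    exact ContinuousOn.aestronglyMeasurable (ContinuousOn.mul
      (Continuous.continuousOn (by fun_prop)) (ContinuousOn.mul
      (Continuous.continuousOn (by fun_prop)) h1)) measurableSet_Ioi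
  have hB : IntegrableOn (fun t : ℝ => dampedForced u q x y 0 t) (Ioi 0) :=
    (hrot 1 one_pos).1.norm.mono' (hmeas 0)
      (Eventually.of_forall fun t => (hnorm 1 t).ge)
  refine ⟨hX, hB, ?_⟩
  -- Since the resolvent is real on the imaginary axis, the damped sine term is the imaginary part
  -- of i times the rotated density.
  have hpt : ∀ ε l : ℝ, 0 < l →
      Real.exp (-(ε * l)) * Real.sin (l * y) * sineTransform (q x) l
        = Real.exp (-(ε * l)) * (Real.sin (l * y) *
          ((jostRatio u x (Complex.I * l)).re * sineTransform (q 0) l))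
        + (Complex.I * dampedForced u q x y ε (Complex.I * l)).im := by
    intro ε l hl
    have h1 := congrArg Complex.re (h.sineTransform_eq hu hl.le hx.le (h0 _ (him l hl)))
    have h2 := forcedPart_I_mul_im (q := q) hu hl.le hx.le
    simp only [Complex.ofReal_re, Complex.add_re, Complex.re_mul_ofReal,
      Complex.re_ofReal_mul] at h1
    have h3 : Complex.exp ((Complex.I * ε - y) * (Complex.I * l))
        = (Real.exp (-(ε * l)) : ℝ) * (Real.cos (l * y) - Real.sin (l * y) * Complex.I) := by
      have : (Complex.I * ε - y) * (Complex.I * l)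
          = ((-(ε * l) : ℝ) : ℂ) + ((-(l * y) : ℝ) : ℂ) * Complex.I := by
        push_cast
        linear_combination (ε * l : ℂ) * Complex.I_sq
      rw [this, Complex.exp_add, Complex.exp_mul_I, ← Complex.ofReal_cos, ← Complex.ofReal_sin,
        Real.cos_neg, Real.sin_neg, ← Complex.ofReal_exp]
      push_cast
      ring
    have h4 : forcedPart u q x (Complex.I * l) = ((forcedPart u q x (Complex.I * l)).re : ℂ) :=
      Complex.ext (by simp) (by simp [h2])
    rw [dampedForced, h3, h4, h1]
    have h5 : Complex.I * ((Real.exp (-(ε * l)) : ℝ) *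
        (Real.cos (l * y) - Real.sin (l * y) * Complex.I) *
        (Complex.I * l * ((forcedPart u q x (Complex.I * l)).re : ℂ)))
        = ((-(Real.exp (-(ε * l)) * Real.cos (l * y) * l *
          (forcedPart u q x (Complex.I * l)).re) : ℝ) : ℂ)
        + ((Real.exp (-(ε * l)) * Real.sin (l * y) * l *
          (forcedPart u q x (Complex.I * l)).re : ℝ) : ℂ) * Complex.I := by
      push_cast
      linear_combination ((Complex.exp (-(ε * l)) : ℂ) *
        (Complex.cos (l * y) - Complex.sin (l * y) * Complex.I) *
        (l * ((forcedPart u q x (Complex.I * l)).re : ℂ))) * Complex.I_sq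
    rw [h5, Complex.add_im, Complex.ofReal_im, Complex.im_ofReal_mul, Complex.I_im]
    ring
  -- The even extension in y supplies a function continuous and bounded on ℝ without changing the
  -- transform.
  have hlhs := tendsto_sine_inversion (g := fun y => q x |y|)
    ((h.continuousOn_left hx.le).comp_continuous continuous_abs fun y => abs_nonneg y)
    (IntegrableOn.congr_fun (h.integrableOn_left hx.le) (fun y (hy : 0 < y) => by
      simp only [abs_of_pos hy]) measurableSet_Ioi)
    (fun y => h.abs_le hx.le (abs_nonneg y)) hy
  have hsame : sineTransform (fun y => q x |y|) = sineTransform (q x) := by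
    funext l
    exact setIntegral_congr_fun measurableSet_Ioi fun y (hy : 0 < y) => by
      simp only [abs_of_pos hy]
  simp only [hsame, abs_of_pos hy] at hlhs
  have hexp : ∀ ε l : ℝ, 0 < ε → 0 < l → ‖Real.exp (-(ε * l))‖ ≤ 1 := fun ε l hε hl => by
    rw [Real.norm_of_nonneg (Real.exp_pos _).le, Real.exp_le_one_iff]
    exact neg_nonpos.2 (mul_pos hε hl).le
  have hXε : ∀ ε : ℝ, 0 < ε → IntegrableOn (fun l : ℝ => Real.exp (-(ε * l)) *
      (Real.sin (l * y) * ((jostRatio u x (Complex.I * l)).re * sineTransform (q 0) l)))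
      (Ioi 0) := fun ε hε => by
    refine Integrable.bdd_mul (c := 1) hX (Continuous.aestronglyMeasurable (by fun_prop))
      ((ae_restrict_iff' measurableSet_Ioi).2 (Eventually.of_forall fun l hl => hexp ε l hε hl))
  have hlim1 : Tendsto (fun ε : ℝ => ∫ l in Ioi (0 : ℝ), Real.exp (-(ε * l)) *
      (Real.sin (l * y) * ((jostRatio u x (Complex.I * l)).re * sineTransform (q 0) l)))
      (𝓝[>] 0) (𝓝 (∫ l in Ioi (0 : ℝ), Real.sin (l * y) *
        ((jostRatio u x (Complex.I * l)).re * sineTransform (q 0) l))) := by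
    refine tendsto_integral_filter_of_dominated_convergence _ ?_ ?_ hX.norm ?_
    · filter_upwards [self_mem_nhdsWithin] with ε hε using (hXε ε hε).aestronglyMeasurable
    · filter_upwards [self_mem_nhdsWithin] with ε hε
      refine (ae_restrict_iff' measurableSet_Ioi).2 (Eventually.of_forall fun l hl => ?_)
      rw [norm_mul]
      exact mul_le_of_le_one_left (norm_nonneg _) (hexp ε l hε hl)
    · refine Eventually.of_forall fun l => ?_
      have h1 : Continuous fun ε : ℝ => Real.exp (-(ε * l)) * (Real.sin (l * y) *
          ((jostRatio u x (Complex.I * l)).re * sineTransform (q 0) l)) := by fun_prop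
      simpa using (h1.tendsto 0).mono_left nhdsWithin_le_nhds
  have hlim2 : Tendsto (fun ε : ℝ => ∫ t in Ioi (0 : ℝ), dampedForced u q x y ε t) (𝓝[>] 0)
      (𝓝 (∫ t in Ioi (0 : ℝ), dampedForced u q x y 0 t)) := by
    refine tendsto_integral_filter_of_dominated_convergence _ (Eventually.of_forall hmeas)
      (Eventually.of_forall fun ε => Eventually.of_forall fun t => (hnorm ε t).le) hB.norm
      (Eventually.of_forall fun t => ?_)
    have h1 : Continuous fun ε : ℝ => dampedForced u q x y ε t := by
      unfold dampedForced
      fun_prop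
    exact (h1.tendsto 0).mono_left nhdsWithin_le_nhds
  refine tendsto_nhds_unique hlhs ((hlim1.add
    ((Complex.continuous_im.tendsto _).comp hlim2)).congr' ?_)
  filter_upwards [self_mem_nhdsWithin] with ε hε
  have hε : 0 < ε := hε
  obtain ⟨-, h2, h3⟩ := hrot ε hε
  have h4 : (∫ t in Ioi (0 : ℝ), dampedForced u q x y ε t).im
      = ∫ l in Ioi (0 : ℝ), (Complex.I * dampedForced u q x y ε (Complex.I * l)).im := by
    rw [h3, ← integral_const_mul]
    exact (Complex.imCLM.integral_comp_comm (h2.const_mul Complex.I)).symm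
  have h5 : IntegrableOn (fun l : ℝ => (Complex.I * dampedForced u q x y ε (Complex.I * l)).im)
      (Ioi 0) := (h2.const_mul Complex.I).im
  simp only [Function.comp_apply]
  rw [h4, ← integral_add (hXε ε hε) h5]
  exact (setIntegral_congr_fun measurableSet_Ioi fun l hl => hpt ε l hl).symm

end IsDecayingSol

end QuarterPlane

/-! ### Assembly of the integral representation. -/

namespace QuarterPlane

open Filter Topology

variable {u : ℝ → ℝ} {q : ℝ → ℝ → ℝ} {C p : ℝ}

theorem g0_conj (q : ℝ → ℝ → ℝ) (k : ℂ) :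
    g0 q ((starRingEnd ℂ) k) = (starRingEnd ℂ) (g0 q k) := by
  rw [g0, g0, ← integral_conj]
  simp only [map_mul, ← Complex.exp_conj, Complex.conj_ofReal]

/-- The contribution `e^{-ky} g₀(-k) ψ(x, k) / ψ(0, k)` of the data on `x = 0`. -/
noncomputable def boundaryDensity (u : ℝ → ℝ) (q : ℝ → ℝ → ℝ) (x y : ℝ) (k : ℂ) : ℂ :=
  Complex.exp (-(k * y)) * g0 q (-k) * jostRatio u x k

namespace IsDecayingSol

theorem integrableOn_g0 (h : IsDecayingSol u q C p) {k : ℂ} (hk : k.re ≤ 0) :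
    IntegrableOn (fun y : ℝ => Complex.exp (k * y) * (q 0 y : ℂ)) (Ioi 0) :=
  (h.integrableOn_mul_y le_rfl (Continuous.continuousOn (by fun_prop))
    (fun _ hy => norm_exp_mul_le_one hk hy.le) h.continuousOn h.bound).1

theorem norm_g0_integrand_le {k : ℂ} (hk : k.re ≤ 0) :
    ∀ᵐ y : ℝ ∂volume.restrict (Ioi (0 : ℝ)), ‖Complex.exp (k * y) * (q 0 y : ℂ)‖ ≤ ‖q 0 y‖ :=
  (ae_restrict_iff' measurableSet_Ioi).2 (Eventually.of_forall fun y (hy : 0 < y) => by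
    rw [norm_mul, Complex.norm_real]
    exact mul_le_of_le_one_left (norm_nonneg _) (norm_exp_mul_le_one hk hy.le))

theorem norm_g0_le (h : IsDecayingSol u q C p) {k : ℂ} (hk : k.re ≤ 0) :
    ‖g0 q k‖ ≤ ∫ y in Ioi (0 : ℝ), ‖q 0 y‖ :=
  norm_integral_le_of_norm_le (h.integrableOn_left le_rfl).norm (norm_g0_integrand_le hk)

theorem holCont_g0_neg (h : IsDecayingSol u q C p) :
    HolCont {k : ℂ | 0 < k.re} {k : ℂ | 0 ≤ k.re} fun k => g0 q (-k) := by
  have hneg : ∀ k : ℂ, 0 ≤ k.re → (-k).re ≤ 0 := fun k hk => by simpa using hk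
  refine HolCont.integral (isOpen_lt continuous_const Complex.continuous_re)
    (fun k (hk : 0 < k.re) => hk.le) (fun k hk => (h.integrableOn_g0 (hneg k hk)).aestronglyMeasurable)
    (Eventually.of_forall fun y => HolCont.of_differentiable (by fun_prop)) fun k₀ _ => ?_
  refine ⟨_, (h.integrableOn_left le_rfl).norm, _, self_mem_nhdsWithin,
    (ae_restrict_iff' measurableSet_Ioi).2 (Eventually.of_forall fun y (hy : 0 < y) k hk => ?_)⟩
  rw [norm_mul, Complex.norm_real]
  exact mul_le_of_le_one_left (norm_nonneg _) (norm_exp_mul_le_one (hneg k hk) hy.le)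

/-- No damping is needed here: e^{-ky} decays in Re k and ψ(x,k)/ψ(0,k) decays like e^{-x Im k},
since x > 0. -/
theorem boundaryDensity_rotate (hu : Admissible u) (h : IsDecayingSol u q C p)
    (h0 : ∀ k : ℂ, 0 ≤ k.im → psi u k 0 ≠ 0) {c : ℝ}
    (hc : ∀ k : ℂ, 0 ≤ k.im → ‖(psi u k 0)⁻¹‖ ≤ c) {x y : ℝ} (hx : 0 < x) (hy : 0 < y) :
    IntegrableOn (fun t : ℝ => boundaryDensity u q x y t) (Ioi 0) ∧
    IntegrableOn (fun t : ℝ => boundaryDensity u q x y (Complex.I * t)) (Ioi 0) ∧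
    ∫ t in Ioi (0 : ℝ), boundaryDensity u q x y t
      = Complex.I * ∫ t in Ioi (0 : ℝ), boundaryDensity u q x y (Complex.I * t) := by
  refine integral_quadrant_rotate
    (C := (∫ y in Ioi (0 : ℝ), ‖q 0 y‖) * (jostBound u * c)) hy hx ?_ fun k hre him => ?_
  · exact ((HolCont.of_differentiable (by fun_prop)).mul
      (h.holCont_g0_neg.mono (fun k hk => hk.1) fun k hk => hk.1)).mul
      ((holCont_jostRatio hu h0 hx.le).mono (fun k hk => hk.2) fun k hk => hk.2)
  · have h1 := h.norm_g0_le (k := -k) (by simpa using hre)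
    have h2 := norm_jostRatio_le hu hc hx.le him
    have h3 : ‖Complex.exp (-(k * y))‖ = Real.exp (-(y * k.re)) := by
      rw [Complex.norm_exp]
      simp [mul_comm]
    have h4 : Real.exp (-(y * k.re) - x * k.im)
        = Real.exp (-(y * k.re)) * Real.exp (-(k.im * x)) := by
      rw [← Real.exp_add]
      congr 1
      ring
    rw [boundaryDensity, norm_mul, norm_mul, h3, h4]
    calc _ ≤ Real.exp (-(y * k.re)) * (∫ y in Ioi (0 : ℝ), ‖q 0 y‖) *
          (jostBound u * c * Real.exp (-(k.im * x))) :=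
          mul_le_mul (mul_le_mul_of_nonneg_left h1 (Real.exp_pos _).le) h2 (norm_nonneg _)
            (mul_nonneg (Real.exp_pos _).le ((norm_nonneg _).trans h1))
      _ = _ := by ring

theorem realAxisIntegrand_eq (hu : Admissible u) (h : IsDecayingSol u q C p)
    (ha : ∀ k : ℂ, k ≠ 0 → 0 ≤ k.im → jostA u k ≠ 0)
    (h0 : ∀ k : ℂ, 0 ≤ k.im → psi u k 0 ≠ 0) {x : ℝ} (hx : 0 ≤ x) (y : ℝ) {k : ℝ} (hk : 0 < k) :
    realAxisIntegrand u q x y k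
      = (boundaryDensity u q x y k - (starRingEnd ℂ) (boundaryDensity u q x y k))
        - 2 * (dampedForced u q x y 0 k - (starRingEnd ℂ) (dampedForced u q x y 0 k)) := by
  have him : (0 : ℝ) ≤ (k : ℂ).im := by simp
  have hψ := h0 k him
  have hψ' : (starRingEnd ℂ) (psi u k 0) ≠ 0 := (map_ne_zero _).2 hψ
  have hF := forcedPart_sub_conj hu h hψ hx
  have hJ := psi_mul_conj_sub hu k hx
  have hρ := rho_eq hu h hk.ne' (ha k (by exact_mod_cast hk.ne') him) hψ
  have hg : (starRingEnd ℂ) (g0 q (-k)) = g0 q (-k) := by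
    rw [← g0_conj]
    simp
  have hS : (starRingEnd ℂ) (∫ ξ in Ioi (0 : ℝ), (q ξ 0 : ℂ) * regSol u k ξ)
      = ∫ ξ in Ioi (0 : ℝ), (q ξ 0 : ℂ) * regSol u k ξ := by
    rw [← integral_conj]
    refine setIntegral_congr_fun measurableSet_Ioi fun ξ (hξ : 0 < ξ) => ?_
    simp only [map_mul, Complex.conj_ofReal, conj_regSol_ofReal hu k hξ.le]
  have he : (starRingEnd ℂ) (Complex.exp (-(k * y))) = Complex.exp (-(k * y)) := by
    rw [← Complex.exp_conj]
    simp
  have hd : dampedForced u q x y 0 k = Complex.exp (-(k * y)) * (k * forcedPart u q x k) := by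
    rw [dampedForced]
    congr 2
    push_cast
    ring
  rw [realAxisIntegrand, hρ, hd, boundaryDensity, jostRatio]
  simp only [map_mul, map_div₀, map_sub, map_ofNat, Complex.conj_ofReal, hg, hS, he]
  set S := ∫ ξ in Ioi (0 : ℝ), (q ξ 0 : ℂ) * regSol u k ξ
  have hF' : forcedPart u q x k = (starRingEnd ℂ) (forcedPart u q x k)
      + (psi u k x * (starRingEnd ℂ) (psi u k 0) - (starRingEnd ℂ) (psi u k x) * psi u k 0) * S /
        (psi u k 0 * (starRingEnd ℂ) (psi u k 0)) := by
    rw [hJ, ← hF]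
    ring
  generalize (starRingEnd ℂ) (forcedPart u q x k) = D at hF' ⊢
  rw [hF']
  field_simp
  ring

/-- Exchanging g₀(il) and g₀(-il) between the two exponentials costs (e^{-ily} - e^{ily})(g₀(il) -
g₀(-il)) = (-2i sin ly)(2i Q) = 4 sin(ly) Q, with Q the sine transform of q(0,·). -/
theorem imagAxisIntegrand_eq (hu : Admissible u) (h : IsDecayingSol u q C p) {x : ℝ} (hx : 0 ≤ x)
    (y : ℝ) {l : ℝ} (hl : 0 ≤ l) :
    imagAxisIntegrand u q x y (Complex.I * l)
      = (boundaryDensity u q x y (Complex.I * l)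
          + (starRingEnd ℂ) (boundaryDensity u q x y (Complex.I * l)))
        + 4 * ((Real.sin (l * y) *
          ((jostRatio u x (Complex.I * l)).re * sineTransform (q 0) l) : ℝ) : ℂ) := by
  have hr := conj_jostRatio_I_mul hu hl hx
  have hr' : ((jostRatio u x (Complex.I * l)).re : ℂ) = jostRatio u x (Complex.I * l) :=
    Complex.conj_eq_iff_re.1 hr
  have hg : (starRingEnd ℂ) (g0 q (-(Complex.I * l))) = g0 q (Complex.I * l) := by
    rw [← g0_conj]
    simp
  have he : (starRingEnd ℂ) (Complex.exp (-(Complex.I * l * y)))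
      = Complex.exp (Complex.I * l * y) := by
    rw [← Complex.exp_conj]
    simp
  have hsin : ∀ η : ℝ, Complex.exp (Complex.I * l * η) - Complex.exp (-(Complex.I * l) * η)
      = 2 * Complex.I * (Real.sin (l * η) : ℝ) := by
    intro η
    have e1 : Complex.I * l * η = (l * η : ℝ) * Complex.I := by push_cast; ring
    have e2 : -(Complex.I * l) * η = (-(l * η) : ℝ) * Complex.I := by push_cast; ring
    rw [e1, e2, Complex.exp_mul_I, Complex.exp_mul_I, ← Complex.ofReal_cos, ← Complex.ofReal_sin,
      ← Complex.ofReal_cos, ← Complex.ofReal_sin, Real.cos_neg, Real.sin_neg]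
    push_cast
    ring
  have hQ : g0 q (Complex.I * l) - g0 q (-(Complex.I * l))
      = 2 * Complex.I * (sineTransform (q 0) l : ℂ) := by
    rw [g0, g0, ← integral_sub (h.integrableOn_g0 (by simp)) (h.integrableOn_g0 (by simp)),
      sineTransform, ← integral_complex_ofReal, ← integral_const_mul]
    congr 1 with η
    rw [← sub_mul, hsin]
    push_cast
    ring
  have hy := hsin y
  rw [neg_mul] at hy
  rw [imagAxisIntegrand, boundaryDensity]
  simp only [map_mul, hr, hg, he, Complex.ofReal_mul, hr']
  rw [← jostRatio]
  linear_combination jostRatio u x (Complex.I * l) *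
    ((Complex.exp (-(Complex.I * l * y)) - Complex.exp (Complex.I * l * y)) * hQ
      - 2 * Complex.I * (sineTransform (q 0) l : ℂ) * hy
      - 4 * (sineTransform (q 0) l : ℂ) * (Real.sin (l * y) : ℝ) * Complex.I_sq)

theorem integral_representation (hu : Admissible u) (h : IsDecayingSol u q C p)
    (ha : ∀ k : ℂ, k ≠ 0 → 0 ≤ k.im → jostA u k ≠ 0) {x y : ℝ} (hx : 0 < x) (hy : 0 < y) :
    IntegrableOn (fun k : ℝ => realAxisIntegrand u q x y (k : ℂ)) (Ioi 0) ∧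
      IntegrableOn (fun l : ℝ => imagAxisIntegrand u q x y (Complex.I * l)) (Ioi 0) ∧
      (q x y : ℂ) =
        -(1 / (2 * Complex.I * Real.pi)) *
            (∫ k in Ioi (0 : ℝ), realAxisIntegrand u q x y (k : ℂ))
          + 1 / (2 * Complex.I * Real.pi) *
            (∫ l in Ioi (0 : ℝ), imagAxisIntegrand u q x y (Complex.I * l) * Complex.I) := by
  have h0 : ∀ k : ℂ, 0 ≤ k.im → psi u k 0 ≠ 0 := fun k hk => psi_zero_ne_zero hu ha hk
  obtain ⟨c, -, hc⟩ := exists_norm_inv_psi_zero_le hu ha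
  obtain ⟨hX, hB, hq⟩ := h.sine_representation hu h0 hc hx hy
  obtain ⟨hA, hA', hAA⟩ := h.boundaryDensity_rotate hu h0 hc hx hy
  have hconj : ∀ {f : ℝ → ℂ}, IntegrableOn f (Ioi 0) →
      IntegrableOn (fun t => (starRingEnd ℂ) (f t)) (Ioi 0) := fun hf =>
    Complex.conjCLE.toContinuousLinearMap.integrable_comp hf
  have hXc : IntegrableOn (fun l : ℝ => 4 * ((Real.sin (l * y) *
      ((jostRatio u x (Complex.I * l)).re * sineTransform (q 0) l) : ℝ) : ℂ)) (Ioi 0) :=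
    (hX.ofReal (𝕜 := ℂ)).const_mul 4
  have hreal : ∀ k ∈ Ioi (0 : ℝ), _ = realAxisIntegrand u q x y k := fun k hk =>
    (h.realAxisIntegrand_eq hu ha h0 hx.le y hk).symm
  have himag : ∀ l ∈ Ioi (0 : ℝ), _ = imagAxisIntegrand u q x y (Complex.I * l) := fun l hl =>
    (h.imagAxisIntegrand_eq hu hx.le y (le_of_lt hl)).symm
  have iA : IntegrableOn (fun t : ℝ => boundaryDensity u q x y t
      - (starRingEnd ℂ) (boundaryDensity u q x y t)) (Ioi 0) := hA.sub (hconj hA)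
  have iB : IntegrableOn (fun t : ℝ => 2 * (dampedForced u q x y 0 t
      - (starRingEnd ℂ) (dampedForced u q x y 0 t))) (Ioi 0) := (hB.sub (hconj hB)).const_mul 2
  have iA' : IntegrableOn (fun t : ℝ => boundaryDensity u q x y (Complex.I * t)
      + (starRingEnd ℂ) (boundaryDensity u q x y (Complex.I * t))) (Ioi 0) := hA'.add (hconj hA')
  refine ⟨IntegrableOn.congr_fun (iA.sub iB) hreal measurableSet_Ioi,
    IntegrableOn.congr_fun (iA'.add hXc) himag measurableSet_Ioi, ?_⟩
  have e1 : ∫ k in Ioi (0 : ℝ), realAxisIntegrand u q x y (k : ℂ)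
      = ((∫ t in Ioi (0 : ℝ), boundaryDensity u q x y t)
        - (starRingEnd ℂ) (∫ t in Ioi (0 : ℝ), boundaryDensity u q x y t))
        - 2 * ((∫ t in Ioi (0 : ℝ), dampedForced u q x y 0 t)
        - (starRingEnd ℂ) (∫ t in Ioi (0 : ℝ), dampedForced u q x y 0 t)) := by
    rw [← setIntegral_congr_fun measurableSet_Ioi hreal, integral_sub iA iB,
      integral_sub hA (hconj hA), integral_const_mul, integral_sub hB (hconj hB), integral_conj,
      integral_conj]
  have e2 : ∫ l in Ioi (0 : ℝ), imagAxisIntegrand u q x y (Complex.I * l) * Complex.I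
      = ((∫ t in Ioi (0 : ℝ), boundaryDensity u q x y (Complex.I * t))
        + (starRingEnd ℂ) (∫ t in Ioi (0 : ℝ), boundaryDensity u q x y (Complex.I * t))
        + 4 * ((∫ l in Ioi (0 : ℝ), Real.sin (l * y) *
          ((jostRatio u x (Complex.I * l)).re * sineTransform (q 0) l) : ℝ) : ℂ)) *
          Complex.I := by
    rw [integral_mul_const, ← setIntegral_congr_fun measurableSet_Ioi himag,
      integral_add iA' hXc, integral_add hA' (hconj hA'), integral_const_mul, integral_conj,
      integral_complex_ofReal]
  have e3 : ∀ z : ℂ, z - (starRingEnd ℂ) z = 2 * Complex.I * z.im := fun z => by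
    rw [Complex.sub_conj]
    push_cast
    ring
  generalize (∫ l in Ioi (0 : ℝ), Real.sin (l * y) *
    ((jostRatio u x (Complex.I * l)).re * sineTransform (q 0) l)) = X at hq e2
  have hqc := congrArg Complex.ofReal hq
  push_cast at hqc
  have hpi : (Real.pi : ℂ) ≠ 0 := by exact_mod_cast Real.pi_ne_zero
  have hI := Complex.I_ne_zero
  -- If A and A' are the integrals of the boundary density along the real and imaginary axes, A =
  -- iA' gives A - conj A = i(A' + conj A'), so these terms cancel between the two axes and `hq`
  -- remains.
  rw [e1, e2, hAA, e3 (∫ t in Ioi (0 : ℝ), dampedForced u q x y 0 t), map_mul, Complex.conj_I]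
  field_simp
  linear_combination 4 * hqc

end IsDecayingSol

end QuarterPlane

/-! ### Reduction to a potential continuous on the whole line. -/

namespace QuarterPlane

open Filter Topology

variable {u v : ℝ → ℝ}

/-- The defining predicate sees u only on [0, ∞), so equal predicates make `Classical.epsilon`
choose the same function, even at negative arguments. -/
theorem phi_congr (h : EqOn u v (Ici 0)) : phi u = phi v := by
  have : IsPhi u = IsPhi v := by
    funext k f
    refine propext (and_congr_right fun _ => forall₂_congr fun x hx => ?_)
    have : ∫ ξ in (0 : ℝ)..x, sinKernel k (x - ξ) * (u ξ : ℂ) * f ξ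
        = ∫ ξ in (0 : ℝ)..x, sinKernel k (x - ξ) * (v ξ : ℂ) * f ξ :=
      intervalIntegral.integral_congr fun ξ hξ => by
        rw [uIcc_of_le hx] at hξ
        simp only [h hξ.1]
    rw [this]
  funext k
  rw [phi, phi, this]

theorem psi_congr (h : EqOn u v (Ici 0)) : psi u = psi v := by
  have : IsPsi u = IsPsi v := by
    funext k f
    refine propext (and_congr_right fun _ => and_congr_right fun _ =>
      forall₂_congr fun x hx => ?_)
    have : ∫ ξ in Ioi x, sinKernel k (x - ξ) * (u ξ : ℂ) * f ξ
        = ∫ ξ in Ioi x, sinKernel k (x - ξ) * (v ξ : ℂ) * f ξ :=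
      setIntegral_congr_fun measurableSet_Ioi fun ξ (hξ : x < ξ) => by
        simp only [h (hx.trans hξ.le : (0 : ℝ) ≤ ξ)]
    rw [this]
  funext k
  rw [psi, psi, this]

/-- The even extension is continuous on ℝ, and 1 + x ≤ 2(1 + x²) passes from the second moment to
the first. -/
theorem Admissible.comp_abs (hu : ContinuousOn u (Ici 0))
    (hu_decay : IntegrableOn (fun x : ℝ => (1 + x ^ 2) * |u x|) (Ioi 0)) :
    Admissible fun x => u |x| := by
  have hc : Continuous fun x : ℝ => u |x| :=
    hu.comp_continuous continuous_abs fun x => abs_nonneg x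
  refine ⟨hc, (hu_decay.const_mul 2).mono' ?_ ?_⟩
  · exact ((continuous_const.add continuous_id).mul hc.abs).aestronglyMeasurable
  · refine (ae_restrict_iff' measurableSet_Ioi).2 (Eventually.of_forall fun x (hx : 0 < x) => ?_)
    rw [Real.norm_of_nonneg (by positivity), abs_of_pos hx, ← mul_assoc]
    exact mul_le_mul_of_nonneg_right (by nlinarith [sq_nonneg (x - 1)]) (abs_nonneg _)

theorem HasDecay.exists_isDecayingSol {q : ℝ → ℝ → ℝ} (hq_decay : HasDecay q)
    (hq_smooth : ContDiffOn ℝ 2 (fun z : ℝ × ℝ => q z.1 z.2) (Ici 0 ×ˢ Ici 0))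
    (hq : SolvesPDE u q) : ∃ C p, IsDecayingSol u q C p := by
  obtain ⟨C, p, hp, hb⟩ := hq_decay
  have hC : 0 ≤ C := by
    have := hb 0 0 le_rfl le_rfl
    rw [add_zero, add_zero, Real.one_rpow, mul_one] at this
    exact le_trans (by positivity) this
  refine ⟨C, p, hq_smooth, hq, hC, hp, fun x y hx hy => ?_, fun x y hx hy => ?_,
    fun x y hx hy => ?_⟩ <;>
  linarith [hb x y hx hy, abs_nonneg (q x y), abs_nonneg (partialX q x y),
    abs_nonneg (partialY q x y)]

end QuarterPlane

theorem proposition3p1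
    (u : ℝ → ℝ) (hu : ContinuousOn u (Ici 0))
    (hu_decay : IntegrableOn (fun x : ℝ => (1 + x ^ 2) * |u x|) (Ioi 0))
    (ha : ∀ k : ℂ, k ≠ 0 → 0 ≤ k.im → jostA u k ≠ 0)
    (q : ℝ → ℝ → ℝ)
    (hq_smooth : ContDiffOn ℝ 2 (fun z : ℝ × ℝ => q z.1 z.2) (Ici 0 ×ˢ Ici 0))
    (hq_decay : HasDecay q)
    (hq : SolvesPDE u q) :
    -- the denominators in the representation do not vanish
    (∀ k : ℂ, 0 ≤ k.im → psi u k 0 ≠ 0) ∧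
    -- integral representation; `k = i l`, `dk = i dl` on the imaginary axis
    (∀ x y : ℝ, 0 < x → 0 < y →
      IntegrableOn (fun k : ℝ => realAxisIntegrand u q x y (k : ℂ)) (Ioi 0) ∧
      IntegrableOn (fun l : ℝ => imagAxisIntegrand u q x y (Complex.I * l)) (Ioi 0) ∧
      (q x y : ℂ) =
        -(1 / (2 * Complex.I * Real.pi)) *
            (∫ k in Ioi (0 : ℝ), realAxisIntegrand u q x y (k : ℂ))
          + 1 / (2 * Complex.I * Real.pi) *
            (∫ l in Ioi (0 : ℝ), imagAxisIntegrand u q x y (Complex.I * l) * Complex.I)) ∧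
    -- global relation for `φ`: `Re k ≤ 0`, whenever the integrals along `y = 0` converge
    (∀ k : ℂ, k.re ≤ 0 →
      IntegrableOn (fun x : ℝ => Real.exp (|k.im| * x) * q x 0) (Ioi 0) →
      IntegrableOn (fun x : ℝ => Real.exp (|k.im| * x) * partialY q x 0) (Ioi 0) →
      IntegrableOn (fun x : ℝ => (k * q x 0 - partialY q x 0) * phi u k x) (Ioi 0) ∧
      IntegrableOn (fun y : ℝ => Complex.exp (k * y) *
        (q 0 y * phiX0 u k - partialX q 0 y * phi u k 0)) (Ioi 0) ∧
      (∫ x in Ioi (0 : ℝ), (k * q x 0 - partialY q x 0) * phi u k x)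
        + (∫ y in Ioi (0 : ℝ), Complex.exp (k * y) *
            (q 0 y * phiX0 u k - partialX q 0 y * phi u k 0)) = 0) ∧
    -- global relation for `ψ`: `Im k ≥ 0`, whenever the integrals along `x = 0` converge
    (∀ k : ℂ, 0 ≤ k.im →
      IntegrableOn (fun y : ℝ => Real.exp (max k.re 0 * y) * q 0 y) (Ioi 0) →
      IntegrableOn (fun y : ℝ => Real.exp (max k.re 0 * y) * partialX q 0 y) (Ioi 0) →
      IntegrableOn (fun x : ℝ => (k * q x 0 - partialY q x 0) * psi u k x) (Ioi 0) ∧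
      IntegrableOn (fun y : ℝ => Complex.exp (k * y) *
        (q 0 y * psiX0 u k - partialX q 0 y * psi u k 0)) (Ioi 0) ∧
      (∫ x in Ioi (0 : ℝ), (k * q x 0 - partialY q x 0) * psi u k x)
        + (∫ y in Ioi (0 : ℝ), Complex.exp (k * y) *
            (q 0 y * psiX0 u k - partialX q 0 y * psi u k 0)) = 0) := by
  -- From here u is replaced by its even extension, which leaves every object in the statement
  -- unchanged.
  have heq : EqOn u (fun x => u |x|) (Ici 0) := fun x (hx : 0 ≤ x) => by
    simp only [abs_of_nonneg hx]
  have hphi := phi_congr heq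
  have hpsi := psi_congr heq
  have hphiX : phiX0 u = phiX0 fun x => u |x| := funext fun k => by rw [phiX0, phiX0, hphi]
  have hpsiX : psiX0 u = psiX0 fun x => u |x| := funext fun k => by rw [psiX0, psiX0, hpsi]
  have hjost : jostA u = jostA fun x => u |x| := funext fun k => by
    rw [jostA, jostA, hphi, hpsi, hphiX, hpsiX]
  have hrho : rho u q = rho (fun x => u |x|) q := funext fun k => by
    rw [rho, rho, f0, f0, hjost, hphi, hpsi]
  have hreal : realAxisIntegrand u q = realAxisIntegrand (fun x => u |x|) q := by
    funext x y k
    rw [realAxisIntegrand, realAxisIntegrand, hrho, hpsi]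
  have himag : imagAxisIntegrand u q = imagAxisIntegrand (fun x => u |x|) q := by
    funext x y k
    rw [imagAxisIntegrand, imagAxisIntegrand, hpsi]
  have hadm := Admissible.comp_abs hu hu_decay
  have hpde : SolvesPDE (fun x => u |x|) q := fun x y hx hy => by
    simpa only [abs_of_pos hx] using hq x y hx hy
  obtain ⟨C, p, h⟩ := hq_decay.exists_isDecayingSol hq_smooth hpde
  rw [hjost] at ha
  rw [hphi, hpsi, hphiX, hpsiX, hreal, himag]
  exact ⟨fun k hk => psi_zero_ne_zero hadm ha hk,
    fun x y hx hy => h.integral_representation hadm ha hx hy,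
    fun k hk h1 h2 => h.global_relation_phi hadm hk h1 h2,
    fun k hk h1 h2 => h.global_relation_psi hadm hk h1 h2⟩
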